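/- Let $J,R$ be non-negative integers and let $G$ be a finite group of Jordan size at most $(J,R)$, i.e. $G$ contains a normal abelian subgroup $A$ that can be generated by at most $R$ elements and satisfies $\mathrm{card}(G/A)\le J$. Let $S_g$ be a closed orientable surface of genus $g$. If $g\ge J+R+1$, then every homomorphism $\rho:\pi_1(S_g)\to G$ is a stabilization. Here $\rho$ is called a stabilization if $S_g$ can be written as a connected sum $S_g=S_{g_1}\# S_{g_2}$ of closed orientable surfaces of genera $g_1\ge 0$ and $g_2\ge 1$ with $g_1+g_2=g$, in such a way that there is a homomorphism $\rho':\pi_1(S_{g_1})\to G$ satisfying: with a base point on the curve along which the sum is done (and $\rho$ transported to it along some path), $\rho$ coincides with $\rho'$ on the fundamental group of the piece $S_{g_1}^*$ ($S_{g_1}$ minus an open disk), i.e. $\rho\circ(S_{g_1}^*\hookrightarrow S_g)_*=\rho'\circ(S_{g_1}^*\hookrightarrow S_{g_1})_*$, and $\rho$ is trivial on the fundamental group of the piece $S_{g_2}^*$ ($S_{g_2}$ minus an open disk). -/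

import Mathlib

noncomputable section

/-- The closed unit disk of the complex plane. -/
abbrev ClosedDisk : Type := {z : ℂ // ‖z‖ ≤ 1}

/-- The point `exp (2πi (k + t) / n)` of the boundary circle: the point with parameter `t ∈ [0,1]`
on the `k`-th side of the disk regarded as an `n`-gon (sides run counterclockwise). -/
def sidePoint (n k : ℕ) (t : unitInterval) : ClosedDisk :=
  ⟨Complex.exp (((2 * Real.pi * ((k + (t : ℝ)) / n) : ℝ) : ℂ) * Complex.I), by
    rw [Complex.norm_exp_ofReal_mul_I]⟩

/-- The side identifications of the `4g`-gon with boundary word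
`a₁ b₁ a₁⁻¹ b₁⁻¹ ⋯ a_g b_g a_g⁻¹ b_g⁻¹`. For `g = 0` the boundary word is empty and the whole
boundary circle is collapsed to a point, which gives the sphere. -/
inductive SideGluing (g : ℕ) : ClosedDisk → ClosedDisk → Prop
  | a (i : Fin g) (t : unitInterval) :
      SideGluing g (sidePoint (4 * g) (4 * i) t)
        (sidePoint (4 * g) (4 * i + 2) (unitInterval.symm t))
  | b (i : Fin g) (t : unitInterval) :
      SideGluing g (sidePoint (4 * g) (4 * i + 1) t)
        (sidePoint (4 * g) (4 * i + 3) (unitInterval.symm t))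
  | collapse (hg : g = 0) (z w : ClosedDisk) (hz : ‖(z : ℂ)‖ = 1) (hw : ‖(w : ℂ)‖ = 1) :
      SideGluing g z w

/-- The standard closed orientable surface of genus `g`, as a quotient space of the disk by the
equivalence relation generated by the side identifications. -/
abbrev StandardSurface (g : ℕ) : Type := Quot (SideGluing g)

/-- `S` is a closed (orientable) surface of genus `g`. -/
def IsClosedSurface (g : ℕ) (S : Type*) [TopologicalSpace S] : Prop :=
  Nonempty (S ≃ₜ StandardSurface g)

/-- The space `M` with the open disk `d({‖z‖ < 1})` removed. -/
abbrev RemoveDisk {M : Type*} (d : ClosedDisk → M) : Type _ :=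
  {m : M // m ∉ d '' {z | ‖(z : ℂ)‖ < 1}}

/-- The point `d z` of the boundary curve of `M` minus an open disk, for `z` on the unit circle. -/
def RemoveDisk.boundary {M : Type*} (d : ClosedDisk → M) (hd : Function.Injective d)
    (z : ClosedDisk) (hz : ‖(z : ℂ)‖ = 1) : RemoveDisk d :=
  ⟨d z, by
    rintro ⟨w, hw, hwz⟩
    obtain rfl := hd hwz
    exact absurd hz (ne_of_lt hw)⟩

/-- A way of writing the surface `S` as the connected sum `M # N`: embedded closed disks in `M` and
`N`, and embeddings into `S` of the complements of the corresponding open disks, whose images cover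
`S` and meet exactly along the two boundary circles, where they are glued by `dM z ∼ dN z`. -/
structure ConnectedSumDecomposition (S M N : Type*) [TopologicalSpace S] [TopologicalSpace M]
    [TopologicalSpace N] where
  dM : ClosedDisk → M
  dN : ClosedDisk → N
  isEmbedding_dM : Topology.IsEmbedding dM
  isEmbedding_dN : Topology.IsEmbedding dN
  iM : C(RemoveDisk dM, S)
  iN : C(RemoveDisk dN, S)
  isEmbedding_iM : Topology.IsEmbedding iM
  isEmbedding_iN : Topology.IsEmbedding iN
  glue : ∀ (z : ClosedDisk) (hz : ‖(z : ℂ)‖ = 1),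
    iM (RemoveDisk.boundary dM isEmbedding_dM.injective z hz) =
      iN (RemoveDisk.boundary dN isEmbedding_dN.injective z hz)
  cover : Set.range iM ∪ Set.range iN = Set.univ
  inter : ∀ p q, iM p = iN q → ∃ z : ClosedDisk, ‖(z : ℂ)‖ = 1 ∧ (p : M) = dM z ∧ (q : N) = dN z

namespace ConnectedSumDecomposition

variable {S M N : Type*} [TopologicalSpace S] [TopologicalSpace M] [TopologicalSpace N]
  (D : ConnectedSumDecomposition S M N)

/-- The base point on the boundary curve of the first piece. -/
def baseM : RemoveDisk D.dM :=
  RemoveDisk.boundary D.dM D.isEmbedding_dM.injective ⟨1, by simp⟩ (by simp)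

/-- The base point on the boundary curve of the second piece. -/
def baseN : RemoveDisk D.dN :=
  RemoveDisk.boundary D.dN D.isEmbedding_dN.injective ⟨1, by simp⟩ (by simp)

/-- The base point of `S` on the curve along which the sum is done. -/
def base : S := D.iM D.baseM

lemma iN_baseN : D.iN D.baseN = D.base := (D.glue _ _).symm

/-- The inclusion of `M` minus an open disk into `M`. -/
def inclM : C(RemoveDisk D.dM, M) := ⟨Subtype.val, continuous_subtype_val⟩

end ConnectedSumDecomposition

/-- A representation `ρ : π₁(S, x) → G` of the fundamental group of a closed surface of genus `g` is
a stabilization if `S = S_{g₁} # S_{g₂}` with `g₂ ≥ 1`, and `ρ` is equal to some representation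
`ρ' : π₁(S_{g₁}) → G` on the first piece and is trivial on the second piece. The path `w` is the
change of base point from `x` to a point of the curve along which the sum is done. -/
def IsStabilization (g : ℕ) {S : Type*} [TopologicalSpace S] {x : S} {G : Type*} [Group G]
    (ρ : FundamentalGroup S x →* G) : Prop :=
  ∃ g₁ g₂ : ℕ, g₁ + g₂ = g ∧ 1 ≤ g₂ ∧
    ∃ (D : ConnectedSumDecomposition S (StandardSurface g₁) (StandardSurface g₂))
      (w : Path x D.base) (ρ' : FundamentalGroup (StandardSurface g₁) (D.inclM D.baseM) →* G),
      (∀ γ : FundamentalGroup (RemoveDisk D.dM) D.baseM,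
        ρ ((FundamentalGroup.fundamentalGroupMulEquivOfPath w).symm
          (FundamentalGroup.map D.iM D.baseM γ)) =
            ρ' (FundamentalGroup.map D.inclM D.baseM γ)) ∧
      (∀ γ : FundamentalGroup (RemoveDisk D.dN) D.baseN,
        ρ ((FundamentalGroup.fundamentalGroupMulEquivOfPath w).symm
          (FundamentalGroup.mapOfEq D.iN D.iN_baseN γ)) = 1)

/-- The finite group `G` has Jordan size at most `(J, R)`: it has a normal abelian subgroup `A` of
rank (minimal number of generators) at most `R` with `card (G / A) ≤ J`. -/
def HasJordanSizeAtMost (G : Type*) [Group G] [Finite G] (J R : ℕ) : Prop :=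
  ∃ A : Subgroup G, A.Normal ∧ (∀ a ∈ A, ∀ b ∈ A, a * b = b * a) ∧
    Group.rank A ≤ R ∧ Nat.card (G ⧸ A) ≤ J

end

/-! A surface of genus g ≥ 1 is a 4g-gon with its sides identified, so a representation is recorded
by a list of g pairs in G, the values on the two standard curves of each handle. Cutting the polygon
and pasting it differently changes the list by elementary moves, while the surface and the
representation stay the same. As soon as some handle has values (1, 1), it can be split off as a
torus summand on which the representation is trivial. It thus has to be shown that moves produce
such a handle, and that a trivial handle gives a stabilization in the strict topological sense.

Algebra. Let Q be a finite group and let there be at least |Q| handles with values in Q. By the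
pigeonhole principle two partial products of the first values agree, so a block of consecutive
handles has product one; moves collect this product in one handle, which becomes (1, b). If b lies
in the subgroup generated by the other handles, sliding over them kills b; otherwise the other
handles generate a smaller subgroup and induction applies (`HandleRel.exists_trivial_handle`). For Q
= G/A and J + R handles this gives R + 1 handles trivial modulo A. The moves lift to G
(`HandleRel.lift`), so R + 1 handles have values in A. The Euclidean algorithm confines one
generator of A after the other to a single handle, which leaves a trivial handle over
(`HandleRel.exists_trivial_handle_of_comm`).

Topology. Representations are replaced by homomorphisms of the fundamental groupoid to G
(`PathHom`), which have values on all sides and spokes of a polygon, without regard to a base point.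
The polygon is divided into triangular sectors around its center. One cut-and-paste step is an
explicit homeomorphism (`SectorSurface.exists_gate`), and every handle move is a composition of such
steps (`HandlesPresent.of_step`). Opening a lens along a spoke shows that the product of two words
gives a connected sum (`exists_connectedSumDecomposition`). If all labels of the second word are 1,
a change of trivialization makes the homomorphism trivial on all paths of the second piece
(`SectorSurface.exists_gauge`, `SectorSurface.eq_one_of_sectors`). By a van Kampen argument
(`PathHom.exists_glue`) it then extends over the disk which replaces this piece, and this extension
is ρ'. -/

/-! ### Elementary moves on handle values, and trivial handles in finite groups. -/

section HandleMoves

open Relation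
open scoped commutatorElement

variable {G : Type*} [Group G]

/-- A pair of group elements stands for the values of a representation on the two standard curves of
a handle. The Dehn twist which multiplies the first value by the second. -/
def twistFst : Equiv.Perm (G × G) where
  toFun h := (h.1 * h.2, h.2)
  invFun h := (h.1 * h.2⁻¹, h.2)
  left_inv h := by simp
  right_inv h := by simp

/-- The Dehn twist which multiplies the second value by the inverse of the first. -/
def twistSnd : Equiv.Perm (G × G) where
  toFun h := (h.1, h.2 * h.1⁻¹)
  invFun h := (h.1, h.2 * h.1)
  left_inv h := by simp
  right_inv h := by simp

/-- Interchange of two neighbouring handles. -/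
def handleComm : Equiv.Perm ((G × G) × (G × G)) where
  toFun p := (p.2, (⁅p.2.1, p.2.2⁆⁻¹ * p.1.1 * ⁅p.2.1, p.2.2⁆,
    ⁅p.2.1, p.2.2⁆⁻¹ * p.1.2 * ⁅p.2.1, p.2.2⁆))
  invFun p := ((⁅p.1.1, p.1.2⁆ * p.2.1 * ⁅p.1.1, p.1.2⁆⁻¹,
    ⁅p.1.1, p.1.2⁆ * p.2.2 * ⁅p.1.1, p.1.2⁆⁻¹), p.1)
  left_inv p := by ext <;> simp [commutatorElement_def, mul_assoc]
  right_inv p := by ext <;> simp [commutatorElement_def, mul_assoc]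

/-- Slide of a handle over its neighbour. -/
def handleSlide : Equiv.Perm ((G × G) × (G × G)) where
  toFun p := ((p.1.2⁻¹ * p.2.1, p.2.2),
    (p.2.2 * (p.1.2⁻¹ * p.2.1 * p.2.2 * (p.1.2⁻¹ * p.2.1)⁻¹)⁻¹ * p.1.1 * p.2.2⁻¹,
      p.2.2 * p.1.2 * p.2.2⁻¹))
  invFun q := ((q.1.1 * q.1.2 * q.1.1⁻¹ * q.1.2⁻¹ * q.2.1 * q.1.2, q.1.2⁻¹ * q.2.2 * q.1.2),
    (q.1.2⁻¹ * q.2.2 * q.1.2 * q.1.1, q.1.2))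
  left_inv p := by simp [mul_assoc]
  right_inv p := by simp [mul_assoc]

/-- An elementary move on the list of values of a representation on the handles of a surface. -/
inductive HandleStep : List (G × G) → List (G × G) → Prop
  | twistFst (pre post : List (G × G)) (h : G × G) :
      HandleStep (pre ++ h :: post) (pre ++ twistFst h :: post)
  | twistSnd (pre post : List (G × G)) (h : G × G) :
      HandleStep (pre ++ h :: post) (pre ++ twistSnd h :: post)
  | comm (pre post : List (G × G)) (p : (G × G) × (G × G)) :
      HandleStep (pre ++ p.1 :: p.2 :: post)
        (pre ++ (handleComm p).1 :: (handleComm p).2 :: post)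
  | slide (pre post : List (G × G)) (p : (G × G) × (G × G)) :
      HandleStep (pre ++ p.1 :: p.2 :: post)
        (pre ++ (handleSlide p).1 :: (handleSlide p).2 :: post)

/-- Two lists of handle values are related if a sequence of moves leads from one to the other. -/
def HandleRel : List (G × G) → List (G × G) → Prop := ReflTransGen HandleStep

namespace HandleRel

variable {T T' T'' : List (G × G)}

@[refl] lemma refl (T : List (G × G)) : HandleRel T T := ReflTransGen.refl

lemma trans (h : HandleRel T T') (h' : HandleRel T' T'') : HandleRel T T'' :=
  ReflTransGen.trans h h'

lemma twistFst (pre post : List (G × G)) (a b : G) :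
    HandleRel (pre ++ (a, b) :: post) (pre ++ (a * b, b) :: post) :=
  .single (.twistFst pre post (a, b))

lemma twistSnd (pre post : List (G × G)) (a b : G) :
    HandleRel (pre ++ (a, b) :: post) (pre ++ (a, b * a⁻¹) :: post) :=
  .single (.twistSnd pre post (a, b))

lemma comm (pre post : List (G × G)) (h k : G × G) :
    HandleRel (pre ++ h :: k :: post) (pre ++ k :: (⁅k.1, k.2⁆⁻¹ * h.1 * ⁅k.1, k.2⁆,
      ⁅k.1, k.2⁆⁻¹ * h.2 * ⁅k.1, k.2⁆) :: post) :=
  .single (.comm pre post (h, k))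

lemma slide (pre post : List (G × G)) (a b c d : G) :
    HandleRel (pre ++ (a, b) :: (c, d) :: post) (pre ++ (b⁻¹ * c, d) ::
      (d * (b⁻¹ * c * d * (b⁻¹ * c)⁻¹)⁻¹ * a * d⁻¹, d * b * d⁻¹) :: post) :=
  .single (.slide pre post ((a, b), (c, d)))

lemma append (h : HandleRel T T') (A B : List (G × G)) :
    HandleRel (A ++ T ++ B) (A ++ T' ++ B) := by
  induction h with
  | refl => rfl
  | tail _ hs ih =>
    refine ih.trans (.single ?_)
    cases hs with
    | twistFst pre post h => simpa using HandleStep.twistFst (A ++ pre) (post ++ B) h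
    | twistSnd pre post h => simpa using HandleStep.twistSnd (A ++ pre) (post ++ B) h
    | comm pre post h => simpa using HandleStep.comm (A ++ pre) (post ++ B) h
    | slide pre post h => simpa using HandleStep.slide (A ++ pre) (post ++ B) h

lemma append_left (h : HandleRel T T') (A : List (G × G)) : HandleRel (A ++ T) (A ++ T') := by
  simpa using h.append A []

lemma append_right (h : HandleRel T T') (B : List (G × G)) : HandleRel (T ++ B) (T' ++ B) := by
  simpa using h.append [] B

lemma cons (h : HandleRel T T') (k : G × G) : HandleRel (k :: T) (k :: T') :=
  h.append_left [k]

lemma length_eq (h : HandleRel T T') : T.length = T'.length := by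
  induction h with
  | refl => rfl
  | tail _ hs ih => rw [ih]; cases hs <;> simp

lemma mem_subgroup (h : HandleRel T T') {H : Subgroup G} (hT : ∀ k ∈ T, k.1 ∈ H ∧ k.2 ∈ H) :
    ∀ k ∈ T', k.1 ∈ H ∧ k.2 ∈ H := by
  induction h with
  | refl => exact hT
  | tail _ hs ih =>
    cases hs <;>
    · simp only [List.forall_mem_append, List.forall_mem_cons] at ih ⊢
      obtain ⟨i1, i2⟩ := ih
      refine ⟨i1, ?_⟩
      simp only [_root_.twistFst, _root_.twistSnd, handleComm, handleSlide, Equiv.coe_fn_mk,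
        commutatorElement_def]
      obtain ⟨⟨_, _⟩, i3⟩ := i2
      first
      | (obtain ⟨⟨_, _⟩, i4⟩ := i3
         refine ⟨⟨?_, ?_⟩, ⟨?_, ?_⟩, i4⟩ <;>
         repeat' first | assumption | apply mul_mem | apply inv_mem)
      | (refine ⟨⟨?_, ?_⟩, i3⟩ <;>
         repeat' first | assumption | apply mul_mem | apply inv_mem)

/-- On a finite set the inverse of a permutation is one of its powers, so a move is undone by
repeating it. Hence no inverse moves have to be included in `HandleStep`. -/
lemma of_perm {α : Type*} [Finite α] (φ : Equiv.Perm α) (f : α → List (G × G))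
    (hf : ∀ a, HandleRel (f a) (f (φ a))) (a : α) : HandleRel (f (φ a)) (f a) := by
  have key : ∀ (n : ℕ) a, HandleRel (f a) (f ((φ ^ n) a)) := by
    intro n
    induction n with
    | zero => intro a; rfl
    | succ n ih => intro a; rw [pow_succ]; exact (hf a).trans (ih (φ a))
  have h := key (orderOf φ - 1) (φ a)
  have e : (φ ^ (orderOf φ - 1)) (φ a) = a := by
    rw [← Equiv.Perm.mul_apply, ← pow_succ, Nat.sub_add_cancel (orderOf_pos φ), pow_orderOf_eq_one]
    rfl
  rwa [e] at h

lemma symm [Finite G] (h : HandleRel T T') : HandleRel T' T := by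
  induction h with
  | refl => rfl
  | tail _ hs ih =>
    refine trans ?_ ih
    cases hs with
    | twistFst pre post h =>
      exact of_perm _root_.twistFst (fun h => pre ++ h :: post) (fun h => .single (.twistFst _ _ _)) h
    | twistSnd pre post h =>
      exact of_perm _root_.twistSnd (fun h => pre ++ h :: post) (fun h => .single (.twistSnd _ _ _)) h
    | comm pre post h =>
      exact of_perm handleComm (fun p => pre ++ p.1 :: p.2 :: post)
        (fun h => .single (.comm _ _ _)) h
    | slide pre post h =>
      exact of_perm handleSlide (fun p => pre ++ p.1 :: p.2 :: post)
        (fun h => .single (.slide _ _ _)) h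

variable {Q : Type*} [Group Q] (f : G →* Q)

lemma map (h : HandleRel T T') :
    HandleRel (T.map (Prod.map f f)) (T'.map (Prod.map f f)) := by
  induction h with
  | refl => rfl
  | tail _ hs ih =>
    refine ih.trans (.single ?_)
    cases hs with
    | twistFst pre post h =>
      simpa [_root_.twistFst] using HandleStep.twistFst (pre.map (Prod.map f f)) (post.map (Prod.map f f))
        (Prod.map f f h)
    | twistSnd pre post h =>
      simpa [_root_.twistSnd] using HandleStep.twistSnd (pre.map (Prod.map f f)) (post.map (Prod.map f f))
        (Prod.map f f h)
    | comm pre post h =>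
      simpa [handleComm, commutatorElement_def] using
        HandleStep.comm (pre.map (Prod.map f f)) (post.map (Prod.map f f))
        (Prod.map f f h.1, Prod.map f f h.2)
    | slide pre post h =>
      simpa [handleSlide] using HandleStep.slide (pre.map (Prod.map f f)) (post.map (Prod.map f f))
        (Prod.map f f h.1, Prod.map f f h.2)

/-- The moves are given by group words in the handle values. A move of the image list therefore
comes from the same move at the same place of the original list, whether or not `f` is surjective.
-/
lemma lift {U : List (Q × Q)} (h : HandleRel (T.map (Prod.map f f)) U) :
    ∃ T', HandleRel T T' ∧ T'.map (Prod.map f f) = U := by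
  induction h with
  | refl => exact ⟨T, refl T, rfl⟩
  | tail _ hs ih =>
    obtain ⟨T', hT, rfl⟩ := ih
    generalize hW : T'.map (Prod.map f f) = W at hs
    cases hs with
    | twistFst pre post h =>
      obtain ⟨A, B, rfl, rfl, hB⟩ := List.map_eq_append_iff.1 hW
      obtain ⟨k, C, rfl, rfl, rfl⟩ := List.map_eq_cons_iff.1 hB
      exact ⟨_, hT.trans (.single (.twistFst A C k)), by simp [_root_.twistFst]⟩
    | twistSnd pre post h =>
      obtain ⟨A, B, rfl, rfl, hB⟩ := List.map_eq_append_iff.1 hW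
      obtain ⟨k, C, rfl, rfl, rfl⟩ := List.map_eq_cons_iff.1 hB
      exact ⟨_, hT.trans (.single (.twistSnd A C k)), by simp [_root_.twistSnd]⟩
    | comm pre post p =>
      obtain ⟨p1, p2⟩ := p
      obtain ⟨A, B, rfl, rfl, hB⟩ := List.map_eq_append_iff.1 hW
      obtain ⟨k, C, rfl, rfl, hC⟩ := List.map_eq_cons_iff.1 hB
      obtain ⟨l, D, rfl, rfl, rfl⟩ := List.map_eq_cons_iff.1 hC
      exact ⟨_, hT.trans (.single (.comm A D (k, l))),
        by simp [handleComm, commutatorElement_def]⟩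
    | slide pre post p =>
      obtain ⟨p1, p2⟩ := p
      obtain ⟨A, B, rfl, rfl, hB⟩ := List.map_eq_append_iff.1 hW
      obtain ⟨k, C, rfl, rfl, hC⟩ := List.map_eq_cons_iff.1 hB
      obtain ⟨l, D, rfl, rfl, rfl⟩ := List.map_eq_cons_iff.1 hC
      exact ⟨_, hT.trans (.single (.slide A D (k, l))), by simp [handleSlide]⟩

/-- The quarter turn of a handle is a product of three twists. -/
lemma swap (pre post : List (G × G)) (a b : G) :
    HandleRel (pre ++ (a, b) :: post) (pre ++ (a * b * a⁻¹, a⁻¹) :: post) := by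
  refine (twistFst _ _ _ _).trans ((twistSnd _ _ _ _).trans ?_)
  simpa using twistFst pre post (a * b) (b * (a * b)⁻¹)

variable [Finite G]

-- A handle with trivial commutator passes its neighbours by exchanges which conjugate them by 1, so
-- nothing else changes.
omit [Finite G] in
lemma move_left (a b : G) (hab : ⁅a, b⁆ = 1) (A B C : List (G × G)) :
    HandleRel (A ++ B ++ (a, b) :: C) (A ++ (a, b) :: B ++ C) := by
  induction B generalizing A with
  | nil => simp; rfl
  | cons h B ih =>
    have h1 := ih (A ++ [h])
    have h2 := comm A (B ++ C) h (a, b)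
    simp only [hab, inv_one, one_mul, mul_one] at h2
    exact HandleRel.trans (by simpa using h1) (by simpa using h2)

/-- Bring `(a, 1)` to the right of `h`, slide, and bring it back. Because its second entry is 1, the
slide leaves `h` as it is. -/
lemma fst_mul_inv_snd (a : G) (h : G × G) (A B : List (G × G)) :
    HandleRel ((a, 1) :: (A ++ h :: B)) ((h.2⁻¹ * a, 1) :: (A ++ h :: B)) := by
  have h1 := (move_left a 1 (by simp) [] (A ++ [h]) B).symm
  have h2 := slide A B h.1 h.2 a 1
  have h3 := move_left (h.2⁻¹ * a) 1 (by simp) [] A (h :: B)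
  simp only [List.nil_append, List.append_assoc, List.cons_append, one_mul, mul_one, inv_one,
    mul_inv_cancel] at h1 h2 h3
  exact h1.trans (h2.trans h3)

/-- A quarter turn makes the inverse of the first value of `h` its second value; afterwards the turn
is undone. -/
lemma fst_mul_fst (a : G) (h : G × G) (A B : List (G × G)) :
    HandleRel ((a, 1) :: (A ++ h :: B)) ((h.1 * a, 1) :: (A ++ h :: B)) := by
  have h1 := swap ((a, 1) :: A) B h.1 h.2
  have h2 := fst_mul_inv_snd a (h.1 * h.2 * h.1⁻¹, h.1⁻¹) A B
  have h3 := (swap ((h.1 * a, 1) :: A) B h.1 h.2).symm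
  simp only [inv_inv] at h2
  exact h1.trans (h2.trans h3)

/-- The subgroup generated by the values on the handles. -/
def _root_.handleClosure (T : List (G × G)) : Subgroup G :=
  Subgroup.closure {x | ∃ h ∈ T, x = h.1 ∨ x = h.2}

/-- The two preceding lemmas provide left multiplication by the generators, and reversing moves
provides their inverses. -/
lemma fst_mul_of_mem_closure (T : List (G × G)) {k : G} (hk : k ∈ handleClosure T) (a : G) :
    HandleRel ((a, 1) :: T) ((k * a, 1) :: T) := by
  unfold handleClosure at hk
  induction hk using Subgroup.closure_induction generalizing a with
  | mem x hx =>
    obtain ⟨h, hT, hx⟩ := hx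
    obtain ⟨A, B, rfl⟩ := List.append_of_mem hT
    rcases hx with rfl | rfl
    · exact fst_mul_fst a h A B
    · simpa using (fst_mul_inv_snd (h.2 * a) h A B).symm
  | one => simp; rfl
  | mul x y _ _ hx hy => rw [mul_assoc]; exact (hy a).trans (hx (y * a))
  | inv x _ hx => simpa using (hx (x⁻¹ * a)).symm

/-- A quarter turn changes `(1, b)` to `(b, 1)`, and then `b` is cancelled by left multiplication
with its inverse. -/
lemma trivialize (T : List (G × G)) {b : G} (hb : b ∈ handleClosure T) :
    HandleRel ((1, b) :: T) ((1, 1) :: T) := by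
  have h1 := swap [] T 1 b
  have h2 := fst_mul_of_mem_closure T (inv_mem hb) b
  simp only [List.nil_append, one_mul, inv_one, mul_one, inv_mul_cancel] at h1 h2
  exact h1.trans h2

/-- Merges the first values from left to right: after a quarter turn, sliding `h` over `k`
multiplies the first value of `k` by that of `h` from the left. -/
lemma exists_prod (h : G × G) (L : List (G × G)) :
    ∃ L' b, HandleRel (h :: L) (L' ++ [(((h :: L).map Prod.fst).prod, b)]) := by
  induction L generalizing h with
  | nil => exact ⟨[], h.2, by simp; rfl⟩
  | cons k L ih =>
    obtain ⟨L', b, hL⟩ := ih (h.1 * k.1, k.2)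
    have h1 := swap [] (k :: L) h.1 h.2
    have h2 := slide [] L (h.1 * h.2 * h.1⁻¹) (h.1⁻¹) k.1 k.2
    simp only [inv_inv] at h2
    obtain ⟨x, hx⟩ : ∃ x, HandleRel (h :: k :: L) ((h.1 * k.1, k.2) :: x :: L) :=
      ⟨_, h1.trans h2⟩
    obtain ⟨y, hy⟩ : ∃ y, HandleRel ((h.1 * k.1, k.2) :: x :: L)
        (y :: (h.1 * k.1, k.2) :: L) := by
      -- The exchange run backwards carries the handle with the product to the right unchanged; only
      -- the handle it passes is conjugated.
      have h3 : HandleRel _ _ := .single (HandleStep.comm [] L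
        (handleComm.symm ((h.1 * k.1, k.2), x)))
      rw [Equiv.apply_symm_apply] at h3
      exact ⟨_, h3.symm⟩
    exact ⟨y :: L', b, hx.trans (hy.trans (by simpa [mul_assoc] using hL.cons y))⟩

/-- There are `T.length + 1` partial products of first values, counting the empty one, but at most
`T.length` elements of `H`. Two of them agree, so the block in between has product 1; it is merged
into one handle, which then moves to the front. -/
lemma exists_fst_eq_one (H : Subgroup G) (T : List (G × G)) (hT : ∀ k ∈ T, k.1 ∈ H ∧ k.2 ∈ H)
    (hc : Nat.card H ≤ T.length) : ∃ b T', HandleRel T ((1, b) :: T') := by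
  classical
  let p : Fin (T.length + 1) → H := fun i => ⟨((T.take i).map Prod.fst).prod, by
    refine Subgroup.list_prod_mem _ fun x hx => ?_
    obtain ⟨k, hk, rfl⟩ := List.mem_map.1 hx
    exact (hT k (List.mem_of_mem_take hk)).1⟩
  have hp : ¬ Function.Injective p := fun hi => by
    have := Nat.card_le_card_of_injective p hi
    rw [Nat.card_fin] at this
    omega
  obtain ⟨i, j, hij, hlt⟩ : ∃ i j, p i = p j ∧ i < j := by
    simp only [Function.Injective, not_forall] at hp
    obtain ⟨i, j, hij, hne⟩ := hp
    rcases lt_or_gt_of_ne hne with h | h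
    · exact ⟨i, j, hij, h⟩
    · exact ⟨j, i, hij.symm, h⟩
  obtain ⟨L, hL⟩ : ∃ L, T.take j = T.take i ++ L :=
    ⟨(T.take j).drop i, by
      conv_lhs => rw [← List.take_append_drop i (T.take j)]
      rw [List.take_take, min_eq_left (show (i : ℕ) ≤ j from le_of_lt hlt)]⟩
  have hprod : (L.map Prod.fst).prod = 1 := by
    have := congrArg Subtype.val hij
    simp only [p, hL, List.map_append, List.prod_append] at this
    simpa using this.symm
  have hne : L ≠ [] := by
    rintro rfl
    have := congrArg List.length hL
    simp only [List.append_nil, List.length_take] at this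
    have h1 := i.2; have h2 := j.2
    have h3 : (i : ℕ) < j := hlt
    omega
  obtain ⟨h, L, rfl⟩ := List.exists_cons_of_ne_nil hne
  obtain ⟨L', b, hL'⟩ := exists_prod h L
  rw [hprod] at hL'
  have h1 := hL'.append (T.take i) (T.drop j)
  have h2 := move_left 1 b (by simp) [] (T.take i ++ L') (T.drop j)
  rw [← hL, List.take_append_drop] at h1
  refine ⟨b, T.take i ++ L' ++ T.drop j, h1.trans ?_⟩
  simpa using h2

/-- Strong induction on the order of `H`. Either the remaining second value of `(1, b)` can be
killed by the other handles, or these generate a proper subgroup of `H`. In the second case the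
bound survives: one handle is lost, but the order of the subgroup drops by at least one. -/
theorem exists_trivial_handle (H : Subgroup G) (T : List (G × G))
    (hT : ∀ k ∈ T, k.1 ∈ H ∧ k.2 ∈ H) (hc : Nat.card H ≤ T.length) :
    ∃ T', HandleRel T ((1, 1) :: T') := by
  induction hn : Nat.card H using Nat.strong_induction_on generalizing H T with
  | _ n ih =>
    subst hn
    obtain ⟨b, T₁, h₁⟩ := exists_fst_eq_one H T hT hc
    by_cases hb : b ∈ handleClosure T₁
    · exact ⟨T₁, h₁.trans (trivialize T₁ hb)⟩
    have hmem := h₁.mem_subgroup hT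
    simp only [List.forall_mem_cons] at hmem
    have hle : handleClosure T₁ ≤ H := (Subgroup.closure_le _).2 <| by
      rintro x ⟨k, hk, rfl | rfl⟩
      exacts [(hmem.2 k hk).1, (hmem.2 k hk).2]
    have hlt : Nat.card (handleClosure T₁) < Nat.card H := by
      refine lt_of_le_of_ne (Subgroup.card_le_of_le hle) fun h => hb ?_
      rw [Subgroup.eq_of_le_of_card_ge hle h.ge]
      exact hmem.1.2
    have hlen := h₁.length_eq
    simp only [List.length_cons] at hlen
    obtain ⟨T₂, h₂⟩ := ih _ hlt (handleClosure T₁) T₁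
      (fun k hk => ⟨Subgroup.subset_closure ⟨k, hk, .inl rfl⟩,
        Subgroup.subset_closure ⟨k, hk, .inr rfl⟩⟩) (by omega) rfl
    exact ⟨(1, b) :: T₂, h₁.trans ((h₂.cons (1, b)).trans
      (by simpa using move_left 1 1 (by simp) [] [(1, b)] T₂))⟩

/-- A further trivial handle can be extracted as long as the unused handles number at least the
order of `G`. -/
theorem exists_replicate_trivial (r : ℕ) (T : List (G × G)) (hc : Nat.card G + r ≤ T.length + 1) :
    ∃ T', HandleRel T (List.replicate r (1, 1) ++ T') := by
  induction r generalizing T with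
  | zero => exact ⟨T, refl T⟩
  | succ r ih =>
    obtain ⟨T₁, h₁⟩ := exists_trivial_handle ⊤ T (by simp) (by
      rw [Subgroup.card_top]; omega)
    have hlen := h₁.length_eq
    simp only [List.length_cons] at hlen
    obtain ⟨T₂, h₂⟩ := ih T₁ (by omega)
    exact ⟨T₂, h₁.trans (by simpa [List.replicate_succ] using h₂.cons (1, 1))⟩

end HandleRel

/-! ### Handle moves in abelian groups and the Euclidean algorithm. -/

section Abelian

variable {A : Type*} [CommGroup A]

namespace HandleRel

lemma of_listPerm {T T' : List (A × A)} (h : T.Perm T') : HandleRel T T' := by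
  induction h with
  | nil => rfl
  | cons x _ ih => exact ih.cons x
  | swap x y l =>
    have := HandleRel.comm [] l y x
    simpa [commutatorElement_def] using this
  | trans _ _ h₁ h₂ => exact h₁.trans h₂

variable [Finite A]

lemma twistFst_zpow (a b : A) (j : ℤ) : HandleRel [(a, b)] [(a * b ^ j, b)] := by
  induction j with
  | zero => simp; rfl
  | succ i ih => exact ih.trans (by simpa [zpow_add, mul_assoc] using twistFst [] [] (a * b ^ (i : ℤ)) b)
  | pred i ih =>
    refine ih.trans ?_
    simpa [zpow_sub, mul_assoc] using (twistFst [] [] (a * b ^ (-(i : ℤ) - 1)) b).symm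

/-- This is the elementary symplectic operation on two handles: adding one first entry to another
forces the opposite correction of the second entries. It is the slide move between quarter turns. -/
lemma row_mul (a b c d : A) : HandleRel [(a, b), (c, d)] [(a * c, b), (c, d * b⁻¹)] := by
  refine (of_listPerm (List.Perm.swap _ _ _)).trans ?_
  refine HandleRel.trans ?_ (of_listPerm (List.Perm.swap _ _ _))
  refine (HandleRel.swap [] [(a, b)] c d).trans ((slide [] [] _ _ _ _).trans ?_)
  refine HandleRel.trans ?_ (of_listPerm (List.Perm.swap _ _ _))
  have h := (HandleRel.swap [(a * c, b)] [] c (d * b⁻¹)).symm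
  have e : b * (c * a * b * (c * a)⁻¹)⁻¹ * (c * d * c⁻¹) * b⁻¹ = c * (d * b⁻¹) * c⁻¹ := by
    refine Additive.ofMul.injective ?_
    simp only [ofMul_mul, ofMul_inv]
    abel
  have e₂ : b * c⁻¹ * b⁻¹ = c⁻¹ := by simp [mul_comm]
  simp only [inv_inv, e, e₂]
  rw [mul_comm c a]
  exact h

lemma row_mul_zpow (a b c d : A) (j : ℤ) :
    HandleRel [(a, b), (c, d)] [(a * c ^ j, b), (c, d * (b ^ j)⁻¹)] := by
  induction j with
  | zero => simp; rfl
  | succ i ih =>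
    have h := row_mul (a * c ^ (i : ℤ)) b c (d * (b ^ (i : ℤ))⁻¹)
    rw [mul_assoc, ← zpow_add_one, mul_assoc, ← mul_inv_rev, ← zpow_one_add, add_comm 1] at h
    exact ih.trans h
  | pred i ih =>
    have h := row_mul (a * c ^ (-(i : ℤ) - 1)) b c (d * (b ^ (-(i : ℤ) - 1))⁻¹)
    rw [mul_assoc, ← zpow_add_one, mul_assoc, ← mul_inv_rev, ← zpow_one_add, sub_add_cancel,
      add_sub_cancel] at h
    exact ih.trans h.symm

variable {D : Type*} [CommGroup D] (f : A →* D) (d : D)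

/-- The Euclidean algorithm for the exponents of `d` in one handle: twists reduce the first exponent
modulo the second, and a quarter turn interchanges their roles. -/
lemma euclid_handle (n : ℕ) (a b : A) (k : ℤ) (ha : f a = d ^ k) (hb : f b = d ^ n) :
    ∃ a' b', HandleRel [(a, b)] [(a', b')] ∧ f a' ∈ Subgroup.zpowers d ∧ f b' = 1 := by
  induction n using Nat.strong_induction_on generalizing a b k with
  | _ n ih =>
    rcases Nat.eq_zero_or_pos n with rfl | hn
    · exact ⟨a, b, refl _, ⟨k, ha.symm⟩, by simpa using hb⟩
    have hpos : 0 ≤ k % n := Int.emod_nonneg k (by omega)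
    have hlt : k % n < n := Int.emod_lt_of_pos k (by omega)
    -- The quarter turn puts the remainder in second place and introduces the sign in `-n`. This
    -- does no harm, since only the second exponent has to be a natural number.
    obtain ⟨a', b', h, h₁, h₂⟩ := ih (k % n).toNat (by omega) (b⁻¹) (a * b ^ (-(k / n))) (-n)
      (by simp [hb]) (by
        rw [map_mul, map_zpow, ha, hb, ← zpow_natCast d (k % n).toNat, Int.toNat_of_nonneg hpos,
          Int.emod_def, ← zpow_natCast, ← zpow_mul, ← zpow_add]
        congr 1; ring)
    refine ⟨a', b', (twistFst_zpow a b (-(k / n))).trans (HandleRel.trans ?_ h), h₁, h₂⟩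
    simpa using (HandleRel.swap [] [] (b⁻¹) (a * b ^ (-(k / n)))).symm

/-- The Euclidean algorithm between the first entries of two handles. The corrections of the second
entries are powers of elements in the kernel of `f`, so these entries stay in the kernel. -/
lemma euclid_pair (n : ℕ) (a b a₂ b₂ : A) (k : ℤ) (ha : f a = d ^ k) (ha₂ : f a₂ = d ^ n)
    (hb : f b = 1) (hb₂ : f b₂ = 1) :
    ∃ h h', HandleRel [(a, b), (a₂, b₂)] [h, h'] ∧ f h.1 ∈ Subgroup.zpowers d ∧ f h.2 = 1 ∧
      f h'.1 = 1 ∧ f h'.2 = 1 := by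
  induction n using Nat.strong_induction_on generalizing a b a₂ b₂ k with
  | _ n ih =>
    rcases Nat.eq_zero_or_pos n with rfl | hn
    · exact ⟨_, _, refl _, ⟨k, ha.symm⟩, hb, by simpa using ha₂, hb₂⟩
    have hpos : 0 ≤ k % n := Int.emod_nonneg k (by omega)
    have hlt : k % n < n := Int.emod_lt_of_pos k (by omega)
    obtain ⟨h, h', hh, r⟩ := ih (k % n).toNat (by omega) a₂ (b₂ * (b ^ (-(k / n)))⁻¹)
      (a * a₂ ^ (-(k / n))) b n (by simp [ha₂]) (by
        rw [map_mul, map_zpow, ha, ha₂, ← zpow_natCast d (k % n).toNat, Int.toNat_of_nonneg hpos,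
          Int.emod_def, ← zpow_natCast, ← zpow_mul, ← zpow_add]
        congr 1; ring) (by simp [hb, hb₂]) hb
    exact ⟨h, h', (row_mul_zpow a b a₂ b₂ (-(k / n))).trans
      ((of_listPerm (List.Perm.swap _ _ _)).trans hh), r⟩

omit [Finite A] in
lemma exists_nat_pow {x : A} (hx : f x ∈ Subgroup.zpowers d) [Finite D] : ∃ n : ℕ, f x = d ^ n := by
  obtain ⟨n, hn⟩ := mem_powers_iff_mem_zpowers.2 hx
  exact ⟨n, hn.symm⟩

/-- Modulo the kernel of `f` the values lie in a cyclic group, where a list of handles has only one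
essential entry: Euclid within each handle leaves its first entry, and Euclid between the handles
leaves one of those. -/
lemma euclid_list [Finite D] (T : List (A × A)) (hT : T ≠ [])
    (hd : ∀ h ∈ T, f h.1 ∈ Subgroup.zpowers d ∧ f h.2 ∈ Subgroup.zpowers d) :
    ∃ h T', HandleRel T (h :: T') ∧ f h.1 ∈ Subgroup.zpowers d ∧ f h.2 = 1 ∧
      ∀ k ∈ T', f k.1 = 1 ∧ f k.2 = 1 := by
  induction T with
  | nil => exact absurd rfl hT
  | cons h T ih =>
    simp only [List.forall_mem_cons] at hd
    obtain ⟨⟨⟨k, hk⟩, h2⟩, hd⟩ := hd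
    obtain ⟨n, hn⟩ := exists_nat_pow f d h2
    obtain ⟨a, b, hab, h₁, h₂⟩ := euclid_handle f d n h.1 h.2 k hk.symm hn
    rcases eq_or_ne T [] with rfl | hne
    · exact ⟨(a, b), [], hab, h₁, h₂, by simp⟩
    obtain ⟨⟨a', b'⟩, T', hT', h₁', h₂', hr⟩ := ih hne hd
    obtain ⟨m, hm⟩ := exists_nat_pow f d h₁'
    obtain ⟨l, hl⟩ := h₁
    obtain ⟨u, v, huv, r₁, r₂, r₃, r₄⟩ := euclid_pair f d m a b a' b' l hl.symm hm h₂ h₂'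
    refine ⟨u, v :: T', ?_, r₁, r₂, ?_⟩
    · exact (hT'.cons h).trans ((hab.append_right _).trans (huv.append_right T'))
    · simp only [List.forall_mem_cons]
      exact ⟨⟨r₃, r₄⟩, hr⟩

/-- Each generator costs one handle: modulo the subgroup generated by `es` all values are powers of
`e`, so moves bring all handles but one into this subgroup, and induction applies to those. -/
theorem exists_trivial_handle_of_comm (es : List A) (T : List (A × A))
    (hT : ∀ h ∈ T, h.1 ∈ Subgroup.closure {x | x ∈ es} ∧ h.2 ∈ Subgroup.closure {x | x ∈ es})
    (hlen : es.length < T.length) : ∃ T', HandleRel T ((1, 1) :: T') := by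
  induction es generalizing T with
  | nil =>
    obtain ⟨h, T', rfl⟩ := List.exists_cons_of_length_pos (by omega : 0 < T.length)
    have h1 := hT h (by simp)
    simp only [List.not_mem_nil, Set.ofPred_false, Subgroup.closure_empty, Subgroup.mem_bot] at h1
    refine ⟨T', ?_⟩
    rw [show h = (1, 1) from Prod.ext h1.1 h1.2]
  | cons e es ih =>
    set C := Subgroup.closure {x | x ∈ es} with hC
    have key : Subgroup.closure {x | x ∈ e :: es} ≤
        (Subgroup.zpowers (QuotientGroup.mk' C e)).comap (QuotientGroup.mk' C) := by
      rw [Subgroup.closure_le]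
      intro x hx
      rcases List.mem_cons.1 hx with rfl | hx
      · exact Subgroup.mem_zpowers _
      · have : QuotientGroup.mk' C x = 1 :=
          (QuotientGroup.eq_one_iff x).2 (Subgroup.subset_closure hx)
        rw [SetLike.mem_coe, Subgroup.mem_comap, this]
        exact one_mem _
    have hker : ∀ x, QuotientGroup.mk' C x = 1 → x ∈ C := fun x hx =>
      (QuotientGroup.eq_one_iff x).1 hx
    obtain ⟨h, T', h₁, -, -, h₂⟩ := euclid_list (QuotientGroup.mk' C) (QuotientGroup.mk' C e) T
      (by rintro rfl; simp at hlen) (fun (h : A × A) (hh : h ∈ T) => ⟨key (hT h hh).1, key (hT h hh).2⟩)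
    have hl := h₁.length_eq
    simp only [List.length_cons] at hl hlen
    obtain ⟨T'', h₃⟩ := ih T' (fun k hk => ⟨hker _ (h₂ k hk).1, hker _ (h₂ k hk).2⟩) (by omega)
    exact ⟨h :: T'', h₁.trans ((h₃.cons h).trans (of_listPerm (List.Perm.swap _ _ _)))⟩

end HandleRel

end Abelian

/-- If the Jordan size is at most `(J, R)` and there are at least `J + R` handles, then handle moves
make the values on one handle trivial. -/
theorem HasJordanSizeAtMost.exists_trivial_handle [Finite G] {J R : ℕ}
    (hG : HasJordanSizeAtMost G J R) (T : List (G × G)) (hT : J + R ≤ T.length) :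
    ∃ T', HandleRel T ((1, 1) :: T') := by
  obtain ⟨A, hA, hcomm, hR, hJ⟩ := hG
  -- The quotient has order at most `J`, and extracting `R + 1` trivial handles needs `J + (R + 1) ≤
  -- T.length + 1`. One handle more than the rank of `A` is what the abelian part requires.
  obtain ⟨U, hU⟩ := HandleRel.exists_replicate_trivial (R + 1)
    (T.map (Prod.map (QuotientGroup.mk' A) (QuotientGroup.mk' A))) (by rw [List.length_map]; omega)
  obtain ⟨T₁, h₁, hT₁⟩ := HandleRel.lift _ hU
  obtain ⟨S, B, rfl, hS, hB⟩ := List.map_eq_append_iff.1 hT₁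
  have hSA : ∀ k ∈ S, k.1 ∈ A ∧ k.2 ∈ A := by
    intro k hk
    have := hS ▸ List.mem_map_of_mem (f := Prod.map (QuotientGroup.mk' A) (QuotientGroup.mk' A)) hk
    have := List.eq_of_mem_replicate this
    rw [Prod.ext_iff] at this
    exact ⟨(QuotientGroup.eq_one_iff _).1 this.1, (QuotientGroup.eq_one_iff _).1 this.2⟩
  have hlen : S.length = R + 1 := by simpa using congrArg List.length hS
  -- The lifted handles take values in `A`; they are treated inside `A`, and the moves found there
  -- are mapped back to `G`.
  let S' : List (A × A) := S.pmap (fun k hk => (⟨k.1, hk.1⟩, ⟨k.2, hk.2⟩)) hSA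
  have hS' : S'.map (Prod.map A.subtype A.subtype) = S := by
    simp only [S', List.map_pmap]
    simp
  let _ : CommGroup A := { (inferInstance : Group A) with
    mul_comm := fun a b => Subtype.ext (hcomm a a.2 b b.2) }
  obtain ⟨gens, hcard, hgens⟩ := Group.rank_spec A
  obtain ⟨V, hV⟩ := HandleRel.exists_trivial_handle_of_comm gens.toList S' (by
    have : {x | x ∈ gens.toList} = (gens : Set A) := by ext; simp
    rw [this]
    intro h _
    exact ⟨hgens ▸ Subgroup.mem_top _, hgens ▸ Subgroup.mem_top _⟩) (by
    rw [Finset.length_toList, hcard]; simp only [S', List.length_pmap, hlen]; omega)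
  have hV' := hV.map A.subtype
  rw [hS'] at hV'
  exact ⟨_, h₁.trans (hV'.append_right B)⟩

end HandleMoves

/-! ### Homomorphisms of the fundamental groupoid to a group. -/

section PathHoms

open unitInterval Topology

/-- The corestriction of a path to a set containing it. -/
def Path.restrictTo {X : Type*} [TopologicalSpace X] {a b : X} (γ : Path a b) {W : Set X}
    (h : ∀ t, γ t ∈ W) : Path (⟨a, γ.source ▸ h 0⟩ : W) ⟨b, γ.target ▸ h 1⟩ where
  toFun t := ⟨γ t, h t⟩
  continuous_toFun := γ.continuous.subtype_mk _
  source' := by simp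
  target' := by simp

/-- A homomorphism from the fundamental groupoid of `X` to the group `G`. -/
structure PathHom (X : Type*) [TopologicalSpace X] (G : Type*) [Group G] where
  /-- The value on a path. -/
  toFun : ∀ {a b : X}, Path a b → G
  map_trans : ∀ {a b c : X} (γ : Path a b) (δ : Path b c), toFun (γ.trans δ) = toFun γ * toFun δ
  map_homotopic : ∀ {a b : X} {γ δ : Path a b}, γ.Homotopic δ → toFun γ = toFun δ

namespace PathHom

variable {X Y : Type*} [TopologicalSpace X] [TopologicalSpace Y] {G : Type*} [Group G]

instance : CoeFun (PathHom X G) (fun _ => ∀ {a b : X}, Path a b → G) := ⟨toFun⟩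

variable (F : PathHom X G)

lemma congr {a b a' b' : X} (γ : Path a b) (δ : Path a' b') (h : ∀ t, γ t = δ t) : F γ = F δ := by
  obtain rfl : a = a' := by simpa using h 0
  obtain rfl : b = b' := by simpa using h 1
  rw [show γ = δ from Path.ext (funext h)]

lemma map_refl (a : X) : F (Path.refl a) = 1 := by
  have := F.map_trans (Path.refl a) (Path.refl a)
  rwa [Path.refl_trans_refl, left_eq_mul] at this

lemma map_const {a b : X} (γ : Path a b) (h : ∀ t, γ t = a) : F γ = 1 := by
  rw [F.congr γ (Path.refl a) (by simpa using h), F.map_refl]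

lemma map_symm {a b : X} (γ : Path a b) : F γ.symm = (F γ)⁻¹ := by
  rw [eq_inv_iff_mul_eq_one, ← F.map_trans, F.map_homotopic ⟨(Path.Homotopy.reflSymmTrans γ).symm⟩,
    F.map_refl]

/-- The pull-back under a continuous map. -/
def comap (f : C(Y, X)) : PathHom Y G where
  toFun γ := F (γ.map f.continuous)
  map_trans γ δ := by rw [Path.map_trans, F.map_trans]
  map_homotopic h := F.map_homotopic (h.map f)

lemma comap_apply (f : C(Y, X)) {a b : Y} (γ : Path a b) :
    F.comap f γ = F (γ.map f.continuous) := rfl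

/-- Change of trivialization at all points. -/
def gauge (u : X → G) : PathHom X G where
  toFun {a b} γ := u a * F γ * (u b)⁻¹
  map_trans γ δ := by rw [F.map_trans]; simp [mul_assoc]
  map_homotopic h := by rw [F.map_homotopic h]

lemma gauge_apply (u : X → G) {a b : X} (γ : Path a b) : F.gauge u γ = u a * F γ * (u b)⁻¹ := rfl

lemma eq_of_simplyConnected [SimplyConnectedSpace X] {a b : X} (γ δ : Path a b) : F γ = F δ :=
  F.map_homotopic (SimplyConnectedSpace.paths_homotopic γ δ)

lemma exists_potential [SimplyConnectedSpace X] :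
    ∃ h : X → G, ∀ {a b : X} (γ : Path a b), F γ = (h a)⁻¹ * h b := by
  obtain ⟨x⟩ : Nonempty X := inferInstance
  refine ⟨fun y => F (PathConnectedSpace.somePath x y), fun {a b} γ => ?_⟩
  rw [eq_inv_mul_iff_mul_eq, ← F.map_trans]
  exact F.eq_of_simplyConnected _ _

instance : ContractibleSpace I := (convex_Icc (0 : ℝ) 1).contractibleSpace ⟨0, by simp⟩

instance : ContractibleSpace (I × I) := by
  have h : Convex ℝ (Set.Icc (0 : ℝ) 1 ×ˢ Set.Icc (0 : ℝ) 1) :=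
    (convex_Icc (0 : ℝ) 1).prod (convex_Icc (0 : ℝ) 1)
  have := h.contractibleSpace ⟨(0, 0), by simp⟩
  exact (Homeomorph.Set.prod (Set.Icc (0 : ℝ) 1) (Set.Icc (0 : ℝ) 1)).symm.contractibleSpace

/-- The values around the boundary of a square. -/
lemma square (Φ : C(I × I, X)) {a b c d : X} (α : Path a b) (β : Path b d) (γ : Path a c)
    (δ : Path c d) (hα : ∀ t, α t = Φ (t, 0)) (hβ : ∀ t, β t = Φ (1, t))
    (hγ : ∀ t, γ t = Φ (0, t)) (hδ : ∀ t, δ t = Φ (t, 1)) : F α * F β = F γ * F δ := by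
  obtain ⟨h, hh⟩ := (F.comap Φ).exists_potential
  let α' : Path ((0, 0) : I × I) (1, 0) := ⟨⟨fun t => (t, 0), by fun_prop⟩, rfl, rfl⟩
  let β' : Path ((1, 0) : I × I) (1, 1) := ⟨⟨fun t => (1, t), by fun_prop⟩, rfl, rfl⟩
  let γ' : Path ((0, 0) : I × I) (0, 1) := ⟨⟨fun t => (0, t), by fun_prop⟩, rfl, rfl⟩
  let δ' : Path ((0, 1) : I × I) (1, 1) := ⟨⟨fun t => (t, 1), by fun_prop⟩, rfl, rfl⟩
  rw [F.congr α (α'.map Φ.continuous) hα, F.congr β (β'.map Φ.continuous) hβ,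
    F.congr γ (γ'.map Φ.continuous) hγ, F.congr δ (δ'.map Φ.continuous) hδ,
    ← comap_apply, ← comap_apply, ← comap_apply, ← comap_apply, hh, hh, hh, hh]
  simp [mul_assoc]

instance : LocallyPathConnectedSpace I :=
  isQuotientMap_projIcc (a := (0 : ℝ)) (b := 1) (h := zero_le_one) |>.locallyPathConnectedSpace

/-- The path homomorphism is trivial if it is trivial on the members of an open cover. -/
lemma eq_one_of_cover {ι : Type*} (U : ι → Set X) (hU : ∀ i, IsOpen (U i)) (hcov : ∀ x, ∃ i, x ∈ U i)
    (h : ∀ i {a b : X} (γ : Path a b), (∀ t, γ t ∈ U i) → F γ = 1) {a b : X} (γ : Path a b) :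
    F γ = 1 := by
  obtain ⟨p, hp⟩ := (F.comap (γ : C(I, X))).exists_potential
  -- Nearby parameters are joined by paths in the preimage of one `U i`, where the homomorphism is
  -- trivial, so the potential along `γ` cannot vary.
  have hloc : IsLocallyConstant p := by
    rw [IsLocallyConstant.iff_exists_open]
    intro t
    obtain ⟨i, hi⟩ := hcov (γ t)
    obtain ⟨V, ⟨hVo, htV, hVc⟩, hVs⟩ := (isOpen_isPathConnected_basis t).mem_iff.1
      (((hU i).preimage γ.continuous).mem_nhds hi)
    refine ⟨V, hVo, htV, fun s hs => ?_⟩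
    obtain ⟨δ, hδ⟩ := hVc.joinedIn t htV s hs
    have h1 := hp δ
    rw [comap_apply, h i _ (fun u => show δ u ∈ γ ⁻¹' U i from hVs (hδ u)), eq_comm, inv_mul_eq_one] at h1
    exact h1.symm
  let id' : Path (0 : I) 1 := ⟨⟨fun t => t, continuous_id⟩, rfl, rfl⟩
  rw [F.congr γ (id'.map γ.continuous) (fun t => rfl)]
  change F.comap (γ : C(I, X)) id' = 1
  rw [hp, hloc.apply_eq_of_isPreconnected isPreconnected_univ (Set.mem_univ 0) (Set.mem_univ 1)]
  simp

/-! ### Gluing path homomorphisms over an open cover. -/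

section Gluing

variable {ι : Type*} {W : ι → Set X} (E : ∀ i, PathHom (W i) G)

/-- `P` is a potential for the locally defined path homomorphisms `E i`, pulled back under `H`. -/
def IsPotential {Q : Type*} [TopologicalSpace Q] (H : C(Q, X)) (P : Q → G) : Prop :=
  ∀ q, ∃ B : Set Q, IsOpen B ∧ q ∈ B ∧ ∃ i, ∀ {a b : Q} (δ : Path a b), (∀ t, δ t ∈ B) →
    ∃ h : ∀ t, δ.map H.continuous t ∈ W i, (P a)⁻¹ * P b = E i ((δ.map H.continuous).restrictTo h)

variable {E} {Q Q' : Type*} [TopologicalSpace Q] [TopologicalSpace Q']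

lemma IsPotential.comp {H : C(Q, X)} {P : Q → G} (hP : IsPotential E H P) (ψ : C(Q', Q)) :
    IsPotential E (H.comp ψ) (P ∘ ψ) := by
  intro q
  obtain ⟨B, hB, hq, i, hi⟩ := hP (ψ q)
  refine ⟨ψ ⁻¹' B, hB.preimage ψ.continuous, hq, i, fun {a b} δ hδ => ?_⟩
  exact hi (δ.map ψ.continuous) hδ

/-- The quotient `P' q * (P q)⁻¹` is locally constant, hence constant. The values of a potential on
pairs of points thus do not depend on its choice. -/
lemma IsPotential.unique [LocallyPathConnectedSpace Q] [PreconnectedSpace Q] {H : C(Q, X)}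
    (hE : ∀ i j {a b : X} (γ : Path a b) (hi : ∀ t, γ t ∈ W i) (hj : ∀ t, γ t ∈ W j),
      E i (γ.restrictTo hi) = E j (γ.restrictTo hj)) {P P' : Q → G}
    (hP : IsPotential E H P) (hP' : IsPotential E H P') (a b : Q) :
    (P a)⁻¹ * P b = (P' a)⁻¹ * P' b := by
  have hloc : IsLocallyConstant (fun q => P' q * (P q)⁻¹) := by
    rw [IsLocallyConstant.iff_exists_open]
    intro t
    obtain ⟨B, hB, hq, i, hi⟩ := hP t
    obtain ⟨B', hB', hq', j, hj⟩ := hP' t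
    obtain ⟨V, ⟨hVo, htV, hVc⟩, hVs⟩ := (isOpen_isPathConnected_basis t).mem_iff.1
      ((hB.inter hB').mem_nhds ⟨hq, hq'⟩)
    refine ⟨V, hVo, htV, fun s hs => ?_⟩
    obtain ⟨δ, hδ⟩ := hVc.joinedIn t htV s hs
    obtain ⟨h₁, e₁⟩ := hi δ (fun u => (hVs (hδ u)).1)
    obtain ⟨h₂, e₂⟩ := hj δ (fun u => (hVs (hδ u)).2)
    rw [hE i j _ h₁ h₂, ← e₂] at e₁
    rw [inv_mul_eq_iff_eq_mul] at e₁
    simp [e₁, mul_assoc]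
  have := hloc.apply_eq_of_isPreconnected isPreconnected_univ (Set.mem_univ a) (Set.mem_univ b)
  simp only [mul_inv_eq_iff_eq_mul] at this
  rw [this]
  simp [mul_assoc]

lemma IsPotential.const_path {H : C(I, X)} {P : I → G} (hP : IsPotential E H P) {x : X}
    (hx : ∀ t, H t = x) : P 0 = P 1 := by
  have hloc : IsLocallyConstant P := by
    rw [IsLocallyConstant.iff_exists_open]
    intro t
    obtain ⟨B, hB, hq, i, hi⟩ := hP t
    obtain ⟨V, ⟨hVo, htV, hVc⟩, hVs⟩ := (isOpen_isPathConnected_basis t).mem_iff.1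
      (hB.mem_nhds hq)
    refine ⟨V, hVo, htV, fun s hs => ?_⟩
    obtain ⟨δ, hδ⟩ := hVc.joinedIn t htV s hs
    obtain ⟨h₁, e₁⟩ := hi δ (fun u => hVs (hδ u))
    rw [(E i).map_const _ (fun u => Subtype.ext ((hx _).trans (hx _).symm)), inv_mul_eq_one] at e₁
    exact e₁.symm
  exact hloc.apply_eq_of_isPreconnected isPreconnected_univ (Set.mem_univ 0) (Set.mem_univ 1)

/-- Local potentials exist on balls, which are simply connected, and two of them differ by a locally
constant factor on an overlap. These factors define a covering space with fiber `G`; since `V` is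
simply connected it has a section, which is a global potential. Only `V = ℝ` and `V = ℝ × ℝ` are
needed, for paths and for homotopies. -/
theorem exists_isPotential {V : Type*} [NormedAddCommGroup V] [NormedSpace ℝ V]
    (hW : ∀ i, IsOpen (W i)) (hcov : ∀ x, ∃ i, x ∈ W i)
    (hE : ∀ i j {a b : X} (γ : Path a b) (hi : ∀ t, γ t ∈ W i) (hj : ∀ t, γ t ∈ W j),
      E i (γ.restrictTo hi) = E j (γ.restrictTo hj)) (H : C(V, X)) :
    ∃ P : V → G, IsPotential E H P := by
  classical
  have hball : ∀ q : V, ∃ i, ∃ r > 0, ∀ p ∈ Metric.ball q r, H p ∈ W i := fun q => by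
    obtain ⟨i, hi⟩ := hcov (H q)
    obtain ⟨r, hr, h⟩ := Metric.isOpen_iff.1 ((hW i).preimage H.continuous) q hi
    exact ⟨i, r, hr, h⟩
  choose i r hr hir using hball
  let B : V → Set V := fun q => Metric.ball q (r q)
  have hsc : ∀ q, SimplyConnectedSpace (B q) := fun q => by
    have := (convex_ball q (r q)).contractibleSpace ⟨q, Metric.mem_ball_self (hr q)⟩
    exact SimplyConnectedSpace.ofContractible _
  let HB : ∀ q, C(B q, W (i q)) := fun q => ⟨fun p => ⟨H p, hir q p p.2⟩, by fun_prop⟩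
  have hpot := fun q => ((E (i q)).comap (HB q)).exists_potential
  choose h hh using hpot
  let k : V → V → G := fun q p => if hp : p ∈ B q then h q ⟨p, hp⟩ else 1
  have hk : ∀ q {a b : V} (δ : Path a b), (∀ t, δ t ∈ B q) →
      ∃ hδ : ∀ t, δ.map H.continuous t ∈ W (i q),
        (k q a)⁻¹ * k q b = E (i q) ((δ.map H.continuous).restrictTo hδ) := by
    intro q a b δ hδ
    have ha : a ∈ B q := by simpa using hδ 0
    have hb : b ∈ B q := by simpa using hδ 1
    refine ⟨fun t => hir q _ (hδ t), ?_⟩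
    simp only [k, ha, hb, dif_pos]
    rw [← hh q (δ.restrictTo hδ)]
    exact (E (i q)).congr _ _ (fun t => rfl)
  -- An intersection of two balls is convex, so any two of its points are joined by a path on which
  -- both local potentials have the same increments.
  have hconst : ∀ q q' a b, a ∈ B q ∩ B q' → b ∈ B q ∩ B q' →
      k q a * (k q' a)⁻¹ = k q b * (k q' b)⁻¹ := by
    intro q q' a b ha hb
    have hc : Convex ℝ (B q ∩ B q') := (convex_ball _ _).inter (convex_ball _ _)
    obtain ⟨δ, hδ⟩ := (hc.isPathConnected ⟨a, ha⟩).joinedIn a ha b hb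
    obtain ⟨h₁, e₁⟩ := hk q δ (fun t => (hδ t).1)
    obtain ⟨h₂, e₂⟩ := hk q' δ (fun t => (hδ t).2)
    rw [hE _ _ _ h₁ h₂, ← e₂, inv_mul_eq_iff_eq_mul] at e₁
    simp [e₁, mul_assoc]
  let _ : TopologicalSpace G := ⊥
  have : DiscreteTopology G := ⟨rfl⟩
  let Z : FiberBundleCore V V G :=
    { baseSet := B
      isOpen_baseSet := fun _ => Metric.isOpen_ball
      indexAt := id
      mem_baseSet_at := fun q => Metric.mem_ball_self (hr q)
      coordChange := fun q q' p v => v * k q p * (k q' p)⁻¹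
      coordChange_self := fun q p _ v => by simp
      continuousOn_coordChange := fun q q' => by
        rcases (B q ∩ B q').eq_empty_or_nonempty with he | ⟨x, hx⟩
        · rw [he]; simp
        refine (ContinuousOn.mul (f := fun p : V × G => p.2) (g := fun _ => k q x * (k q' x)⁻¹)
          (by fun_prop) (by fun_prop)).congr ?_
        rintro ⟨p, v⟩ ⟨hp, -⟩
        simp only [mul_assoc]
        rw [hconst q q' p x hp hx]
        rfl
      coordChange_comp := fun q q' q'' p _ v => by simp [mul_assoc] }
  have hcovering : IsCoveringMap Z.proj := FiberBundle.isCoveringMap (F := G) (E := Z.Fiber)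
  obtain ⟨s, ⟨-, hs⟩, -⟩ := hcovering.existsUnique_continuousMap_lifts (ContinuousMap.id V) 0
    ⟨0, (1 : G)⟩ rfl
  have hs' : ∀ q, (s q).1 = q := fun q => congrFun hs q
  let val : Z.TotalSpace → G := fun e => e.2
  -- The product of the fiber coordinate with the local potential is the same in every chart. In a
  -- fixed chart the coordinate of the section is constant, so `P` has the increments of the local
  -- potential.
  let P : V → G := fun q => val (s q) * k (s q).1 q
  refine ⟨P, fun q => ⟨B q, Metric.isOpen_ball, Metric.mem_ball_self (hr q), i q,
    fun {a b} δ hδ => ?_⟩⟩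
  obtain ⟨h₁, e₁⟩ := hk q δ hδ
  refine ⟨h₁, ?_⟩
  rw [← e₁]
  have hcont : ContinuousOn (fun p => (Z.localTriv q (s p)).2) (B q) := by
    have h2 := (Z.localTriv q).continuousOn
    refine continuous_snd.comp_continuousOn (h2.comp s.continuous.continuousOn fun p hp => ?_)
    rw [(Z.localTriv q).mem_source]
    change (s p).1 ∈ B q
    rwa [hs' p]
  have hval : ∀ p, (Z.localTriv q (s p)).2 = P p * (k q p)⁻¹ := fun p => by
    rw [FiberBundleCore.localTriv_apply]
    change val (s p) * k (s p).1 (s p).1 * (k q (s p).1)⁻¹ = val (s p) * k (s p).1 p * (k q p)⁻¹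
    rw [hs' p]
  have ha : a ∈ B q := by simpa using hδ 0
  have hb : b ∈ B q := by simpa using hδ 1
  have heq := (convex_ball q (r q)).isPreconnected.constant hcont ha hb
  rw [hval, hval, mul_inv_eq_iff_eq_mul] at heq
  rw [heq]
  simp [mul_assoc]

/-- Path homomorphisms on the members of an open cover which agree on the overlaps can be glued. -/
theorem exists_glue (hW : ∀ i, IsOpen (W i)) (hcov : ∀ x, ∃ i, x ∈ W i)
    (hE : ∀ i j {a b : X} (γ : Path a b) (hi : ∀ t, γ t ∈ W i) (hj : ∀ t, γ t ∈ W j),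
      E i (γ.restrictTo hi) = E j (γ.restrictTo hj)) :
    ∃ F : PathHom X G, ∀ i {a b : X} (γ : Path a b) (hi : ∀ t, γ t ∈ W i),
      F γ = E i (γ.restrictTo hi) := by
  -- Clamping extends paths and squares to the line and the plane, where `exists_isPotential`
  -- applies.
  let pI : C(ℝ, I) := ⟨Set.projIcc 0 1 zero_le_one, continuous_projIcc⟩
  have hI : ∀ H : C(I, X), ∃ P : I → G, IsPotential E H P := fun H => by
    obtain ⟨P, hP⟩ := exists_isPotential hW hcov hE (H.comp pI)
    have h := hP.comp ⟨((↑) : I → ℝ), continuous_subtype_val⟩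
    have e : (H.comp pI).comp ⟨((↑) : I → ℝ), continuous_subtype_val⟩ = H := by ext t; simp [pI]
    rw [e] at h
    exact ⟨_, h⟩
  have hII : ∀ H : C(I × I, X), ∃ P : I × I → G, IsPotential E H P := fun H => by
    obtain ⟨P, hP⟩ := exists_isPotential hW hcov hE (H.comp (pI.prodMap pI))
    have h := hP.comp ⟨fun p : I × I => ((p.1 : ℝ), (p.2 : ℝ)), by fun_prop⟩
    have e : (H.comp (pI.prodMap pI)).comp ⟨fun p : I × I => ((p.1 : ℝ), (p.2 : ℝ)), by fun_prop⟩ =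
        H := by ext t; simp [pI]
    rw [e] at h
    exact ⟨_, h⟩
  choose P hP using hI
  have huniq : ∀ {H : C(I, X)} {P' : I → G}, IsPotential E H P' → ∀ a b,
      (P H a)⁻¹ * P H b = (P' a)⁻¹ * P' b := fun h a b => (hP _).unique hE h a b
  refine ⟨⟨fun γ => (P γ.toContinuousMap 0)⁻¹ * P γ.toContinuousMap 1, ?_, ?_⟩, ?_⟩
  · intro a b c γ δ
    let half₁ : C(I, I) := ⟨fun t => ⟨t / 2, by constructor <;> linarith [t.2.1, t.2.2]⟩, by fun_prop⟩
    let half₂ : C(I, I) :=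
      ⟨fun t => ⟨(1 + t) / 2, by constructor <;> linarith [t.2.1, t.2.2]⟩, by fun_prop⟩
    have h₁ : (γ.trans δ).toContinuousMap.comp half₁ = γ.toContinuousMap := by
      ext t
      change γ.trans δ (half₁ t) = γ t
      rw [Path.trans_apply, dif_pos (by change (t : ℝ) / 2 ≤ 1 / 2; linarith [t.2.2])]
      congr 1
      ext
      change 2 * ((t : ℝ) / 2) = t
      ring
    have h₂ : (γ.trans δ).toContinuousMap.comp half₂ = δ.toContinuousMap := by
      ext t
      change γ.trans δ (half₂ t) = δ t
      rw [Path.trans_apply]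
      split_ifs with h
      · change (1 + (t : ℝ)) / 2 ≤ 1 / 2 at h
        have ht : t = 0 := le_antisymm (Subtype.coe_le_coe.1 (by simp; linarith)) t.2.1
        subst ht
        rw [δ.source]
        convert! γ.target using 2
        ext
        simp [half₂]
      · congr 1
        ext
        change 2 * ((1 + (t : ℝ)) / 2) - 1 = t
        ring
    have k₁ := h₁ ▸ (hP (γ.trans δ).toContinuousMap).comp half₁
    have k₂ := h₂ ▸ (hP (γ.trans δ).toContinuousMap).comp half₂
    rw [huniq k₁, huniq k₂]
    have e0 : half₁ 0 = 0 := by ext; simp [half₁]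
    have e1 : half₁ 1 = half₂ 0 := by ext; simp [half₁, half₂]
    have e2 : half₂ 1 = 1 := by ext; simp [half₂]
    simp only [Function.comp_apply, e0, e1, e2]
    simp [mul_assoc]
  · rintro a b γ δ ⟨K⟩
    -- A potential on the square of the homotopy restricts to potentials of both paths. Along the
    -- two sides where the homotopy rests it is constant, so both paths have the same increment.
    obtain ⟨R, hR⟩ := hII K.toContinuousMap
    let ι₁ : I → C(I, I × I) := fun s => ⟨fun t => (s, t), by fun_prop⟩
    let ι₂ : I → C(I, I × I) := fun s => ⟨fun t => (t, s), by fun_prop⟩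
    have h₁ : K.toContinuousMap.comp (ι₁ 0) = γ.toContinuousMap := by
      ext t; exact K.apply_zero t
    have h₂ : K.toContinuousMap.comp (ι₁ 1) = δ.toContinuousMap := by
      ext t; exact K.apply_one t
    rw [huniq (h₁ ▸ hR.comp (ι₁ 0)), huniq (h₂ ▸ hR.comp (ι₁ 1))]
    have h₃ := (hR.comp (ι₂ 0)).const_path (x := a) (fun t => K.source t)
    have h₄ := (hR.comp (ι₂ 1)).const_path (x := b) (fun t => K.target t)
    simp only [Function.comp_apply, ι₁, ι₂, ContinuousMap.coe_mk] at h₃ h₄ ⊢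
    rw [h₃, h₄]
  · intro i a b γ hi
    let γ' : C(I, W i) := ⟨fun t => ⟨γ t, hi t⟩, by fun_prop⟩
    obtain ⟨p, hp⟩ := ((E i).comap γ').exists_potential
    have hpp : IsPotential E γ.toContinuousMap p := fun q =>
      ⟨Set.univ, isOpen_univ, trivial, i, fun {a b} δ _ => ⟨fun t => hi _, by
        rw [← hp δ]; exact (E i).congr _ _ fun t => rfl⟩⟩
    change (P γ.toContinuousMap 0)⁻¹ * P γ.toContinuousMap 1 = _
    rw [huniq hpp]
    let id' : Path (0 : I) 1 := ⟨⟨fun t => t, continuous_id⟩, rfl, rfl⟩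
    rw [← hp id']
    exact (E i).congr _ _ fun t => rfl

end Gluing

end PathHom

end PathHoms

/-! ### Surfaces glued from triangular sectors. -/

section SectorSurfaces

set_option linter.unusedSectionVars false

open Topology

/-- A correspondence between compact spaces induces a homeomorphism of quotients, if it is compatible
with the relations. -/
theorem exists_quot_homeomorph {K K' : Type*} [TopologicalSpace K] [TopologicalSpace K']
    [CompactSpace K] [CompactSpace K'] (R : K → K → Prop) (R' : K' → K' → Prop)
    (C : K → K' → Prop) (hC : IsClosed {p : K × K' | C p.1 p.2}) (ex : ∀ a, ∃ a', C a a')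
    (ex' : ∀ a', ∃ a, C a a')
    (fib : ∀ a b c, C a c → C b c → Quot.mk R a = Quot.mk R b)
    (fib' : ∀ a c d, C a c → C a d → Quot.mk R' c = Quot.mk R' d)
    (gen : ∀ a b, R a b → ∃ a' b', C a a' ∧ C b b' ∧ Quot.mk R' a' = Quot.mk R' b')
    (gen' : ∀ a' b', R' a' b' → ∃ a b, C a a' ∧ C b b' ∧ Quot.mk R a = Quot.mk R b) :
    ∃ h : Quot R ≃ₜ Quot R', ∀ a a', C a a' → h (Quot.mk R a) = Quot.mk R' a' := by
  choose f hf using ex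
  choose f' hf' using ex'
  have hf_eq : ∀ a a', C a a' → Quot.mk R' (f a) = Quot.mk R' a' := fun a a' h =>
    fib' _ _ _ (hf a) h
  have hf_eq' : ∀ a a', C a a' → Quot.mk R (f' a') = Quot.mk R a := fun a a' h =>
    fib _ _ _ (hf' a') h
  have cont : Continuous fun a => Quot.mk R' (f a) := by
    refine continuous_iff_isClosed.2 fun Z hZ => ?_
    -- The preimage of a closed set is the projection of a closed part of the correspondence, and
    -- projections along compact spaces are closed. The choice function itself need not be
    -- continuous.
    have : (fun a => Quot.mk R' (f a)) ⁻¹' Z =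
        Prod.fst '' ({p : K × K' | C p.1 p.2} ∩ Prod.snd ⁻¹' (Quot.mk R' ⁻¹' Z)) := by
      ext a
      constructor
      · exact fun ha => ⟨(a, f a), ⟨hf a, ha⟩, rfl⟩
      · rintro ⟨⟨a, a'⟩, ⟨h, ha⟩, rfl⟩
        simpa only [Set.mem_preimage, hf_eq a a' h] using ha
    rw [this]
    exact isClosedMap_fst_of_compactSpace _
      (hC.inter ((hZ.preimage continuous_quot_mk).preimage continuous_snd))
  have cont' : Continuous fun a' => Quot.mk R (f' a') := by
    refine continuous_iff_isClosed.2 fun Z hZ => ?_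
    have : (fun a' => Quot.mk R (f' a')) ⁻¹' Z =
        Prod.snd '' ({p : K × K' | C p.1 p.2} ∩ Prod.fst ⁻¹' (Quot.mk R ⁻¹' Z)) := by
      ext a'
      constructor
      · exact fun ha => ⟨(f' a', a'), ⟨hf' a', ha⟩, rfl⟩
      · rintro ⟨⟨a, a'⟩, ⟨h, ha⟩, rfl⟩
        simpa only [Set.mem_preimage, hf_eq' a a' h] using ha
    rw [this]
    exact isClosedMap_snd_of_compactSpace _
      (hC.inter ((hZ.preimage continuous_quot_mk).preimage continuous_fst))
  let g : Quot R → Quot R' := Quot.lift (fun a => Quot.mk R' (f a)) fun a b hab => by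
    obtain ⟨a', b', ha, hb, h⟩ := gen a b hab
    simp only [hf_eq a a' ha, hf_eq b b' hb, h]
  let g' : Quot R' → Quot R := Quot.lift (fun a => Quot.mk R (f' a)) fun a' b' hab => by
    obtain ⟨a, b, ha, hb, h⟩ := gen' a' b' hab
    simp only [hf_eq' a a' ha, hf_eq' b b' hb, h]
  refine ⟨⟨⟨g, g', ?_, ?_⟩, ?_, ?_⟩, fun a a' h => hf_eq a a' h⟩
  · rintro ⟨a⟩; exact hf_eq' _ _ (hf a)
  · rintro ⟨a⟩; exact hf_eq _ _ (hf' a)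
  · exact continuous_quot_lift _ cont
  · exact continuous_quot_lift _ cont'

/-- The triangle with vertices `(0,0)` (the center), `(1,0)` (the start) and `(0,1)` (the
finish). -/
abbrev Triangle : Type := {q : ℝ × ℝ // q ∈ {q : ℝ × ℝ | 0 ≤ q.1 ∧ 0 ≤ q.2 ∧ q.1 + q.2 ≤ 1}}

namespace Triangle

/-- The center. -/
def ctr : Triangle := ⟨(0, 0), by simp⟩

/-- The side from the center to the start. -/
def start (r : unitInterval) : Triangle := ⟨(r, 0), r.2.1, le_rfl, by simpa using r.2.2⟩

/-- The side from the center to the finish. -/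
def finish (r : unitInterval) : Triangle := ⟨(0, r), le_rfl, r.2.1, by simpa using r.2.2⟩

/-- The side from the start to the finish. -/
def edge (t : unitInterval) : Triangle := ⟨(1 - t, t), by simpa using t.2.2, t.2.1, by simp⟩

lemma convex : Convex ℝ {q : ℝ × ℝ | 0 ≤ q.1 ∧ 0 ≤ q.2 ∧ q.1 + q.2 ≤ 1} := by
  rintro ⟨a, b⟩ ⟨h1, h2, h3⟩ ⟨c, d⟩ ⟨h4, h5, h6⟩ u v hu hv huv
  simp only at h1 h2 h3 h4 h5 h6
  refine ⟨?_, ?_, ?_⟩ <;> simp only [Prod.smul_mk, Prod.mk_add_mk, smul_eq_mul]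
  · positivity
  · positivity
  · nlinarith

instance : ContractibleSpace Triangle := convex.contractibleSpace ⟨(0, 0), by simp⟩

instance : CompactSpace Triangle := by
  refine isCompact_iff_compactSpace.1 (Metric.isCompact_of_isClosed_isBounded ?_ ?_)
  · exact (isClosed_le continuous_const continuous_fst).inter
      ((isClosed_le continuous_const continuous_snd).inter
        (isClosed_le (continuous_fst.add continuous_snd) continuous_const))
  · refine (Metric.isBounded_Icc (0 : ℝ × ℝ) 1).subset ?_
    rintro ⟨a, b⟩ ⟨h1, h2, h3⟩
    simp only at h1 h2 h3
    exact ⟨⟨h1, h2⟩, ⟨by change a ≤ 1; linarith, by change b ≤ 1; linarith⟩⟩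

@[ext] lemma ext {p q : Triangle} (h₁ : p.1.1 = q.1.1) (h₂ : p.1.2 = q.1.2) : p = q :=
  Subtype.ext (Prod.ext h₁ h₂)

/-- The side from the center to the start, as a path. -/
def startPath : Path ctr (start 1) where
  toFun := start
  continuous_toFun := by unfold start; fun_prop
  source' := by ext <;> simp [start, ctr]
  target' := rfl

/-- The side from the center to the finish, as a path. -/
def finishPath : Path ctr (finish 1) where
  toFun := finish
  continuous_toFun := by unfold finish; fun_prop
  source' := by ext <;> simp [finish, ctr]
  target' := rfl

/-- The side from the start to the finish, as a path. -/
def edgePath : Path (start 1) (finish 1) where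
  toFun := edge
  continuous_toFun := by unfold edge; fun_prop
  source' := by ext <;> simp [edge, start]
  target' := by ext <;> simp [edge, finish]

end Triangle

open Triangle

variable {L : Type*}

/-- The gluing of triangular sectors, one for each letter of an alphabet with inverses, to a closed
surface: The sectors are arranged around the common center in the cyclic order given by `σ`, and
the outer sides of `e` and `bar e` are identified. -/
inductive SectorGluing (bar : L → L) (σ : Equiv.Perm L) : L × Triangle → L × Triangle → Prop
  | center (e e' : L) : SectorGluing bar σ (e, ctr) (e', ctr)
  | spoke (e : L) (r : unitInterval) : SectorGluing bar σ (e, finish r) (σ e, start r)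
  | side (e : L) (t : unitInterval) : SectorGluing bar σ (e, edge t) (bar e, edge (unitInterval.symm t))

/-- The surface glued from triangular sectors. -/
abbrev SectorSurface (bar : L → L) (σ : Equiv.Perm L) : Type _ := Quot (SectorGluing bar σ)

namespace SectorSurface

variable {bar : L → L} {σ : Equiv.Perm L}

lemma center_eq (e e' : L) {q q' : Triangle} (h₁ : q.1.1 = 0) (h₂ : q.1.2 = 0) (h₃ : q'.1.1 = 0)
    (h₄ : q'.1.2 = 0) : Quot.mk (SectorGluing bar σ) (e, q) = Quot.mk _ (e', q') := by
  obtain rfl : q = ctr := by ext <;> assumption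
  obtain rfl : q' = ctr := by ext <;> assumption
  exact Quot.sound (.center e e')

lemma spoke_eq {e e' : L} {q q' : Triangle} (he : σ e = e') (h₁ : q.1.1 = 0) (h₂ : q'.1.2 = 0)
    (h₃ : q.1.2 = q'.1.1) : Quot.mk (SectorGluing bar σ) (e, q) = Quot.mk _ (e', q') := by
  let r : unitInterval := ⟨q.1.2, q.2.2.1, by linarith [q.2.1, q.2.2.2]⟩
  have hq : q = finish r := by ext <;> simp [finish, h₁, r]
  have hq' : q' = start r := by ext <;> simp [start, h₂, h₃, r]
  subst he
  rw [hq, hq']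
  exact Quot.sound (.spoke e r)

lemma side_eq {e e' : L} {q q' : Triangle} (he : bar e = e') (h₁ : q.1.1 + q.1.2 = 1)
    (h₂ : q'.1.1 = q.1.2) (h₃ : q'.1.2 = q.1.1) :
    Quot.mk (SectorGluing bar σ) (e, q) = Quot.mk _ (e', q') := by
  let r : unitInterval := ⟨q.1.2, q.2.2.1, by linarith [q.2.1, q.2.2.2]⟩
  have hq : q = edge r := by ext <;> simp [edge, r]; linarith
  have hq' : q' = edge (unitInterval.symm r) := by ext <;> simp [edge, r] <;> linarith
  subst he
  rw [hq, hq']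
  exact Quot.sound (.side e r)

variable [TopologicalSpace L] [DiscreteTopology L]

/-- The map of a sector to the surface. -/
def sector (bar : L → L) (σ : Equiv.Perm L) (e : L) : C(Triangle, SectorSurface bar σ) :=
  ⟨fun q => Quot.mk _ (e, q), continuous_quot_mk.comp (by fun_prop)⟩

variable {G : Type*} [Group G]

/-- The value of a path homomorphism on a side. -/
def label (F : PathHom (SectorSurface bar σ) G) (e : L) : G := F.comap (sector bar σ e) edgePath

/-- The value of a path homomorphism on the spoke at the start of a sector. -/
def spokeValue (F : PathHom (SectorSurface bar σ) G) (e : L) : G :=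
  F.comap (sector bar σ e) startPath

lemma finish_eq (F : PathHom (SectorSurface bar σ) G) (e : L) :
    F.comap (sector bar σ e) finishPath = spokeValue F (σ e) :=
  F.congr _ _ fun t => Quot.sound (.spoke e t)

/-- A sector is simply connected, so going out along its first spoke and along the outer side has
the value of its last spoke. -/
lemma spokeValue_mul_label (F : PathHom (SectorSurface bar σ) G) (e : L) :
    spokeValue F e * label F e = spokeValue F (σ e) := by
  rw [← finish_eq, label, spokeValue, ← PathHom.map_trans]
  exact PathHom.eq_of_simplyConnected _ _ _

lemma label_bar (F : PathHom (SectorSurface bar σ) G) (e : L) :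
    label F (bar e) = (label F e)⁻¹ := by
  rw [label, label, ← PathHom.map_symm]
  refine F.congr _ _ fun t => ?_
  have := Quot.sound (SectorGluing.side (bar := bar) (σ := σ) e (unitInterval.symm t))
  rw [unitInterval.symm_symm] at this
  exact this.symm

/-! ### The cut-and-paste step on three sectors. -/

section Gate

variable [DecidableEq L] (bar) (x y : L)

/-- The three sectors `x`, `y`, `bar x` with `y` following `x` as parts of a pentagon. -/
def pentagon (a : L × Triangle) : L × ℝ × ℝ :=
  if a.1 = x then (x, 2 * a.2.1.2, a.2.1.1 + a.2.1.2)
  else if a.1 = y then (x, 2 * a.2.1.1 + a.2.1.2, a.2.1.1)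
  else if a.1 = bar x then (x, 1 + a.2.1.1 - a.2.1.2, 2 - a.2.1.1 - a.2.1.2)
  else (a.1, a.2.1.1, a.2.1.2)

/-- The three sectors `x`, `y`, `bar x` with `bar x` following `y` as parts of a pentagon. -/
def pentagon' (a : L × Triangle) : L × ℝ × ℝ :=
  if a.1 = x then (x, a.2.1.2, a.2.1.1)
  else if a.1 = y then (x, 1 + a.2.1.1, 2 - a.2.1.1 - 2 * a.2.1.2)
  else if a.1 = bar x then (x, 1 - a.2.1.2, 2 - 2 * a.2.1.1 - a.2.1.2)
  else (a.1, a.2.1.1, a.2.1.2)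

lemma continuous_pentagon : Continuous (pentagon bar x y) := by
  rw [continuous_prod_of_discrete_left]
  intro e
  unfold pentagon
  dsimp only
  split_ifs <;> fun_prop

lemma continuous_pentagon' : Continuous (pentagon' bar x y) := by
  rw [continuous_prod_of_discrete_left]
  intro e
  unfold pentagon'
  dsimp only
  split_ifs <;> fun_prop

variable {bar x y}

section Fibers

omit [TopologicalSpace L] [DiscreteTopology L]

variable (hyx : y ≠ x) (hyb : y ≠ bar x) (hxb : bar x ≠ x)

include hyx hyb hxb

omit hyx hyb hxb in
lemma pentagon_fst (e : L) (q : Triangle) :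
    (pentagon bar x y (e, q)).1 = if e = y ∨ e = bar x then x else e := by
  unfold pentagon
  split_ifs <;> simp_all

/-- The pentagon has the vertices (0,0), (1,0), (2,1), (1,2), (0,1). The triangle of `x` touches
that of `y` along a spoke and that of `bar x` along the side, so coinciding points are identified in
the surface. -/
lemma pentagon_fib (hσ : σ x = y) {a b : L × Triangle}
    (h : pentagon bar x y a = pentagon bar x y b) :
    Quot.mk (SectorGluing bar σ) a = Quot.mk _ b := by
  have h₁ : ∀ q q' : Triangle, pentagon bar x y (x, q) = pentagon bar x y (y, q') →
      Quot.mk (SectorGluing bar σ) (x, q) = Quot.mk _ (y, q') := by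
    rintro ⟨⟨s, f⟩, h1, h2, h3⟩ ⟨⟨s', f'⟩, h1', h2', h3'⟩ h
    simp only [pentagon, if_true, if_neg hyx, Prod.mk.injEq, true_and] at h h1 h2 h3 h1' h2' h3'
    exact spoke_eq hσ (by simp only; linarith) (by simp only; linarith) (by simp only; linarith)
  have h₂ : ∀ q q' : Triangle, pentagon bar x y (x, q) = pentagon bar x y (bar x, q') →
      Quot.mk (SectorGluing bar σ) (x, q) = Quot.mk _ (bar x, q') := by
    rintro ⟨⟨s, f⟩, h1, h2, h3⟩ ⟨⟨s', f'⟩, h1', h2', h3'⟩ h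
    simp only [pentagon, if_true, if_neg hxb, if_neg hyb.symm, Prod.mk.injEq, true_and]
      at h h1 h2 h3 h1' h2' h3'
    exact side_eq rfl (by simp only; linarith) (by simp only; linarith) (by simp only; linarith)
  have h₃ : ∀ q q' : Triangle, pentagon bar x y (y, q) = pentagon bar x y (bar x, q') →
      Quot.mk (SectorGluing bar σ) (y, q) = Quot.mk _ (bar x, q') := by
    rintro ⟨⟨s, f⟩, h1, h2, h3⟩ ⟨⟨s', f'⟩, h1', h2', h3'⟩ h
    simp only [pentagon, if_true, if_neg hxb, if_neg hyb.symm, if_neg hyx, Prod.mk.injEq,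
      true_and] at h h1 h2 h3 h1' h2' h3'
    -- The triangles of `y` and `bar x` meet only in the vertex (2,1), which is also a corner of the
    -- triangle of `x`; the identification passes through that corner.
    refine (spoke_eq (q := finish 1) hσ rfl ?_ ?_).symm.trans (side_eq rfl ?_ ?_ ?_) <;>
      simp only [finish, Set.Icc.coe_one] <;> linarith
  obtain ⟨e, q⟩ := a
  obtain ⟨e', q'⟩ := b
  have same : ∀ q q' : Triangle, pentagon bar x y (e, q) = pentagon bar x y (e, q') → q = q' := by
    intro q q' h
    unfold pentagon at h
    dsimp only at h
    split_ifs at h <;> simp only [Prod.mk.injEq, true_and] at h <;> ext <;> linarith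
  by_cases hee : e = e'
  · subst hee; rw [same _ _ h]
  have h1 := congrArg Prod.fst h
  rw [pentagon_fst, pentagon_fst] at h1
  have hs : (e = x ∨ e = y ∨ e = bar x) ∧ (e' = x ∨ e' = y ∨ e' = bar x) := by
    clear h₁ h₂ h₃ same h
    grind
  rcases hs with ⟨rfl | rfl | rfl, rfl | rfl | rfl⟩
  all_goals first
    | exact absurd rfl hee
    | exact h₁ _ _ h
    | exact h₂ _ _ h
    | exact h₃ _ _ h
    | exact (h₁ _ _ h.symm).symm
    | exact (h₂ _ _ h.symm).symm
    | exact (h₃ _ _ h.symm).symm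

omit hyx hyb hxb in
lemma pentagon'_fst (e : L) (q : Triangle) :
    (pentagon' bar x y (e, q)).1 = if e = y ∨ e = bar x then x else e := by
  unfold pentagon'
  split_ifs <;> simp_all

lemma pentagon'_fib (hbar : Function.Involutive bar) (hσ : σ y = bar x) {a b : L × Triangle}
    (h : pentagon' bar x y a = pentagon' bar x y b) :
    Quot.mk (SectorGluing bar σ) a = Quot.mk _ b := by
  have h₁ : ∀ q q' : Triangle, pentagon' bar x y (x, q) = pentagon' bar x y (y, q') →
      Quot.mk (SectorGluing bar σ) (x, q) = Quot.mk _ (y, q') := by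
    rintro ⟨⟨s, f⟩, h1, h2, h3⟩ ⟨⟨s', f'⟩, h1', h2', h3'⟩ h
    simp only [pentagon', if_true, if_neg hyx, Prod.mk.injEq, true_and] at h h1 h2 h3 h1' h2' h3'
    -- In the second triangulation `x` and `y` meet only in (1,0), which is a corner of `bar x` as
    -- well.
    refine Eq.symm ((spoke_eq (q' := start 1) hσ ?_ rfl ?_).trans (side_eq (hbar x) ?_ ?_ ?_)) <;>
      simp only [start, Set.Icc.coe_one] <;> linarith
  have h₂ : ∀ q q' : Triangle, pentagon' bar x y (x, q) = pentagon' bar x y (bar x, q') →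
      Quot.mk (SectorGluing bar σ) (x, q) = Quot.mk _ (bar x, q') := by
    rintro ⟨⟨s, f⟩, h1, h2, h3⟩ ⟨⟨s', f'⟩, h1', h2', h3'⟩ h
    simp only [pentagon', if_true, if_neg hxb, if_neg hyb.symm, Prod.mk.injEq, true_and]
      at h h1 h2 h3 h1' h2' h3'
    exact side_eq rfl (by simp only; linarith) (by simp only; linarith) (by simp only; linarith)
  have h₃ : ∀ q q' : Triangle, pentagon' bar x y (y, q) = pentagon' bar x y (bar x, q') →
      Quot.mk (SectorGluing bar σ) (y, q) = Quot.mk _ (bar x, q') := by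
    rintro ⟨⟨s, f⟩, h1, h2, h3⟩ ⟨⟨s', f'⟩, h1', h2', h3'⟩ h
    simp only [pentagon', if_true, if_neg hxb, if_neg hyb.symm, if_neg hyx, Prod.mk.injEq,
      true_and] at h h1 h2 h3 h1' h2' h3'
    exact spoke_eq hσ (by simp only; linarith) (by simp only; linarith) (by simp only; linarith)
  obtain ⟨e, q⟩ := a
  obtain ⟨e', q'⟩ := b
  have same : ∀ q q' : Triangle, pentagon' bar x y (e, q) = pentagon' bar x y (e, q') →
      q = q' := by
    intro q q' h
    unfold pentagon' at h
    dsimp only at h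
    split_ifs at h <;> simp only [Prod.mk.injEq, true_and] at h <;> ext <;> linarith
  by_cases hee : e = e'
  · subst hee; rw [same _ _ h]
  have h1 := congrArg Prod.fst h
  rw [pentagon'_fst, pentagon'_fst] at h1
  have hs : (e = x ∨ e = y ∨ e = bar x) ∧ (e' = x ∨ e' = y ∨ e' = bar x) := by
    clear h₁ h₂ h₃ same h
    grind
  rcases hs with ⟨rfl | rfl | rfl, rfl | rfl | rfl⟩
  all_goals first
    | exact absurd rfl hee
    | exact h₁ _ _ h
    | exact h₂ _ _ h
    | exact h₃ _ _ h
    | exact (h₁ _ _ h.symm).symm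
    | exact (h₂ _ _ h.symm).symm
    | exact (h₃ _ _ h.symm).symm

/-- Both triangulations fill the same pentagon. The inequalities decide in which triangle of the
other one a point lies, and the witnesses are the affine coordinates there. -/
lemma exists_pentagon_eq (a : L × Triangle) : ∃ a', pentagon bar x y a = pentagon' bar x y a' := by
  have hx : ∀ s f (h1 : 0 ≤ s) (h2 : 0 ≤ f) (h3 : s + f ≤ 1) (p q : ℝ), p = f → q = s →
      ∃ a', (x, p, q) = pentagon' bar x y a' := by
    rintro s f h1 h2 h3 p q rfl rfl
    exact ⟨(x, ⟨(_, _), h1, h2, h3⟩), by simp [pentagon']⟩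
  have hy : ∀ s f (h1 : 0 ≤ s) (h2 : 0 ≤ f) (h3 : s + f ≤ 1) (p q : ℝ), p = 1 + s →
      q = 2 - s - 2 * f → ∃ a', (x, p, q) = pentagon' bar x y a' := by
    rintro s f h1 h2 h3 _ _ rfl rfl
    exact ⟨(y, ⟨(s, f), h1, h2, h3⟩), by simp [pentagon', hyx]⟩
  have hb : ∀ s f (h1 : 0 ≤ s) (h2 : 0 ≤ f) (h3 : s + f ≤ 1) (p q : ℝ), p = 1 - f →
      q = 2 - 2 * s - f → ∃ a', (x, p, q) = pentagon' bar x y a' := by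
    rintro s f h1 h2 h3 _ _ rfl rfl
    exact ⟨(bar x, ⟨(s, f), h1, h2, h3⟩), by simp [pentagon', hyb.symm, hxb]⟩
  obtain ⟨e, ⟨⟨s, f⟩, h1, h2, h3⟩⟩ := a
  simp only at h1 h2 h3
  unfold pentagon
  dsimp only
  split_ifs with k1 k2 k3
  · rcases le_total (s + 3 * f) 1 with h | h
    · exact hx (s + f) (2 * f) (by linarith) (by linarith) (by linarith) _ _ (by ring) (by ring)
    rcases le_total 1 (2 * f) with h' | h'
    · exact hy (2 * f - 1) ((3 - 3 * f - s) / 2) (by linarith) (by linarith) (by linarith) _ _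
        (by ring) (by ring)
    · exact hb ((1 + f - s) / 2) (1 - 2 * f) (by linarith) (by linarith) (by linarith) _ _
        (by ring) (by ring)
  · rcases le_total (3 * s + f) 1 with h | h
    · exact hx s (2 * s + f) (by linarith) (by linarith) (by linarith) _ _ (by ring) (by ring)
    rcases le_total 1 (2 * s + f) with h' | h'
    · exact hy (2 * s + f - 1) ((3 - 3 * s - f) / 2) (by linarith) (by linarith) (by linarith) _ _
        (by ring) (by ring)
    · exact hb ((1 + s + f) / 2) (1 - 2 * s - f) (by linarith) (by linarith) (by linarith) _ _
        (by ring) (by ring)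
  · rcases le_total f s with h | h
    · exact hy (s - f) f (by linarith) (by linarith) (by linarith) _ _ (by ring) (by ring)
    · exact hb s (f - s) (by linarith) (by linarith) (by linarith) _ _ (by ring) (by ring)
  · exact ⟨(e, ⟨(s, f), h1, h2, h3⟩), by simp [pentagon', k1, k2, k3]⟩

lemma exists_pentagon'_eq (a' : L × Triangle) :
    ∃ a, pentagon bar x y a = pentagon' bar x y a' := by
  have hx : ∀ s f (h1 : 0 ≤ s) (h2 : 0 ≤ f) (h3 : s + f ≤ 1) (p q : ℝ), p = 2 * f → q = s + f →
      ∃ a, pentagon bar x y a = (x, p, q) := by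
    rintro s f h1 h2 h3 _ _ rfl rfl
    exact ⟨(x, ⟨(s, f), h1, h2, h3⟩), by simp [pentagon]⟩
  have hy : ∀ s f (h1 : 0 ≤ s) (h2 : 0 ≤ f) (h3 : s + f ≤ 1) (p q : ℝ), p = 2 * s + f →
      q = s → ∃ a, pentagon bar x y a = (x, p, q) := by
    rintro s f h1 h2 h3 _ _ rfl rfl
    exact ⟨(y, ⟨(_, f), h1, h2, h3⟩), by simp [pentagon, hyx]⟩
  have hb : ∀ s f (h1 : 0 ≤ s) (h2 : 0 ≤ f) (h3 : s + f ≤ 1) (p q : ℝ), p = 1 + s - f →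
      q = 2 - s - f → ∃ a, pentagon bar x y a = (x, p, q) := by
    rintro s f h1 h2 h3 _ _ rfl rfl
    exact ⟨(bar x, ⟨(s, f), h1, h2, h3⟩), by simp [pentagon, hyb.symm, hxb]⟩
  obtain ⟨e, ⟨⟨s, f⟩, h1, h2, h3⟩⟩ := a'
  simp only at h1 h2 h3
  unfold pentagon'
  dsimp only
  split_ifs with k1 k2 k3
  · rcases le_total (f / 2) s with h | h
    · exact hx (s - f / 2) (f / 2) (by linarith) (by linarith) (by linarith) _ _ (by ring) (by ring)
    · exact hy s (f - 2 * s) (by linarith) (by linarith) (by linarith) _ _ (by ring) (by ring)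
  · rcases le_total (s + 2 * f) 1 with h | h
    · exact hb (s + f) f (by linarith) (by linarith) (by linarith) _ _ (by ring) (by ring)
    rcases le_total (3 * s + 4 * f) 3 with h' | h'
    · exact hx ((3 - 3 * s - 4 * f) / 2) ((1 + s) / 2) (by linarith) (by linarith) (by linarith) _ _
        (by ring) (by ring)
    · exact hy (2 - s - 2 * f) (3 * s + 4 * f - 3) (by linarith) (by linarith) (by linarith) _ _
        (by ring) (by ring)
  · rcases le_total (2 * s + f) 1 with h | h
    · exact hb s (s + f) (by linarith) (by linarith) (by linarith) _ _ (by ring) (by ring)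
    rcases le_total (4 * s + f) 3 with h' | h'
    · exact hx ((3 - 4 * s - f) / 2) ((1 - f) / 2) (by linarith) (by linarith) (by linarith) _ _
        (by ring) (by ring)
    · exact hy (2 - 2 * s - f) (4 * s + f - 3) (by linarith) (by linarith) (by linarith) _ _
        (by ring) (by ring)
  · exact ⟨(e, ⟨(s, f), h1, h2, h3⟩), by simp [pentagon, k1, k2, k3]⟩

/-- Describes the outline of the pentagon, where only names change: the last spoke of `y` becomes
the last spoke of `x`. The last spoke of `x` itself is excluded because it runs through the
interior. -/
lemma pentagon_finish {e : L} (he : e ≠ x) (r : unitInterval) :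
    pentagon bar x y (e, finish r) = pentagon' bar x y (Equiv.swap x y e, finish r) := by
  rcases eq_or_ne e y with rfl | h
  · simp [pentagon, pentagon', finish, hyx]
  rw [Equiv.swap_apply_of_ne_of_ne he h]
  unfold pentagon pentagon'
  simp [finish, he, h]

lemma pentagon_start {e : L} (he : e ≠ y) (r : unitInterval) :
    pentagon bar x y (e, start r) = pentagon' bar x y (Equiv.swap (bar x) y e, start r) := by
  rcases eq_or_ne e (bar x) with rfl | h
  · simp [pentagon, pentagon', start, hxb, hyx, hyb.symm]
  rw [Equiv.swap_apply_of_ne_of_ne h he]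
  unfold pentagon pentagon'
  simp [start, he, h]

lemma pentagon_edge {e : L} (h₁ : e ≠ x) (h₂ : e ≠ bar x) (t : unitInterval) :
    pentagon bar x y (e, edge t) = pentagon' bar x y (e, edge t) := by
  unfold pentagon pentagon'
  simp only [edge, h₁, h₂, if_false]
  split_ifs
  · simp only [Prod.mk.injEq, true_and]; constructor <;> ring
  · rfl

lemma pentagon_edge_bar (t : unitInterval) : pentagon bar x y (x, edge t) =
    pentagon bar x y (bar x, edge (unitInterval.symm t)) := by
  simp only [pentagon, edge, hxb, hyb.symm, if_true, if_false, unitInterval.coe_symm_eq,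
    Prod.mk.injEq, true_and]
  constructor <;> ring

lemma pentagon'_edge_bar (t : unitInterval) : pentagon' bar x y (x, edge t) =
    pentagon' bar x y (bar x, edge (unitInterval.symm t)) := by
  simp only [pentagon', edge, hxb, hyb.symm, if_true, if_false, unitInterval.coe_symm_eq,
    Prod.mk.injEq, true_and]
  constructor <;> ring

end Fibers

variable [Finite L]

/-- Cutting a surface along the first spoke of `y` and regluing along the side `x`. -/
theorem exists_gate (hbar : Function.Involutive bar) (hyx : y ≠ x) (hyb : y ≠ bar x)
    (hxb : bar x ≠ x) (hσ : σ x = y) {σ' : Equiv.Perm L}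
    (hσ' : σ' = Equiv.swap (bar x) y * σ * Equiv.swap x y) :
    ∃ h : SectorSurface bar σ ≃ₜ SectorSurface bar σ',
      (∀ e t, e ≠ x → e ≠ bar x → h (Quot.mk _ (e, edge t)) = Quot.mk _ (e, edge t)) ∧
      (∀ r, h (Quot.mk _ (x, start r)) = Quot.mk _ (x, start r)) ∧
      ∀ r, h (Quot.mk _ (y, finish r)) = Quot.mk _ (x, finish r) := by
  have hσy : σ' y = bar x := by
    simp [hσ', hσ]
  have hσs : ∀ e, σ' (Equiv.swap x y e) = Equiv.swap (bar x) y (σ e) := by simp [hσ']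
  have hyσ : ∀ e, e ≠ x → σ e ≠ y := fun e he h => he (σ.injective (h.trans hσ.symm))
  have hbx : ∀ e, e ≠ bar x → bar e ≠ x := fun e he h => he (by rw [← h, hbar])
  have hbb : ∀ e, e ≠ x → bar e ≠ bar x := fun e he h => he (hbar.injective h)
  have ex := exists_pentagon_eq (bar := bar) hyx hyb hxb
  have ex' := exists_pentagon'_eq (bar := bar) hyx hyb hxb
  have H := exists_quot_homeomorph (SectorGluing bar σ) (SectorGluing bar σ')
    (fun a a' => pentagon bar x y a = pentagon' bar x y a')
    (isClosed_eq ((continuous_pentagon bar x y).comp continuous_fst)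
      ((continuous_pentagon' bar x y).comp continuous_snd)) ex ex'
    (fun a b c h₁ h₂ => pentagon_fib hyx hyb hxb hσ (h₁.trans h₂.symm))
    (fun a b c h₁ h₂ => pentagon'_fib hyx hyb hxb hbar hσy (h₁.symm.trans h₂)) ?_ ?_
  · obtain ⟨h, hh⟩ := H
    refine ⟨h, fun e t h₁ h₂ => hh _ _ (pentagon_edge hyx hyb hxb h₁ h₂ t), fun r => hh _ _ ?_,
      fun r => hh _ _ ?_⟩
    · rw [pentagon_start hyx hyb hxb hyx.symm, Equiv.swap_apply_of_ne_of_ne hxb.symm hyx.symm]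
    · rw [pentagon_finish hyx hyb hxb hyx, Equiv.swap_apply_right]
  · rintro _ _ (⟨e, e'⟩ | ⟨e, r⟩ | ⟨e, t⟩)
    · have : ∀ e, ∃ e', pentagon bar x y (e, ctr) = pentagon' bar x y (e', ctr) := fun e => by
        rcases eq_or_ne e x with rfl | he
        · exact ⟨e, by simp [pentagon, pentagon', ctr]⟩
        · have := pentagon_finish hyx hyb hxb he 0
          exact ⟨_, by convert this using 3 <;> ext <;> simp [ctr, finish]⟩
      obtain ⟨e₁, h₁⟩ := this e
      obtain ⟨e₂, h₂⟩ := this e'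
      exact ⟨_, _, h₁, h₂, Quot.sound (.center _ _)⟩
    -- The spoke between `x` and `y` lies inside the pentagon, so its two copies already have the
    -- same image and nothing needs to be identified.
    · rcases eq_or_ne e x with rfl | he
      · obtain ⟨a', ha'⟩ := ex (e, finish r)
        refine ⟨a', a', ha', ?_, rfl⟩
        rw [← ha', hσ]
        simp [pentagon, start, finish, hyx]
      · refine ⟨_, _, pentagon_finish hyx hyb hxb he r, pentagon_start hyx hyb hxb (hyσ e he) r, ?_⟩
        rw [← hσs]
        exact Quot.sound (.spoke _ _)
    · rcases eq_or_ne e x with rfl | h₁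
      · obtain ⟨a', ha'⟩ := ex (e, edge t)
        exact ⟨a', a', ha', (pentagon_edge_bar hyx hyb hxb t).symm.trans ha', rfl⟩
      rcases eq_or_ne e (bar x) with rfl | h₂
      · obtain ⟨a', ha'⟩ := ex (bar x, edge t)
        refine ⟨a', a', ha', ?_, rfl⟩
        rw [hbar, pentagon_edge_bar hyx hyb hxb, unitInterval.symm_symm, ha']
      · exact ⟨_, _, pentagon_edge hyx hyb hxb h₁ h₂ t,
          pentagon_edge hyx hyb hxb (hbx e h₂) (hbb e h₁) _, Quot.sound (.side _ _)⟩
  · rintro _ _ (⟨e, e'⟩ | ⟨e, r⟩ | ⟨e, t⟩)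
    · have : ∀ e, ∃ e', pentagon bar x y (e', ctr) = pentagon' bar x y (e, ctr) := fun e => by
        rcases eq_or_ne e y with rfl | he
        · have := pentagon_start hyx hyb hxb hyb.symm 0
          rw [Equiv.swap_apply_left] at this
          exact ⟨_, by convert this using 3 <;> ext <;> simp [ctr, start]⟩
        · rcases eq_or_ne e x with rfl | h
          · exact ⟨e, by simp [pentagon, pentagon', ctr]⟩
          · have := pentagon_finish hyx hyb hxb h 0
            rw [Equiv.swap_apply_of_ne_of_ne h he] at this
            exact ⟨_, by convert this using 3 <;> ext <;> simp [ctr, finish]⟩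
      obtain ⟨e₁, h₁⟩ := this e
      obtain ⟨e₂, h₂⟩ := this e'
      exact ⟨_, _, h₁, h₂, Quot.sound (.center _ _)⟩
    · rcases eq_or_ne e y with rfl | he
      · obtain ⟨a, ha⟩ := ex' (e, finish r)
        refine ⟨a, a, ha, ?_, rfl⟩
        rw [ha, hσy]
        simp [pentagon', start, finish, hyx, hxb, hyb.symm]
      · obtain ⟨e, rfl⟩ := (Equiv.swap x y).surjective e
        have he' : e ≠ x := by rintro rfl; simp at he
        refine ⟨_, _, pentagon_finish hyx hyb hxb he' r, ?_, Quot.sound (.spoke _ _)⟩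
        rw [hσs]
        exact pentagon_start hyx hyb hxb (hyσ e he') r
    · rcases eq_or_ne e x with rfl | h₁
      · obtain ⟨a, ha⟩ := ex' (e, edge t)
        exact ⟨a, a, ha, ha.trans (pentagon'_edge_bar hyx hyb hxb t), rfl⟩
      rcases eq_or_ne e (bar x) with rfl | h₂
      · obtain ⟨a, ha⟩ := ex' (bar x, edge t)
        refine ⟨a, a, ha, ?_, rfl⟩
        rw [ha, hbar, pentagon'_edge_bar hyx hyb hxb, unitInterval.symm_symm]
      · exact ⟨_, _, pentagon_edge hyx hyb hxb h₁ h₂ t,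
          pentagon_edge hyx hyb hxb (hbx e h₂) (hbb e h₁) _, Quot.sound (.side _ _)⟩

variable {S : Type*} [TopologicalSpace S] {G : Type*} [Group G]

/-- The path homomorphism `F` on `S` is the one with labels `ℓ` on a sector surface. -/
def Presents (F : PathHom S G) (bar : L → L) (σ : Equiv.Perm L) (ℓ : L → G) : Prop :=
  ∃ h : SectorSurface bar σ ≃ₜ S, ∀ e, label (F.comap (h : C(SectorSurface bar σ, S))) e = ℓ e

/-- The new side `x` runs from the end of the first spoke of `x` to the end of the last spoke of
`y`, and the homeomorphism keeps both spokes. Comparing spoke values across the sectors gives the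
product. -/
lemma label_gate {σ' : Equiv.Perm L} (F : PathHom (SectorSurface bar σ) G)
    (F' : PathHom (SectorSurface bar σ') G) (h : SectorSurface bar σ ≃ₜ SectorSurface bar σ')
    (hF : ∀ {a b} (γ : Path a b), F γ = F' (γ.map h.continuous)) (hσ : σ x = y)
    (h₁ : ∀ e t, e ≠ x → e ≠ bar x → h (Quot.mk _ (e, edge t)) = Quot.mk _ (e, edge t))
    (h₂ : ∀ r, h (Quot.mk _ (x, start r)) = Quot.mk _ (x, start r))
    (h₃ : ∀ r, h (Quot.mk _ (y, finish r)) = Quot.mk _ (x, finish r)) :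
    label F' x = label F x * label F y ∧ ∀ e, e ≠ x → e ≠ bar x → label F' e = label F e := by
  have k₁ : spokeValue F' x = spokeValue F x :=
    ((hF (startPath.map (sector bar σ x).continuous)).trans 
    (F'.congr _ (startPath.map (sector bar σ' x).continuous) h₂)).symm
  have k₂ : spokeValue F' (σ' x) = spokeValue F (σ y) := by
    rw [← finish_eq, ← finish_eq]
    exact ((hF (finishPath.map (sector bar σ y).continuous)).trans 
    (F'.congr _ (finishPath.map (sector bar σ' x).continuous) h₃)).symm
  refine ⟨?_, fun e he he' => ((hF (edgePath.map (sector bar σ e).continuous)).trans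
    (F'.congr _ (edgePath.map (sector bar σ' e).continuous) fun t => h₁ e t he he')).symm⟩
  have e₁ := spokeValue_mul_label F' x
  have e₂ := spokeValue_mul_label F x
  have e₃ := spokeValue_mul_label F y
  rw [hσ] at e₂
  rw [k₁, k₂, ← e₃, ← e₂, mul_assoc] at e₁
  exact mul_left_cancel e₁

lemma Presents.gate {F : PathHom S G} {ℓ : L → G} (hF : Presents F bar σ ℓ)
    (hbar : Function.Involutive bar) (hyx : y ≠ x) (hyb : y ≠ bar x) (hxb : bar x ≠ x)
    (hσ : σ x = y) {σ' : Equiv.Perm L} (hσ' : σ' = Equiv.swap (bar x) y * σ * Equiv.swap x y)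
    {ℓ' : L → G} (h₁ : ℓ' x = ℓ x * ℓ y) (h₂ : ℓ' (bar x) = (ℓ' x)⁻¹)
    (h₃ : ∀ e, e ≠ x → e ≠ bar x → ℓ' e = ℓ e) : Presents F bar σ' ℓ' := by
  obtain ⟨h, hh⟩ := hF
  obtain ⟨k, hk₁, hk₂, hk₃⟩ := exists_gate hbar hyx hyb hxb hσ hσ'
  obtain ⟨e₁, e₂⟩ := label_gate (F.comap (h : C(SectorSurface bar σ, S)))
    (F.comap ((k.symm.trans h : SectorSurface bar σ' ≃ₜ S) : C(SectorSurface bar σ', S))) k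
    (fun γ => F.congr _ _ fun t => congrArg h (k.symm_apply_apply (γ t)).symm) hσ hk₁ hk₂ hk₃
  refine ⟨k.symm.trans h, fun e => ?_⟩
  rcases eq_or_ne e x with rfl | hex
  · rw [e₁, hh, hh, h₁]
  rcases eq_or_ne e (bar x) with rfl | heb
  · rw [label_bar, e₁, hh, hh, h₂, h₁]
  · rw [e₂ e hex heb, hh, h₃ e hex heb]

lemma Presents.gate_symm {F : PathHom S G} {ℓ' : L → G} {σ' : Equiv.Perm L}
    (hF : Presents F bar σ' ℓ')
    (hbar : Function.Involutive bar) (hyx : y ≠ x) (hyb : y ≠ bar x) (hxb : bar x ≠ x)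
    (hσ : σ x = y) (hσ' : σ' = Equiv.swap (bar x) y * σ * Equiv.swap x y)
    {ℓ : L → G} (h₁ : ℓ x = ℓ' x * (ℓ' y)⁻¹) (h₂ : ℓ (bar x) = (ℓ x)⁻¹)
    (h₃ : ∀ e, e ≠ x → e ≠ bar x → ℓ e = ℓ' e) : Presents F bar σ ℓ := by
  obtain ⟨h, hh⟩ := hF
  obtain ⟨k, hk₁, hk₂, hk₃⟩ := exists_gate hbar hyx hyb hxb hσ hσ'
  obtain ⟨e₁, e₂⟩ := label_gate
    (F.comap ((k.trans h : SectorSurface bar σ ≃ₜ S) : C(SectorSurface bar σ, S)))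
    (F.comap (h : C(SectorSurface bar σ', S))) k (fun γ => F.congr _ _ fun t => rfl)
    hσ hk₁ hk₂ hk₃
  have hx : label (F.comap ((k.trans h : SectorSurface bar σ ≃ₜ S) : C(SectorSurface bar σ, S))) x
      = ℓ x := by
    rw [h₁, eq_mul_inv_iff_mul_eq, ← hh, ← hh, e₁, e₂ y hyx hyb]
  refine ⟨k.trans h, fun e => ?_⟩
  rcases eq_or_ne e x with rfl | hex
  · exact hx
  rcases eq_or_ne e (bar x) with rfl | heb
  · rw [label_bar, hx, h₂]
  · rw [← e₂ e hex heb, hh, h₃ e hex heb]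

end Gate

end SectorSurface

end SectorSurfaces

/-! ### Labeled boundary words and the realization of the handle moves. -/

section Words

set_option linter.unusedSectionVars false

open Topology SectorSurface commutatorElement

lemma List.formPerm_map_equiv {α β : Type*} [DecidableEq α] [DecidableEq β] (f : α ≃ β) :
    ∀ l : List α, (l.map f).formPerm = f.permCongr l.formPerm
  | [] => by ext; simp [Equiv.permCongr_apply]
  | [x] => by ext; simp [Equiv.permCongr_apply]
  | x :: y :: l => by
    have h := List.formPerm_map_equiv f (y :: l)
    rw [List.map_cons] at h
    rw [List.map_cons, List.map_cons, List.formPerm_cons_cons, h, List.formPerm_cons_cons]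
    ext z
    simp only [Equiv.Perm.mul_apply, Equiv.permCongr_apply]
    exact f.injective.swap_apply _ _ _

/-- Moving `y` from behind `x` to the place in front of `z` multiplies the cyclic order by two
transpositions. For `z = bar x` these are the ones in `exists_gate`. -/
lemma List.formPerm_gate {L : Type*} [DecidableEq L] {x y z : L} {U V : List L}
    (h : (x :: y :: (U ++ z :: V)).Nodup) : (x :: (U ++ y :: z :: V)).formPerm =
      Equiv.swap z y * (x :: y :: (U ++ z :: V)).formPerm * Equiv.swap x y := by
  have hp : (x :: (U ++ y :: z :: V)).Nodup := by
    refine (List.Perm.nodup_iff (.cons x ?_)).1 h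
    exact List.perm_middle.symm
  have hm : ∀ e, e ≠ x → e ≠ y → Equiv.swap x y e = e := fun e => Equiv.swap_apply_of_ne_of_ne
  have h1 : Equiv.swap x y * (y :: (U ++ z :: V)).formPerm * Equiv.swap x y =
      (x :: (U ++ z :: V)).formPerm := by
    have := List.formPerm_map_equiv (Equiv.swap x y) (y :: (U ++ z :: V))
    have e : (y :: (U ++ z :: V)).map (Equiv.swap x y) = x :: (U ++ z :: V) := by
      rw [List.map_cons, Equiv.swap_apply_right, List.map_congr_left (g := id), List.map_id]
      intro e he
      simp only [List.nodup_cons, List.mem_cons, not_or] at h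
      refine hm e ?_ ?_
      · rintro rfl; exact h.1.2 he
      · rintro rfl; exact h.2.1 he
    rw [e] at this
    rw [this]
    ext; simp
  have h2 : (x :: (U ++ z :: V)) ~r (z :: (V ++ x :: U)) := by
    have := List.isRotated_append (l := x :: U) (l' := z :: V)
    simpa using this
  have h3 : (x :: (U ++ y :: z :: V)) ~r (y :: z :: (V ++ x :: U)) := by
    have := List.isRotated_append (l := x :: U) (l' := y :: z :: V)
    simpa using this
  have h4 : (x :: (U ++ z :: V)).Nodup := by
    simp only [List.nodup_cons, List.mem_cons, not_or] at h ⊢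
    exact ⟨h.1.2, h.2.2⟩
  rw [List.formPerm_eq_of_isRotated hp h3, List.formPerm_cons_cons, List.formPerm_cons_cons,
    mul_assoc, h1, List.formPerm_eq_of_isRotated h4 h2, Equiv.swap_comm]

variable {L : Type*} [TopologicalSpace L] [DiscreteTopology L] [Finite L] [DecidableEq L]
  {S : Type*} [TopologicalSpace S] {G : Type*} [Group G]

/-- The path homomorphism `F` on `S` is given by the labeled boundary word `W` of a polygon. -/
def WordPresents (F : PathHom S G) (bar : L → L) (W : List (L × G)) : Prop :=
  (W.map Prod.fst).Nodup ∧
    ∃ ℓ : L → G, (∀ p ∈ W, ℓ p.1 = p.2) ∧ Presents F bar (W.map Prod.fst).formPerm ℓ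

namespace WordPresents

variable {F : PathHom S G} {bar : L → L} {U V W W' : List (L × G)} {x y : L} {a b : G}

lemma rotate (h : WordPresents F bar W) (hr : W ~r W') : WordPresents F bar W' := by
  obtain ⟨hd, ℓ, hℓ, hF⟩ := h
  have hr' := hr.map Prod.fst
  refine ⟨hr'.nodup_iff.1 hd, ℓ, fun p hp => hℓ p (hr.mem_iff.2 hp), ?_⟩
  rwa [← List.formPerm_eq_of_isRotated hd hr']

lemma rotate' (h : WordPresents F bar (U ++ V)) : WordPresents F bar (V ++ U) :=
  h.rotate List.isRotated_append

variable (hbar : Function.Involutive bar)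

include hbar

/-- In terms of words, `x y U x⁻¹ V` becomes `x' U y x'⁻¹ V` with `x' = x y`. -/
lemma gate (h : WordPresents F bar ((x, a) :: (y, b) :: (U ++ (bar x, a⁻¹) :: V))) :
    WordPresents F bar ((x, a * b) :: (U ++ (y, b) :: (bar x, (a * b)⁻¹) :: V)) := by
  obtain ⟨hd, ℓ, hℓ, hF⟩ := h
  simp only [List.map_cons, List.map_append] at hd hF
  have hg := List.formPerm_gate hd
  have hd' := hd
  simp only [List.nodup_cons, List.mem_cons, List.mem_append, not_or, List.nodup_append] at hd'
  obtain ⟨⟨hxy, hxU, hxb, hxV⟩, ⟨hyU, hyb, hyV⟩, -, ⟨hbV, -⟩, hUV⟩ := hd'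
  have hnd : (x :: (U.map Prod.fst ++ y :: bar x :: V.map Prod.fst)).Nodup :=
    (List.Perm.nodup_iff (.cons x List.perm_middle.symm)).1 hd
  let ℓ' : L → G := Function.update (Function.update ℓ x (a * b)) (bar x) (a * b)⁻¹
  have hx : ℓ' x = a * b := by simp [ℓ', hxb]
  have hb : ℓ' (bar x) = (a * b)⁻¹ := by simp [ℓ']
  have he : ∀ e, e ≠ x → e ≠ bar x → ℓ' e = ℓ e := fun e h₁ h₂ => by simp [ℓ', h₁, h₂]
  have hlx : ℓ x = a := hℓ (x, a) (by simp)
  have hly : ℓ y = b := hℓ (y, b) (by simp)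
  refine ⟨by simpa using hnd, ℓ', ?_, ?_⟩
  · have mem : ∀ p, p ∈ U ∨ p ∈ V → ℓ' p.1 = p.2 := by
      intro p hp
      rw [he, hℓ p (by rcases hp with hp | hp <;> simp [hp])]
      · rintro rfl
        exact hp.elim (fun h => hxU (List.mem_map_of_mem h)) (fun h => hxV (List.mem_map_of_mem h))
      · intro h
        rw [← h] at hbV hUV
        exact hp.elim (fun h => hUV _ (List.mem_map_of_mem h) _ (Or.inl rfl) rfl)
          (fun h => hbV (List.mem_map_of_mem h))
    intro p hp
    simp only [List.mem_cons, List.mem_append] at hp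
    rcases hp with rfl | hp | rfl | rfl | hp
    · exact hx
    · exact mem p (Or.inl hp)
    · exact (he y (Ne.symm hxy) hyb).trans hly
    · exact hb
    · exact mem p (Or.inr hp)
  · simp only [List.map_cons, List.map_append]
    exact hF.gate hbar (Ne.symm hxy) hyb (Ne.symm hxb) (List.formPerm_apply_head x y _ hd) hg
      (by rw [hx, hlx, hly]) (by rw [hx, hb]) he

lemma gate_symm (h : WordPresents F bar ((x, a) :: (U ++ (y, b) :: (bar x, a⁻¹) :: V))) :
    WordPresents F bar ((x, a * b⁻¹) :: (y, b) :: (U ++ (bar x, (a * b⁻¹)⁻¹) :: V)) := by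
  obtain ⟨hnd, ℓ, hℓ, hF⟩ := h
  simp only [List.map_cons, List.map_append] at hnd hF
  have hd : (x :: y :: (U.map Prod.fst ++ bar x :: V.map Prod.fst)).Nodup :=
    (List.Perm.nodup_iff (.cons x List.perm_middle.symm)).2 hnd
  have hg := List.formPerm_gate hd
  have hd' := hd
  simp only [List.nodup_cons, List.mem_cons, List.mem_append, not_or, List.nodup_append] at hd'
  obtain ⟨⟨hxy, hxU, hxb, hxV⟩, ⟨hyU, hyb, hyV⟩, -, ⟨hbV, -⟩, hUV⟩ := hd'
  let ℓ' : L → G := Function.update (Function.update ℓ x (a * b⁻¹)) (bar x) (a * b⁻¹)⁻¹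
  have hx : ℓ' x = a * b⁻¹ := by simp [ℓ', hxb]
  have hb : ℓ' (bar x) = (a * b⁻¹)⁻¹ := by simp [ℓ']
  have he : ∀ e, e ≠ x → e ≠ bar x → ℓ' e = ℓ e := fun e h₁ h₂ => by simp [ℓ', h₁, h₂]
  have hlx : ℓ x = a := hℓ (x, a) (by simp)
  have hly : ℓ y = b := hℓ (y, b) (by simp)
  refine ⟨by simpa using hd, ℓ', ?_, ?_⟩
  · have mem : ∀ p, p ∈ U ∨ p ∈ V → ℓ' p.1 = p.2 := by
      intro p hp
      rw [he, hℓ p (by rcases hp with hp | hp <;> simp [hp])]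
      · rintro rfl
        exact hp.elim (fun h => hxU (List.mem_map_of_mem h)) (fun h => hxV (List.mem_map_of_mem h))
      · intro h
        rw [← h] at hbV hUV
        exact hp.elim (fun h => hUV _ (List.mem_map_of_mem h) _ (Or.inl rfl) rfl)
          (fun h => hbV (List.mem_map_of_mem h))
    intro p hp
    simp only [List.mem_cons, List.mem_append] at hp
    rcases hp with rfl | rfl | hp | rfl | hp
    · exact hx
    · exact (he y (Ne.symm hxy) hyb).trans hly
    · exact mem p (Or.inl hp)
    · exact hb
    · exact mem p (Or.inr hp)
  · simp only [List.map_cons, List.map_append]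
    exact hF.gate_symm hbar (Ne.symm hxy) hyb (Ne.symm hxb) (List.formPerm_apply_head x y _ hd) hg
      (by rw [hx, hlx, hly]) (by rw [hx, hb]) he

/-- The inverse gate for the letter `bar x` in a rotated word. As `bar x` carries the inverse label,
`b` now multiplies from the left. -/
lemma gate_left (h : WordPresents F bar ((y, b) :: (x, a) :: (U ++ (bar x, a⁻¹) :: V))) :
    WordPresents F bar ((x, b * a) :: (U ++ (bar x, (b * a)⁻¹) :: (y, b) :: V)) := by
  have h₁ := rotate' (U := (y, b) :: (x, a) :: U) (by simpa using h)
  have h₂ := gate_symm hbar (x := bar x) (a := a⁻¹) (U := V) (y := y) (b := b) (V := U)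
    (by simpa [hbar x] using h₁)
  have h₃ := rotate' (U := (bar x, a⁻¹ * b⁻¹) :: (y, b) :: V) (by simpa [hbar x] using h₂)
  simpa [mul_inv_rev] using h₃

lemma gate_left_symm (h : WordPresents F bar ((x, a) :: (U ++ (bar x, a⁻¹) :: (y, b) :: V))) :
    WordPresents F bar ((y, b) :: (x, b⁻¹ * a) :: (U ++ (bar x, (b⁻¹ * a)⁻¹) :: V)) := by
  have h₁ := rotate' (U := (x, a) :: U) (by simpa using h)
  have h₂ := gate hbar (x := bar x) (a := a⁻¹) (U := V) (y := y) (b := b) (V := U)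
    (by simpa [hbar x] using h₁)
  have h₃ := rotate' (U := (bar x, a⁻¹ * b) :: V) (by simpa [hbar x] using h₂)
  simpa [mul_inv_rev] using h₃

end WordPresents

/-- The part of the boundary word belonging to a handle. -/
def handleWord (bar : L → L) (p : (L × L) × (G × G)) : List (L × G) :=
  [(p.1.1, p.2.1), (p.1.2, p.2.2), (bar p.1.1, p.2.1⁻¹), (bar p.1.2, p.2.2⁻¹)]

namespace WordPresents

variable {F : PathHom S G} {bar : L → L} {U V W W' : List (L × G)} {x y : L} {a b : G}
  (hbar : Function.Involutive bar)

include hbar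

/-- The letter `z` crosses the four sides of the handle one by one, each time by a gate with respect
to `p` or `q`. Each of the two values is multiplied once from the left and once from the right,
hence conjugated. -/
lemma handle_comm_letter {q : L × L} {z : L} {a b c : G}
    (h : WordPresents F bar (handleWord bar (q, (a, b)) ++ (z, c) :: V)) :
    WordPresents F bar ((z, c) :: (handleWord bar (q, (c⁻¹ * a * c, c⁻¹ * b * c)) ++ V)) := by
  obtain ⟨p, q⟩ := q
  simp only [handleWord, List.cons_append, List.nil_append] at h ⊢
  have h₁ := gate_left_symm hbar (x := q) (a := b) (y := z) (b := c) (U := [(bar p, a⁻¹)])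
    (V := V ++ [(p, a)]) (by simpa using rotate' (U := [(p, a)]) h)
  have r₁ := rotate' (V := [(p, a)])
    (U := (z, c) :: (q, c⁻¹ * b) :: (bar p, a⁻¹) :: (bar q, (c⁻¹ * b)⁻¹) :: V) (by simpa using h₁)
  have h₂ := gate hbar (x := p) (a := a) (y := z) (b := c) (U := [(q, c⁻¹ * b)])
    (V := (bar q, (c⁻¹ * b)⁻¹) :: V) (by simpa using r₁)
  have h₃ := gate hbar (x := q) (a := c⁻¹ * b) (y := z) (b := c) (U := [(bar p, (a * c)⁻¹)])
    (V := V ++ [(p, a * c)]) (by simpa using rotate' (U := [(p, a * c)]) h₂)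
  have r₃ := rotate' (V := [(p, a * c)]) (U := (q, c⁻¹ * b * c) :: (bar p, (a * c)⁻¹) :: (z, c) ::
    (bar q, (c⁻¹ * b * c)⁻¹) :: V) (by simpa using h₃)
  have h₄ := gate_left_symm hbar (x := p) (a := a * c) (y := z) (b := c) (U := [(q, c⁻¹ * b * c)])
    (V := (bar q, (c⁻¹ * b * c)⁻¹) :: V) (by simpa using r₃)
  simpa [mul_assoc] using h₄

lemma handle_comm {q : L × L} {a b : G} {Z : List (L × G)}
    (h : WordPresents F bar (handleWord bar (q, (a, b)) ++ (Z ++ V))) :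
    WordPresents F bar (Z ++ (handleWord bar (q, ((Z.map Prod.snd).prod⁻¹ * a * (Z.map Prod.snd).prod,
      (Z.map Prod.snd).prod⁻¹ * b * (Z.map Prod.snd).prod)) ++ V)) := by
  induction Z generalizing a b V with
  | nil => simpa using h
  | cons z Z ih =>
    have h₁ := handle_comm_letter hbar (z := z.1) (c := z.2) (V := Z ++ V) (by simpa using h)
    have r₁ := rotate' (U := [z]) (V := handleWord bar (q, (z.2⁻¹ * a * z.2, z.2⁻¹ * b * z.2)) ++
      (Z ++ V)) (by simpa using h₁)
    have h₂ := ih (V := V ++ [z]) (by simpa using r₁)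
    have h₃ := rotate' (V := [z]) (U := Z ++ (handleWord bar (q, _) ++ V)) (by simpa using h₂)
    simpa [mul_assoc] using h₃

lemma handle_twistFst {q : L × L} {h : G × G}
    (hW : WordPresents F bar (handleWord bar (q, h) ++ V)) :
    WordPresents F bar (handleWord bar (q, twistFst h) ++ V) := by
  obtain ⟨p, q⟩ := q
  obtain ⟨a, b⟩ := h
  exact gate hbar (x := p) (a := a) (y := q) (b := b) (U := []) (V := (bar q, b⁻¹) :: V) hW

lemma handle_twistSnd {q : L × L} {h : G × G}
    (hW : WordPresents F bar (handleWord bar (q, h) ++ V)) :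
    WordPresents F bar (handleWord bar (q, twistSnd h) ++ V) := by
  obtain ⟨p, q⟩ := q
  obtain ⟨a, b⟩ := h
  have h₁ := gate hbar (x := q) (a := b) (y := bar p) (b := a⁻¹) (U := []) (V := V ++ [(p, a)])
    (by simpa using rotate' (U := [(p, a)]) hW)
  simpa [handleWord, twistSnd] using rotate' (V := [(p, a)]) (U := (q, b * a⁻¹) ::
    (bar p, a⁻¹) :: (bar q, (b * a⁻¹)⁻¹) :: V) (by simpa using h₁)

lemma handle_handleComm {q₁ q₂ : L × L} {p : (G × G) × (G × G)}
    (hW : WordPresents F bar (handleWord bar (q₁, p.1) ++ (handleWord bar (q₂, p.2) ++ V))) :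
    WordPresents F bar (handleWord bar (q₂, (handleComm p).1) ++
      (handleWord bar (q₁, (handleComm p).2) ++ V)) := by
  obtain ⟨⟨a₁, b₁⟩, ⟨a₂, b₂⟩⟩ := p
  have h := handle_comm hbar hW
  have e : ((handleWord bar (q₂, (a₂, b₂))).map Prod.snd).prod = ⁅a₂, b₂⁆ := by
    simp [handleWord, commutatorElement_def, mul_assoc]
  rw [e] at h
  exact h

/-- The last side of the first handle is moved into the second one, which changes the label of `x₂`
to `b₁⁻¹ * a₂`; then the sides of the second handle are carried across the first until both are
contiguous again. -/
lemma handle_handleSlide {q₁ q₂ : L × L} {p : (G × G) × (G × G)}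
    (hW : WordPresents F bar (handleWord bar (q₁, p.1) ++ (handleWord bar (q₂, p.2) ++ V))) :
    WordPresents F bar (handleWord bar (q₂, (handleSlide p).1) ++
      (handleWord bar (q₁, (handleSlide p).2) ++ V)) := by
  obtain ⟨⟨a₁, b₁⟩, ⟨a₂, b₂⟩⟩ := p
  obtain ⟨x₁, y₁⟩ := q₁
  obtain ⟨x₂, y₂⟩ := q₂
  have r₀ := rotate' (U := [(x₁, a₁), (y₁, b₁), (bar x₁, a₁⁻¹)])
    (V := (bar y₁, b₁⁻¹) :: (handleWord bar ((x₂, y₂), (a₂, b₂)) ++ V))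
    (by simpa [handleWord] using hW)
  have h₁ := gate_left hbar (y := bar y₁) (b := b₁⁻¹) (x := x₂) (a := a₂) (U := [(y₂, b₂)])
    (V := (bar y₂, b₂⁻¹) :: (V ++ [(x₁, a₁), (y₁, b₁), (bar x₁, a₁⁻¹)]))
    (by simpa [handleWord] using r₀)
  set a := b₁⁻¹ * a₂ with ha
  have r₁ := rotate' (V := [(x₁, a₁), (y₁, b₁), (bar x₁, a₁⁻¹)]) (U := (x₂, a) :: (y₂, b₂) ::
    (bar x₂, a⁻¹) :: (bar y₁, b₁⁻¹) :: (bar y₂, b₂⁻¹) :: V) (by simpa using h₁)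
  -- The letters `x₂`, `y₂`, `bar x₂` pass in turn to the left of `x₁ y₁ bar x₁`, which brings `bar
  -- y₁` back behind its handle.
  have h₂ := gate_left_symm hbar (x := x₁) (a := a₁) (y := x₂) (b := a) (U := [(y₁, b₁)])
    (V := (y₂, b₂) :: (bar x₂, a⁻¹) :: (bar y₁, b₁⁻¹) :: (bar y₂, b₂⁻¹) :: V)
    (by simpa using r₁)
  have h₃ := gate_left_symm hbar (x := x₁) (a := a⁻¹ * a₁) (y := y₂) (b := b₂) (U := [(y₁, b₁)])
    (V := (bar x₂, a⁻¹) :: (bar y₁, b₁⁻¹) :: (bar y₂, b₂⁻¹) :: (V ++ [(x₂, a)]))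
    (by simpa using rotate' (U := [(x₂, a)]) h₂)
  have h₄ := gate_left_symm hbar (x := x₁) (a := b₂⁻¹ * (a⁻¹ * a₁)) (y := bar x₂) (b := a⁻¹)
    (U := [(y₁, b₁)]) (V := (bar y₁, b₁⁻¹) :: (bar y₂, b₂⁻¹) :: (V ++ [(x₂, a), (y₂, b₂)]))
    (by simpa using rotate' (U := [(y₂, b₂)]) h₃)
  -- Now only `bar y₂` stands on the wrong side of the complete first handle.
  have h₅ := handle_comm_letter hbar (q := (x₁, y₁)) (a := a⁻¹⁻¹ * (b₂⁻¹ * (a⁻¹ * a₁))) (b := b₁)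
    (z := bar y₂) (c := b₂⁻¹) (V := V ++ [(x₂, a), (y₂, b₂), (bar x₂, a⁻¹)])
    (by simpa [handleWord] using rotate' (U := [(bar x₂, a⁻¹)]) h₄)
  have h₆ := rotate' (V := [(x₂, a), (y₂, b₂), (bar x₂, a⁻¹)]) (U := (bar y₂, b₂⁻¹) ::
    (handleWord bar ((x₁, y₁), _) ++ V)) (by simpa using h₅)
  simpa [handleWord, handleSlide, ha, mul_assoc] using h₆

end WordPresents

/-- The path homomorphism `F` on `S` is given by the labels `T` of the handles of a surface. -/
def HandlesPresent (F : PathHom S G) (bar : L → L) (T : List (G × G)) : Prop :=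
  ∃ P : List ((L × L) × (G × G)), T = P.map Prod.snd ∧
    WordPresents F bar (P.flatMap (handleWord bar)) ∧
    ∀ e, ∃ p ∈ P, e = p.1.1 ∨ e = p.1.2 ∨ e = bar p.1.1 ∨ e = bar p.1.2

namespace HandlesPresent

variable {F : PathHom S G} {bar : L → L}

lemma of_step (hbar : Function.Involutive bar) {T T' : List (G × G)} (h : HandlesPresent F bar T)
    (hT : HandleStep T T') : HandlesPresent F bar T' := by
  obtain ⟨P, rfl, hW, hP⟩ := h
  generalize hPT : P.map Prod.snd = T at hT
  -- Words are cyclic, so the handles affected by a move may be rotated to the front; the move is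
  -- made there and the rotation is undone.
  have one : ∀ (pre post : List (G × G)) (h h' : G × G), P.map Prod.snd = pre ++ h :: post →
      (∀ V q, WordPresents F bar (handleWord bar (q, h) ++ V) →
        WordPresents F bar (handleWord bar (q, h') ++ V)) →
      HandlesPresent F bar (pre ++ h' :: post) := by
    intro pre post h h' hPT H
    obtain ⟨A, B, rfl, rfl, hB⟩ := List.map_eq_append_iff.1 hPT
    obtain ⟨⟨q, k⟩, B, rfl, hh, rfl⟩ := List.map_eq_cons_iff.1 hB
    obtain rfl : k = h := hh
    refine ⟨A ++ (q, h') :: B, by simp, ?_, fun e => ?_⟩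
    · have r := WordPresents.rotate' (U := A.flatMap (handleWord bar))
        (V := handleWord bar (q, k) ++ B.flatMap (handleWord bar)) (by simpa using hW)
      have h₁ := H (B.flatMap (handleWord bar) ++ A.flatMap (handleWord bar)) q
        (by simpa using r)
      simpa using WordPresents.rotate' (V := A.flatMap (handleWord bar))
        (U := handleWord bar (q, h') ++ B.flatMap (handleWord bar)) (by simpa using h₁)
    · obtain ⟨p, hp, he⟩ := hP e
      simp only [List.mem_append, List.mem_cons] at hp
      rcases hp with hp | rfl | hp
      · exact ⟨p, by simp [hp], he⟩
      · exact ⟨(q, h'), by simp, he⟩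
      · exact ⟨p, by simp [hp], he⟩
  have two : ∀ (pre post : List (G × G)) (p p' : (G × G) × (G × G)),
      P.map Prod.snd = pre ++ p.1 :: p.2 :: post →
      (∀ V q₁ q₂, WordPresents F bar (handleWord bar (q₁, p.1) ++ (handleWord bar (q₂, p.2) ++ V)) →
        WordPresents F bar (handleWord bar (q₂, p'.1) ++ (handleWord bar (q₁, p'.2) ++ V))) →
      HandlesPresent F bar (pre ++ p'.1 :: p'.2 :: post) := by
    intro pre post p p' hPT H
    obtain ⟨A, B, rfl, rfl, hB⟩ := List.map_eq_append_iff.1 hPT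
    obtain ⟨⟨q₁, _⟩, B₁, rfl, rfl, hB₁⟩ := List.map_eq_cons_iff.1 hB
    obtain ⟨⟨q₂, _⟩, B, rfl, h₂, rfl⟩ := List.map_eq_cons_iff.1 hB₁
    obtain rfl : _ = p.2 := h₂
    refine ⟨A ++ (q₂, p'.1) :: (q₁, p'.2) :: B, by simp, ?_, fun e => ?_⟩
    · have r := WordPresents.rotate' (U := A.flatMap (handleWord bar))
        (V := handleWord bar (q₁, p.1) ++ (handleWord bar (q₂, p.2) ++ B.flatMap (handleWord bar)))
        (by simpa using hW)
      have h₁ := H (B.flatMap (handleWord bar) ++ A.flatMap (handleWord bar)) q₁ q₂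
        (by simpa using r)
      simpa using WordPresents.rotate' (V := A.flatMap (handleWord bar))
        (U := handleWord bar (q₂, p'.1) ++ (handleWord bar (q₁, p'.2) ++
          B.flatMap (handleWord bar))) (by simpa using h₁)
    · obtain ⟨p, hp, he⟩ := hP e
      simp only [List.mem_append, List.mem_cons] at hp
      rcases hp with hp | rfl | rfl | hp
      · exact ⟨p, by simp [hp], he⟩
      · exact ⟨(q₁, p'.2), by simp, he⟩
      · exact ⟨(q₂, p'.1), by simp, he⟩
      · exact ⟨p, by simp [hp], he⟩
  cases hT with
  | twistFst pre post h => exact one _ _ _ _ hPT fun V q => .handle_twistFst hbar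
  | twistSnd pre post h => exact one _ _ _ _ hPT fun V q => .handle_twistSnd hbar
  | comm pre post p => exact two _ _ _ _ hPT fun V q₁ q₂ => .handle_handleComm hbar
  | slide pre post p => exact two _ _ _ _ hPT fun V q₁ q₂ => .handle_handleSlide hbar

lemma of_rel (hbar : Function.Involutive bar) {T T' : List (G × G)} (h : HandlesPresent F bar T)
    (hT : HandleRel T T') : HandlesPresent F bar T' := by
  induction hT with
  | refl => exact h
  | tail _ hs ih => exact ih.of_step hbar hs

end HandlesPresent

end Words

/-! ### The standard word of genus g and its division into two words. -/

section StandardWord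

set_option linter.unusedSectionVars false

open Topology SectorSurface

variable {L : Type*} [TopologicalSpace L] [DiscreteTopology L] [Finite L] [DecidableEq L]
  {S : Type*} [TopologicalSpace S] {G : Type*} [Group G]

lemma SectorSurface.Presents.relabel {L' : Type*} [TopologicalSpace L'] [DiscreteTopology L']
    [Finite L'] {F : PathHom S G} {bar : L → L} {bar' : L' → L'} {σ : Equiv.Perm L}
    {σ' : Equiv.Perm L'} {ℓ : L → G} (h : Presents F bar σ ℓ) (τ : L ≃ L')
    (hbar : ∀ e, bar' (τ e) = τ (bar e)) (hσ : ∀ e, σ' (τ e) = τ (σ e)) :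
    Presents F bar' σ' (ℓ ∘ τ.symm) := by
  obtain ⟨h, hh⟩ := h
  obtain ⟨k, hk⟩ := exists_quot_homeomorph (SectorGluing bar' σ') (SectorGluing bar σ)
    (fun a a' => a = (τ a'.1, a'.2))
    (isClosed_eq continuous_fst (by fun_prop)) (fun a => ⟨(τ.symm a.1, a.2), by simp⟩)
    (fun a' => ⟨_, rfl⟩) (fun a b c h₁ h₂ => by rw [h₁, h₂])
    (fun a c d h₁ h₂ => by
      rw [h₁] at h₂
      obtain ⟨h₃, h₄⟩ := Prod.mk.inj h₂
      rw [show c = d from Prod.ext (τ.injective h₃) h₄]) (by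
    rintro _ _ (⟨e, e'⟩ | ⟨e, r⟩ | ⟨e, t⟩)
    · exact ⟨(τ.symm e, _), (τ.symm e', _), by simp, by simp, Quot.sound (.center _ _)⟩
    · refine ⟨(τ.symm e, _), (σ (τ.symm e), _), by simp, ?_, Quot.sound (.spoke _ r)⟩
      rw [← hσ, Equiv.apply_symm_apply]
    · refine ⟨(τ.symm e, _), (bar (τ.symm e), _), by simp, ?_, Quot.sound (.side _ t)⟩
      rw [← hbar, Equiv.apply_symm_apply]) (by
    rintro _ _ (⟨e, e'⟩ | ⟨e, r⟩ | ⟨e, t⟩)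
    · exact ⟨_, _, rfl, rfl, Quot.sound (.center _ _)⟩
    · refine ⟨_, _, rfl, rfl, ?_⟩
      rw [← hσ]
      exact Quot.sound (.spoke _ r)
    · refine ⟨_, _, rfl, rfl, ?_⟩
      rw [← hbar]
      exact Quot.sound (.side _ t))
  refine ⟨k.trans h, fun e => ?_⟩
  rw [Function.comp_apply, ← hh]
  refine F.congr _ _ fun t => congrArg h ?_
  exact hk _ _ (by simp)

/-- The letters `a₁, b₁, a₁⁻¹, b₁⁻¹, a₂, ⋯` of the standard word of genus `g`, in this order. -/
abbrev StdLetter (g : ℕ) : Type := Fin g × Fin 4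

/-- The inverse letter. -/
def stdBar {g : ℕ} (e : StdLetter g) : StdLetter g := (e.1, e.2 + 2)

/-- The position of a letter. -/
def stdIndex {g : ℕ} (e : StdLetter g) : ℕ := 4 * e.1 + e.2

/-- The next letter, in cyclic order. -/
def letterNext (g : ℕ) : Equiv.Perm (StdLetter g) := finProdFinEquiv.symm.permCongr (finRotate (g * 4))

lemma stdBar_involutive (g : ℕ) : Function.Involutive (stdBar (g := g)) := fun e => by
  ext
  · rfl
  · simp only [stdBar, add_assoc]
    congr 1
    exact add_zero e.2

lemma stdIndex_lt {g : ℕ} (e : StdLetter g) : stdIndex e < 4 * g := by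
  unfold stdIndex; omega

lemma stdIndex_injective (g : ℕ) : Function.Injective (stdIndex (g := g)) := by
  rintro ⟨i, j⟩ ⟨i', j'⟩ h
  simp only [stdIndex] at h
  ext <;> simp only <;> omega

lemma stdIndex_letterNext {g : ℕ} (e : StdLetter g) :
    stdIndex (letterNext g e) = if stdIndex e + 1 = 4 * g then 0 else stdIndex e + 1 := by
  have key : ∀ e : StdLetter g, stdIndex e = (finProdFinEquiv e : ℕ) := fun e => by
    simp [stdIndex, finProdFinEquiv, add_comm]
  rw [key, key, letterNext, Equiv.permCongr_apply, Equiv.apply_symm_apply, Equiv.symm_symm]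
  obtain ⟨n, hn⟩ : ∃ n, g * 4 = n + 1 := ⟨g * 4 - 1, by have := e.1.2; omega⟩
  generalize finProdFinEquiv e = k
  have h4 : 4 * g = n + 1 := by omega
  rw [h4]
  revert k
  rw [hn]
  intro k
  rw [coe_finRotate]
  simp [Fin.ext_iff]

lemma letterNext_eq {g : ℕ} {e e' : StdLetter g}
    (h : stdIndex e' = if stdIndex e + 1 = 4 * g then 0 else stdIndex e + 1) : letterNext g e = e' :=
  stdIndex_injective g ((stdIndex_letterNext e).trans h.symm)

lemma drop_flatMap_handleWord (bar : L → L) (P : List ((L × L) × (G × G))) (i : ℕ) :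
    (P.flatMap (handleWord bar)).drop (4 * i) = (P.drop i).flatMap (handleWord bar) := by
  induction i generalizing P with
  | zero => simp
  | succ i ih =>
    cases P with
    | nil => simp
    | cons p P => simpa [handleWord, mul_add] using ih P

lemma length_flatMap_handleWord (bar : L → L) (P : List ((L × L) × (G × G))) :
    (P.flatMap (handleWord bar)).length = 4 * P.length := by
  induction P with
  | nil => rfl
  | cons p P ih => simp [ih, handleWord]; omega

lemma getElem?_flatMap_handleWord (bar : L → L) (P : List ((L × L) × (G × G))) (i : ℕ)
    (hi : i < P.length) (j : Fin 4) :
    (P.flatMap (handleWord bar))[4 * i + j]? = (handleWord bar P[i])[j]? := by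
  rw [← List.getElem?_drop, drop_flatMap_handleWord, List.drop_eq_getElem_cons hi,
    List.flatMap_cons]
  fin_cases j <;> rfl

/-- A path homomorphism given by handle labels can be put on the standard sector surface. -/
lemma HandlesPresent.exists_presents {F : PathHom S G} {bar : L → L}
    (hbar : Function.Involutive bar) {T : List (G × G)} (hT : HandlesPresent F bar T) {g : ℕ}
    (hg : T.length = g) : ∃ ℓ : StdLetter g → G, Presents F stdBar (letterNext g) ℓ ∧
      ∀ (i : Fin g) (j : Fin 4), T[(i : ℕ)]? = some (1, 1) → ℓ (i, j) = 1 := by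
  obtain ⟨P, rfl, ⟨hd, ℓ, hℓ, hF⟩, hP⟩ := hT
  rw [List.length_map] at hg
  set W := P.flatMap (handleWord bar) with hW
  have hlen : W.length = 4 * g := by rw [hW, length_flatMap_handleWord, hg]
  have hlt : ∀ e : StdLetter g, stdIndex e < W.length := fun e => by
    rw [hlen]; exact stdIndex_lt e
  have hlt' : ∀ e : StdLetter g, stdIndex e < (W.map Prod.fst).length := fun e => by
    rw [List.length_map]; exact hlt e
  let φ : StdLetter g → L := fun e => (W.map Prod.fst)[stdIndex e]'(hlt' e)
  have hφ : ∀ e, φ e = (W[stdIndex e]'(hlt e)).1 := fun e => List.getElem_map _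
  have hWe : ∀ (i : Fin g) (j : Fin 4), W[stdIndex (i, j)]'(hlt _) =
      (handleWord bar (P[(i : ℕ)]'(by omega)))[j] := fun i j => by
    have := getElem?_flatMap_handleWord bar P i (by omega) j
    rw [← hW] at this
    change W[stdIndex (i, j)]? = _ at this
    rw [List.getElem?_eq_getElem (hlt (i, j))] at this
    rw [← Option.some_inj, this]
    fin_cases j <;> rfl
  have hinj : Function.Injective φ := fun e e' h =>
    stdIndex_injective g ((hd.getElem_inj_iff).1 h)
  have hsurj : Function.Surjective φ := fun e => by
    obtain ⟨p, hp, he⟩ := hP e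
    obtain ⟨i, hi, rfl⟩ := List.getElem_of_mem hp
    have : ∀ j : Fin 4, φ (⟨i, by omega⟩, j) = ((handleWord bar P[i])[j]).1 := fun j => by
      rw [hφ, hWe]
    rcases he with rfl | rfl | rfl | rfl
    exacts [⟨_, this 0⟩, ⟨_, this 1⟩, ⟨_, this 2⟩, ⟨_, this 3⟩]
  let τ : StdLetter g ≃ L := Equiv.ofBijective φ ⟨hinj, hsurj⟩
  have hb : ∀ e, φ (stdBar e) = bar (φ e) := by
    rintro ⟨i, j⟩
    rw [hφ, hφ, stdBar, hWe, hWe]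
    fin_cases j
    · rfl
    · rfl
    · exact (hbar _).symm
    · exact (hbar _).symm
  have hn : ∀ e, φ (letterNext g e) = (W.map Prod.fst).formPerm (φ e) := by
    intro e
    rw [List.formPerm_apply_getElem _ hd]
    change (W.map Prod.fst)[stdIndex (letterNext g e)]'(hlt' _) = _
    congr 1
    rw [stdIndex_letterNext, List.length_map, hlen]
    split_ifs with h
    · simp [h]
    · have := stdIndex_lt e
      rw [Nat.mod_eq_of_lt (by omega)]
  refine ⟨_, hF.relabel τ.symm (fun e => ?_) (fun e => ?_), fun i j h => ?_⟩
  · obtain ⟨e, rfl⟩ := τ.surjective e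
    rw [τ.symm_apply_apply, Equiv.eq_symm_apply]
    exact hb e
  · obtain ⟨e, rfl⟩ := τ.surjective e
    rw [τ.symm_apply_apply, Equiv.eq_symm_apply]
    exact hn e
  · have h1 : ℓ (φ (i, j)) = (W[stdIndex (i, j)]'(hlt _)).2 := by
      rw [hφ, hℓ _ (List.getElem_mem _)]
    change ℓ (φ (i, j)) = 1
    rw [h1, hWe]
    have h2 : (P[(i : ℕ)]'(by omega)).2 = (1, 1) := by
      rw [List.getElem?_map, List.getElem?_eq_getElem (by omega)] at h
      simpa using h
    fin_cases j <;> simp [handleWord, h2]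

/-- The list is read off from the labels of the first two letters of each handle; the other two
labels are their inverses. -/
lemma exists_handlesPresent {g : ℕ} (F : PathHom S G)
    (h : SectorSurface (stdBar (g := g)) (letterNext g) ≃ₜ S) :
    ∃ T : List (G × G), T.length = g ∧ HandlesPresent F (stdBar (g := g)) T := by
  let ℓ := label (F.comap (h : C(SectorSurface (stdBar (g := g)) (letterNext g), S)))
  have hb : ∀ e, ℓ (stdBar e) = (ℓ e)⁻¹ := label_bar _
  let P : List ((StdLetter g × StdLetter g) × (G × G)) :=
    (List.finRange g).map fun i => (((i, 0), (i, 1)), (ℓ (i, 0), ℓ (i, 1)))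
  set W := P.flatMap (handleWord stdBar) with hW
  have hlen : W.length = 4 * g := by rw [hW, length_flatMap_handleWord]; simp [P]
  have hlt : ∀ e : StdLetter g, stdIndex e < W.length := fun e => by
    rw [hlen]; exact stdIndex_lt e
  have hWe : ∀ e : StdLetter g, W[stdIndex e]'(hlt e) = (e, ℓ e) := by
    rintro ⟨i, j⟩
    have := getElem?_flatMap_handleWord stdBar P i (by simp [P]) j
    rw [← hW] at this
    change W[stdIndex (i, j)]? = _ at this
    rw [List.getElem?_eq_getElem (hlt (i, j))] at this
    rw [← Option.some_inj, this]
    fin_cases j <;> simp only [handleWord, P, List.getElem_map, List.getElem_finRange]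
    · rfl
    · rfl
    · exact congrArg (fun x => some ((i, 2), x)) (hb (i, 0)).symm
    · exact congrArg (fun x => some ((i, 3), x)) (hb (i, 1)).symm
  have hex : ∀ k, k < W.length → ∃ e : StdLetter g, stdIndex e = k := fun k hk => by
    rw [hlen] at hk
    exact ⟨(⟨k / 4, by omega⟩, ⟨k % 4, by omega⟩), by simp only [stdIndex]; omega⟩
  have hlt' : ∀ e : StdLetter g, stdIndex e < (W.map Prod.fst).length := fun e => by
    rw [List.length_map]; exact hlt e
  have hWe' : ∀ e : StdLetter g, (W.map Prod.fst)[stdIndex e]'(hlt' e) = e := fun e => by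
    rw [List.getElem_map, hWe]
  have hd : (W.map Prod.fst).Nodup := by
    rw [List.nodup_iff_injective_get]
    rintro ⟨k, hk⟩ ⟨k', hk'⟩ h
    obtain ⟨e, rfl⟩ := hex k (by simpa using hk)
    obtain ⟨e', rfl⟩ := hex k' (by simpa using hk')
    simp only [List.get_eq_getElem] at h
    rw [hWe', hWe'] at h
    simp [h]
  refine ⟨P.map Prod.snd, by simp [P], P, rfl, ⟨hd, ℓ, fun p hp => ?_, ?_⟩, fun e => ?_⟩
  · obtain ⟨k, hk, rfl⟩ := List.getElem_of_mem hp
    obtain ⟨e, rfl⟩ := hex k hk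
    rw [hWe]
  · have : (W.map Prod.fst).formPerm = letterNext g := by
      ext1 e
      conv_lhs => rw [← hWe' e]
      rw [List.formPerm_apply_getElem _ hd, ← hWe' (letterNext g e)]
      congr 1
      rw [stdIndex_letterNext, List.length_map, hlen]
      split_ifs with h
      · simp [h]
      · have := stdIndex_lt e
        rw [Nat.mod_eq_of_lt (by omega)]
    rw [← hW, this]
    exact ⟨h, fun e => rfl⟩
  · obtain ⟨i, j⟩ := e
    refine ⟨(((i, 0), (i, 1)), (ℓ (i, 0), ℓ (i, 1))), List.mem_map_of_mem (List.mem_finRange i), ?_⟩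
    fin_cases j <;> simp [stdBar]

/-- The cyclic order on the letters of two words which are read one after the other, where `x` and
`y` are the initial letters. -/
def joinPerm {L L' : Type*} [DecidableEq L] [DecidableEq L'] (σ : Equiv.Perm L) (σ' : Equiv.Perm L')
    (x : L) (y : L') : Equiv.Perm (L ⊕ L') :=
  Equiv.swap (.inl x) (.inr y) * Equiv.Perm.sumCongr σ σ'

section Join

variable {L L' : Type*} [DecidableEq L] [DecidableEq L'] (σ : Equiv.Perm L) (σ' : Equiv.Perm L')
  (x : L) (y : L')

lemma joinPerm_inl (e : L) :
    joinPerm σ σ' x y (.inl e) = if σ e = x then .inr y else .inl (σ e) := by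
  simp only [joinPerm, Equiv.Perm.mul_apply, Equiv.Perm.sumCongr_apply, Sum.map_inl,
    Equiv.swap_apply_def, Sum.inl.injEq, reduceCtorEq, if_false]

lemma joinPerm_inr (e : L') :
    joinPerm σ σ' x y (.inr e) = if σ' e = y then .inl x else .inr (σ' e) := by
  simp only [joinPerm, Equiv.Perm.mul_apply, Equiv.Perm.sumCongr_apply, Sum.map_inr,
    Equiv.swap_apply_def, Sum.inr.injEq, reduceCtorEq, if_false]

end Join

/-- The initial letter. -/
def stdFirst (g : ℕ) : StdLetter (g + 1) := (0, 0)

/-- The letters of the standard word of genus `1 + (g + 1)`, split into two words. -/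
lemma exists_splitEquiv (g : ℕ) :
    ∃ τ : StdLetter (1 + (g + 1)) ≃ StdLetter (g + 1) ⊕ StdLetter 1,
      (∀ e, Sum.map stdBar stdBar (τ e) = τ (stdBar e)) ∧
      (∀ e, joinPerm (letterNext (g + 1)) (letterNext 1) (stdFirst g) (stdFirst 0) (τ e) =
        τ (letterNext _ e)) ∧ ∀ e, ∃ j, τ.symm (.inr e) = (0, j) := by
  -- Handle 0 forms the second word; the remaining handles, shifted by one, form the first.
  let τ : StdLetter (1 + (g + 1)) ≃ StdLetter (g + 1) ⊕ StdLetter 1 :=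
    ((finSumFinEquiv.symm.trans (Equiv.sumComm _ _)).prodCongr (Equiv.refl _)).trans
      (Equiv.sumProdDistrib _ _ _)
  have τl : ∀ (i : Fin (g + 1)) (j : Fin 4), τ.symm (.inl (i, j)) = (i.natAdd 1, j) := fun i j => rfl
  have τr : ∀ (i : Fin 1) (j : Fin 4), τ.symm (.inr (i, j)) = (i.castAdd (g + 1), j) := fun i j => rfl
  refine ⟨τ, fun e => ?_, fun e => ?_, ?_⟩
  · obtain ⟨e | e, rfl⟩ := τ.symm.surjective e <;>
      (rw [Equiv.apply_symm_apply, ← Equiv.symm_apply_eq]; rfl)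
  · have il : ∀ e, stdIndex (τ.symm (.inl e)) = 4 + stdIndex e := fun ⟨i, j⟩ => by
      rw [τl]; simp [stdIndex]; ring
    have ir : ∀ e, stdIndex (τ.symm (.inr e)) = stdIndex e := fun ⟨i, j⟩ => by
      rw [τr]; simp [stdIndex]
    have f0 : stdIndex (stdFirst g) = 0 := rfl
    have f0' : stdIndex (stdFirst 0) = 0 := rfl
    obtain ⟨e | e, rfl⟩ := τ.symm.surjective e <;> rw [Equiv.apply_symm_apply, ← Equiv.symm_apply_eq] <;>
      refine (letterNext_eq ?_).symm
    · have hlt := stdIndex_lt e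
      have hs := stdIndex_letterNext e
      rw [joinPerm_inl]
      split_ifs with h₁ h₂ h₂
      · rw [ir]; rfl
      · rw [h₁, f0] at hs
        rw [il] at h₂
        split_ifs at hs <;> omega
      · rw [il] at h₂
        exact absurd (stdIndex_injective _ (by rw [hs, f0, if_pos (by omega)])) h₁
      · rw [il] at h₂
        rw [il, il, hs, if_neg (by omega)]
        rfl
    · have hlt := stdIndex_lt e
      have hs := stdIndex_letterNext e
      rw [joinPerm_inr, if_neg (c := stdIndex (τ.symm (.inr e)) + 1 = 4 * (1 + (g + 1))) (by rw [ir]; omega)]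
      split_ifs with h₁
      · rw [h₁, f0'] at hs
        rw [il, ir, f0]
        split_ifs at hs <;> omega
      · rw [ir, ir, hs, if_neg]
        intro h₂
        exact h₁ (stdIndex_injective _ (by rw [hs, f0', if_pos h₂]))
  · rintro ⟨i, j⟩
    exact ⟨j, by rw [τr, show i.castAdd (g + 1) = 0 by ext; simp]⟩

lemma SectorSurface.Presents.split {F : PathHom S G} {g : ℕ} {ℓ : StdLetter (1 + (g + 1)) → G}
    (h : Presents F stdBar (letterNext (1 + (g + 1))) ℓ) (hℓ : ∀ j, ℓ (0, j) = 1) :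
    ∃ ℓ' : StdLetter (g + 1) ⊕ StdLetter 1 → G, Presents F (Sum.map stdBar stdBar)
      (joinPerm (letterNext (g + 1)) (letterNext 1) (stdFirst g) (stdFirst 0)) ℓ' ∧
      ∀ e, ℓ' (.inr e) = 1 := by
  obtain ⟨τ, hbar, hσ, hτ⟩ := exists_splitEquiv g
  refine ⟨_, h.relabel τ hbar hσ, fun e => ?_⟩
  obtain ⟨j, hj⟩ := hτ e
  rw [Function.comp_apply, hj]
  exact hℓ j

end StandardWord

/-! ### The disk model and the sector model of the standard surface. -/

section StandardSurfaces

open Topology SectorSurface Triangle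

namespace Triangle

/-- The point with distance `r` from the center in direction `t`. -/
def polar (r t : unitInterval) : Triangle :=
  ⟨(r * (1 - t), r * t), mul_nonneg r.2.1 (by linarith [t.2.2]), mul_nonneg r.2.1 t.2.1, by
    simp only; linarith [r.2.2, mul_sub (r : ℝ) 1 t]⟩

lemma exists_polar_eq (q : Triangle) : ∃ r t, polar r t = q := by
  obtain ⟨⟨s, f⟩, h1, h2, h3⟩ := q
  simp only at h1 h2 h3
  rcases (add_nonneg h1 h2).eq_or_lt with h | h
  · refine ⟨0, 0, ?_⟩
    ext <;> simp [polar] <;> linarith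
  · refine ⟨⟨s + f, h.le, h3⟩, ⟨f / (s + f), by positivity, (div_le_one h).2 (by linarith)⟩, ?_⟩
    ext <;> simp only [polar] <;> field_simp
    ring

lemma polar_eq_polar {r t r' t' : unitInterval} (h : polar r t = polar r' t') :
    r = r' ∧ ((r : ℝ) = 0 ∨ t = t') := by
  have h1 := congrArg (fun q : Triangle => q.1.1) h
  have h2 := congrArg (fun q : Triangle => q.1.2) h
  simp only [polar] at h1 h2
  have hr : (r : ℝ) = r' := by linarith
  refine ⟨Subtype.ext hr, ?_⟩
  rw [← hr] at h2
  rcases eq_or_ne (r : ℝ) 0 with h0 | h0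
  · exact Or.inl h0
  · exact Or.inr (Subtype.ext (mul_left_cancel₀ h0 h2))

end Triangle

lemma norm_sidePoint (n k : ℕ) (t : unitInterval) : ‖(sidePoint n k t : ℂ)‖ = 1 :=
  Complex.norm_exp_ofReal_mul_I _

/-- The point with distance `r` from the center in the direction of a point of the circle. -/
noncomputable def diskPoint (n k : ℕ) (r t : unitInterval) : ClosedDisk :=
  ⟨r * sidePoint n k t, by
    rw [norm_mul, norm_sidePoint, Complex.norm_real, mul_one, Real.norm_of_nonneg r.2.1]
    exact r.2.2⟩

lemma continuous_diskPoint (n k : ℕ) :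
    Continuous fun p : unitInterval × unitInterval => diskPoint n k p.1 p.2 := by
  unfold diskPoint sidePoint
  fun_prop

lemma norm_diskPoint (n k : ℕ) (r t : unitInterval) : ‖(diskPoint n k r t : ℂ)‖ = r := by
  change ‖((r : ℝ) : ℂ) * sidePoint n k t‖ = r
  rw [norm_mul, norm_sidePoint, Complex.norm_real, mul_one, Real.norm_of_nonneg r.2.1]

lemma diskPoint_one (n k : ℕ) (t : unitInterval) : diskPoint n k 1 t = sidePoint n k t := by
  apply Subtype.ext
  simp [diskPoint]

lemma diskPoint_zero (n k k' : ℕ) (t t' : unitInterval) :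
    diskPoint n k 0 t = diskPoint n k' 0 t' := by
  apply Subtype.ext
  simp [diskPoint]

lemma sidePoint_eq_iff {n k k' : ℕ} (hk : k < n) {t t' : unitInterval} :
    sidePoint n k t = sidePoint n k' t' ↔ ∃ m : ℤ, (k + t : ℝ) = k' + t' + m * n := by
  have hn : (n : ℝ) ≠ 0 := by norm_cast; omega
  rw [sidePoint, sidePoint, Subtype.mk.injEq, Complex.exp_eq_exp_iff_exists_int]
  refine exists_congr fun m => ?_
  rw [show (((2 * Real.pi * ((k' + (t' : ℝ)) / n) : ℝ) : ℂ) * Complex.I + m * (2 * Real.pi * Complex.I)) =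
    ((2 * Real.pi * ((k' + (t' : ℝ)) / n + m) : ℝ) : ℂ) * Complex.I by push_cast; ring,
    mul_left_inj' Complex.I_ne_zero, Complex.ofReal_inj, mul_right_inj' (by positivity),
    div_add' _ _ _ hn, div_left_inj' hn]

lemma exists_diskPoint_eq {n : ℕ} (hn : 0 < n) (z : ClosedDisk) :
    ∃ k < n, ∃ r t, diskPoint n k r t = z := by
  obtain ⟨z, hz⟩ := z
  have hn' : (0 : ℝ) < n := by exact_mod_cast hn
  let u : ℝ := toIcoMod Real.two_pi_pos 0 z.arg / (2 * Real.pi) * n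
  have h1 := toIcoMod_mem_Ico Real.two_pi_pos 0 z.arg
  have hu0 : 0 ≤ u := mul_nonneg (div_nonneg h1.1 Real.two_pi_pos.le) hn'.le
  have hun : u < n := by
    have : toIcoMod Real.two_pi_pos 0 z.arg / (2 * Real.pi) < 1 := by
      rw [div_lt_one Real.two_pi_pos]; simpa using h1.2
    calc u < 1 * n := mul_lt_mul_of_pos_right this hn'
      _ = n := one_mul _
  have hfl : ⌊u⌋₊ < n := (Nat.floor_lt hu0).2 hun
  refine ⟨⌊u⌋₊, hfl, ⟨‖z‖, norm_nonneg _, hz⟩,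
    ⟨u - ⌊u⌋₊, sub_nonneg.2 (Nat.floor_le hu0), by linarith [Nat.lt_floor_add_one u]⟩, ?_⟩
  apply Subtype.ext
  simp only [diskPoint, sidePoint]
  have e : 2 * Real.pi * ((⌊u⌋₊ + (u - ⌊u⌋₊)) / n) = toIcoMod Real.two_pi_pos 0 z.arg := by
    simp only [u]; field_simp; ring
  rw [e]
  conv_rhs => rw [← Complex.norm_mul_exp_arg_mul_I z]
  congr 1
  rw [Complex.exp_eq_exp_iff_exists_int]
  refine ⟨-toIcoDiv Real.two_pi_pos 0 z.arg, ?_⟩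
  rw [toIcoMod]
  simp only [zsmul_eq_mul]
  push_cast
  ring

instance : CompactSpace ClosedDisk := by
  have h := isCompact_closedBall (0 : ℂ) 1
  have e : Metric.closedBall (0 : ℂ) 1 = {z | ‖z‖ ≤ 1} := by ext; simp
  rw [e] at h
  exact isCompact_iff_compactSpace.1 h

/-- A point of the disk and a point of a sector correspond to each other. -/
def DiskSector {g : ℕ} (z : ClosedDisk) (a : StdLetter g × Triangle) : Prop :=
  ∃ r t, diskPoint (4 * g) (stdIndex a.1) r t = z ∧ polar r t = a.2

lemma continuous_polar : Continuous fun p : unitInterval × unitInterval => polar p.1 p.2 := by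
  unfold polar
  fun_prop

lemma isClosed_diskSector (g : ℕ) :
    IsClosed {p : ClosedDisk × (StdLetter g × Triangle) | DiskSector p.1 p.2} := by
  let f : StdLetter g × (unitInterval × unitInterval) → ClosedDisk × (StdLetter g × Triangle) :=
    fun p => (diskPoint (4 * g) (stdIndex p.1) p.2.1 p.2.2, (p.1, polar p.2.1 p.2.2))
  have hf : Continuous f := by
    rw [continuous_prod_of_discrete_left]
    intro e
    have h : Continuous fun p : unitInterval × unitInterval => ((e, polar p.1 p.2) :
      StdLetter g × Triangle) := continuous_const.prodMk continuous_polar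
    have h' := (continuous_diskPoint (4 * g) (stdIndex e)).prodMk h
    exact h'
  have e : {p : ClosedDisk × (StdLetter g × Triangle) | DiskSector p.1 p.2} = Set.range f := by
    ext ⟨z, e, q⟩
    constructor
    · rintro ⟨r, t, h₁, h₂⟩
      exact ⟨(e, r, t), Prod.ext h₁ (Prod.ext rfl h₂)⟩
    · rintro ⟨⟨e, r, t⟩, h⟩
      simp only [f, Prod.mk.injEq] at h
      obtain ⟨h₁, rfl, h₂⟩ := h
      exact ⟨r, t, h₁, h₂⟩
  rw [e]
  exact (isCompact_range hf).isClosed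

/-- The standard surface as a surface glued from sectors. -/
theorem nonempty_sectorSurface_homeomorph {g : ℕ} (hg : 0 < g) :
    Nonempty (StandardSurface g ≃ₜ SectorSurface (stdBar (g := g)) (letterNext g)) := by
  have hidx : ∀ k, k < 4 * g → ∃ e : StdLetter g, stdIndex e = k := fun k hk =>
    ⟨(⟨k / 4, by omega⟩, ⟨k % 4, by omega⟩), by simp only [stdIndex]; omega⟩
  have hedge : ∀ t, polar 1 t = edge t := fun t => by ext <;> simp [polar, edge]
  have hfin : ∀ r, polar r 1 = finish r := fun t => by ext <;> simp [polar, finish]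
  have hsta : ∀ r, polar r 0 = start r := fun t => by ext <;> simp [polar, start]
  have Cedge : ∀ (e : StdLetter g) t, DiskSector (sidePoint (4 * g) (stdIndex e) t) (e, edge t) := fun e t =>
    ⟨1, t, diskPoint_one _ _ _, hedge t⟩
  have hspoke : ∀ (e : StdLetter g), sidePoint (4 * g) (stdIndex e) 1 =
      sidePoint (4 * g) (stdIndex (letterNext g e)) 0 := fun e => by
    rw [sidePoint_eq_iff (stdIndex_lt _), stdIndex_letterNext]
    split_ifs with h
    · refine ⟨1, ?_⟩
      have : ((stdIndex e + 1 : ℕ) : ℝ) = (4 * g : ℕ) := by rw [h]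
      push_cast at this ⊢
      linarith
    · exact ⟨0, by simp⟩
  -- Two parameters of one boundary point differ by a multiple of `4 * g`, and their range leaves
  -- the multiples 0 and -1. So the point lies on one side, at the meeting point of consecutive
  -- sides, or where the last side meets the first.
  have key : ∀ (e e' : StdLetter g) (r t t' : unitInterval),
      (stdIndex e + t : ℝ) ≤ stdIndex e' + t' →
      sidePoint (4 * g) (stdIndex e) t = sidePoint (4 * g) (stdIndex e') t' →
      Quot.mk (SectorGluing stdBar (letterNext g)) (e, polar r t) = Quot.mk _ (e', polar r t') := by
    intro e e' r t t' hle h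
    obtain ⟨m, hm⟩ := (sidePoint_eq_iff (stdIndex_lt _)).1 h
    have l1 := stdIndex_lt e
    have l2 := stdIndex_lt e'
    have l2' : ((stdIndex e' : ℝ) + 1) ≤ (4 * g : ℕ) := by exact_mod_cast l2
    have t0 := t.2.1
    have t1 := t.2.2
    have t0' := t'.2.1
    have t1' := t'.2.2
    have hgp : (0 : ℝ) < (4 * g : ℕ) := by exact_mod_cast (by omega : 0 < 4 * g)
    have hm0 : m ≤ 0 := by
      by_contra hc
      have : (1 : ℝ) ≤ m := by exact_mod_cast (by omega : 1 ≤ m)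
      nlinarith
    have hm1 : -1 ≤ m := by
      by_contra hc
      have : (m : ℝ) ≤ -2 := by exact_mod_cast (by omega : m ≤ -2)
      have : (0 : ℝ) ≤ stdIndex e := Nat.cast_nonneg _
      nlinarith
    rcases (by omega : m = 0 ∨ m = -1) with rfl | rfl
    · simp only [Int.cast_zero, zero_mul, add_zero] at hm
      have a1 : (stdIndex e : ℝ) < (stdIndex e' + 2 : ℕ) := by push_cast; linarith
      have a2 : (stdIndex e' : ℝ) < (stdIndex e + 2 : ℕ) := by push_cast; linarith
      have b1 : stdIndex e < stdIndex e' + 2 := by exact_mod_cast a1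
      have b2 : stdIndex e' < stdIndex e + 2 := by exact_mod_cast a2
      rcases (by omega : stdIndex e = stdIndex e' ∨ stdIndex e' = stdIndex e + 1 ∨
        stdIndex e = stdIndex e' + 1) with h' | h' | h'
      · obtain rfl := stdIndex_injective g h'
        obtain rfl : t = t' := Subtype.ext (by linarith)
        rfl
      · rw [h'] at hm
        push_cast at hm
        obtain rfl : t = 1 := Subtype.ext (by simp only [Set.Icc.coe_one]; linarith)
        obtain rfl : t' = 0 := Subtype.ext (by simp only [Set.Icc.coe_zero]; linarith)
        rw [hfin, hsta]
        rw [← letterNext_eq (e := e) (e' := e') (by rw [if_neg (by omega), h'])]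
        exact Quot.sound (.spoke e r)
      · rw [h'] at hm
        push_cast at hm
        obtain rfl : t = 0 := Subtype.ext (by simp only [Set.Icc.coe_zero]; linarith)
        obtain rfl : t' = 1 := Subtype.ext (by simp only [Set.Icc.coe_one]; linarith)
        rw [hfin, hsta]
        rw [← letterNext_eq (e := e') (e' := e) (by rw [if_neg (by omega), h'])]
        exact (Quot.sound (.spoke e' r)).symm
    · have hz : (0 : ℝ) ≤ stdIndex e := Nat.cast_nonneg _
      push_cast at hm l2'
      have c1 : (stdIndex e : ℝ) = 0 := by linarith
      have c2 : (stdIndex e' : ℝ) + 1 = 4 * g := by linarith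
      have d1 : stdIndex e = 0 := by exact_mod_cast c1
      have d2 : stdIndex e' + 1 = 4 * g := by exact_mod_cast c2
      obtain rfl : t = 0 := Subtype.ext (by simp only [Set.Icc.coe_zero]; linarith)
      obtain rfl : t' = 1 := Subtype.ext (by simp only [Set.Icc.coe_one]; linarith)
      rw [hfin, hsta]
      rw [← letterNext_eq (e := e') (e' := e) (by rw [if_pos d2, d1])]
      exact (Quot.sound (.spoke e' r)).symm
  refine (exists_quot_homeomorph (SideGluing g) (SectorGluing stdBar (letterNext g)) DiskSector
    (isClosed_diskSector g) ?_ ?_ ?_ ?_ ?_ ?_).nonempty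
  · intro z
    obtain ⟨k, hk, r, t, rfl⟩ := exists_diskPoint_eq (n := 4 * g) (by omega) z
    obtain ⟨e, rfl⟩ := hidx k hk
    exact ⟨(e, polar r t), r, t, rfl, rfl⟩
  · rintro ⟨e, q⟩
    obtain ⟨r, t, rfl⟩ := exists_polar_eq q
    exact ⟨_, r, t, rfl, rfl⟩
  · rintro _ _ ⟨e, q⟩ ⟨r, t, rfl, rfl⟩ ⟨r', t', rfl, h⟩
    obtain ⟨rfl, h0 | rfl⟩ := polar_eq_polar h
    · obtain rfl : r' = 0 := Subtype.ext h0
      rw [diskPoint_zero]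
    · rfl
  · rintro _ ⟨e, q⟩ ⟨e', q'⟩ ⟨r, t, rfl, rfl⟩ ⟨r', t', h, rfl⟩
    obtain rfl : r' = r := Subtype.ext (by rw [← norm_diskPoint _ _ r' t', h, norm_diskPoint])
    rcases eq_or_ne (r' : ℝ) 0 with h0 | h0
    · obtain rfl : r' = 0 := Subtype.ext h0
      exact center_eq _ _ (by simp [polar]) (by simp [polar]) (by simp [polar]) (by simp [polar])
    have h' : sidePoint (4 * g) (stdIndex e') t' = sidePoint (4 * g) (stdIndex e) t := by
      have := congrArg Subtype.val h
      exact Subtype.ext (mul_left_cancel₀ (by exact_mod_cast h0) this)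
    rcases le_total (stdIndex e + t : ℝ) (stdIndex e' + t') with hle | hle
    · exact key _ _ _ _ _ hle h'.symm
    · exact (key _ _ _ _ _ hle h').symm
  · rintro _ _ (⟨i, t⟩ | ⟨i, t⟩ | ⟨rfl, z, w⟩)
    · exact ⟨_, _, Cedge (i, 0) t, Cedge (i, 2) _, Quot.sound (.side (i, 0) t)⟩
    · exact ⟨_, _, Cedge (i, 1) t, Cedge (i, 3) _, Quot.sound (.side (i, 1) t)⟩
    · omega
  · rintro _ _ (⟨e, e'⟩ | ⟨e, r⟩ | ⟨e, t⟩)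
    · refine ⟨_, _, ⟨0, 0, rfl, ?_⟩, ⟨0, 0, rfl, ?_⟩, ?_⟩
      · ext <;> simp [polar, ctr]
      · ext <;> simp [polar, ctr]
      · rw [diskPoint_zero]
    · refine ⟨_, _, ⟨r, 1, rfl, hfin r⟩, ⟨r, 0, rfl, hsta r⟩, ?_⟩
      congr 1
      exact Subtype.ext (congrArg (fun z : ClosedDisk => (r : ℂ) * z) (hspoke e))
    · refine ⟨_, _, Cedge e t, Cedge _ _, ?_⟩
      obtain ⟨i, j⟩ := e
      fin_cases j
      · exact Quot.sound (.a i t)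
      · exact Quot.sound (.b i t)
      · have := Quot.sound (SideGluing.a i (unitInterval.symm t))
        rw [unitInterval.symm_symm] at this
        exact this.symm
      · have := Quot.sound (SideGluing.b i (unitInterval.symm t))
        rw [unitInterval.symm_symm] at this
        exact this.symm

end StandardSurfaces

/-! ### The explicit identifications of a sector surface. -/

section SectorEquality

set_option linter.unusedSectionVars false

open Topology SectorSurface Triangle

variable {L : Type*}

/-- The points of sectors which are identified in a surface with a single vertex. -/
def SectorEq (bar : L → L) (σ : Equiv.Perm L) (a b : L × Triangle) : Prop :=
  a = b ∨ (a.2 = ctr ∧ b.2 = ctr) ∨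
    ((a.2 = start 1 ∨ a.2 = finish 1) ∧ (b.2 = start 1 ∨ b.2 = finish 1)) ∨
    (σ a.1 = b.1 ∧ ∃ r, a.2 = finish r ∧ b.2 = start r) ∨
    (σ b.1 = a.1 ∧ ∃ r, b.2 = finish r ∧ a.2 = start r) ∨
    (bar a.1 = b.1 ∧ ∃ t, a.2 = edge t ∧ b.2 = edge (unitInterval.symm t))

/-- The conditions which exclude degenerate gluings and make all vertices equal. -/
structure IsRegularGluing (bar : L → L) (σ : Equiv.Perm L) : Prop where
  bar_bar : Function.Involutive bar
  bar_ne : ∀ e, bar e ≠ e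
  next_ne : ∀ e, σ e ≠ e
  next_next_ne : ∀ e, σ (σ e) ≠ e
  transitive : ∀ P : L → Prop, (∃ e, P e) → (∀ e, P e → P (σ e)) → ∀ e, P e
  vertex : ∀ P : L → Prop, (∃ e, P e) → (∀ e, P e → P (σ (bar e))) → ∀ e, P e

namespace SectorSurface

variable {bar : L → L} {σ : Equiv.Perm L}

/-- Around a vertex the sectors follow each other by `e ↦ σ (bar e)`, and by regularity this reaches
all letters. -/
lemma vertex_eq (h : IsRegularGluing bar σ) {a b : L × Triangle}
    (ha : a.2 = start 1 ∨ a.2 = finish 1) (hb : b.2 = start 1 ∨ b.2 = finish 1) :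
    Quot.mk (SectorGluing bar σ) a = Quot.mk _ b := by
  obtain ⟨e, q⟩ := a
  obtain ⟨e', q'⟩ := b
  have h₁ : ∀ e, Quot.mk (SectorGluing bar σ) (e, finish 1) = Quot.mk _ (σ e, start 1) := fun e =>
    Quot.sound (.spoke e 1)
  have h₂ : ∀ e, Quot.mk (SectorGluing bar σ) (e, start 1) = Quot.mk _ (bar e, finish 1) := fun e =>
    side_eq rfl (by simp [start]) (by simp [start, finish]) (by simp [start, finish])
  have h₃ : ∀ e, Quot.mk (SectorGluing bar σ) (e, start 1) = Quot.mk _ (e', start 1) :=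
    h.vertex _ ⟨e', rfl⟩ fun e he => by rw [← h₁, ← h₂, he]
  have h₄ : ∀ e, Quot.mk (SectorGluing bar σ) (e, finish 1) = Quot.mk _ (e', start 1) := fun e => by
    rw [h₁, h₃]
  simp only at ha hb
  rcases ha with rfl | rfl <;> rcases hb with rfl | rfl <;> simp only [h₃, h₄]

lemma mk_eq_of_sectorEq (h : IsRegularGluing bar σ) {a b : L × Triangle} (hab : SectorEq bar σ a b) :
    Quot.mk (SectorGluing bar σ) a = Quot.mk _ b := by
  obtain ⟨e, q⟩ := a
  obtain ⟨e', q'⟩ := b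
  rcases hab with h | ⟨rfl, rfl⟩ | ⟨ha, hb⟩ | ⟨rfl, r, rfl, rfl⟩ | ⟨rfl, r, rfl, rfl⟩ |
    ⟨rfl, t, rfl, rfl⟩
  · rw [h]
  · exact Quot.sound (.center _ _)
  · exact vertex_eq h ha hb
  · exact Quot.sound (.spoke _ _)
  · exact (Quot.sound (.spoke _ _)).symm
  · exact Quot.sound (.side _ _)

section Invariant

variable [DecidableEq L] (bar σ)

/-- A continuous function which separates the points of a surface. -/
noncomputable def separating (a : L × Triangle) : ℝ × (L → ℝ) × (L → ℝ) :=
  (a.2.1.1 + a.2.1.2,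
    Pi.single a.1 (a.2.1.1 * (1 - a.2.1.1 - a.2.1.2)) +
      Pi.single (σ a.1) (a.2.1.2 * (1 - a.2.1.1 - a.2.1.2)),
    Pi.single a.1 (a.2.1.1 ^ 2 * a.2.1.2) + Pi.single (bar a.1) (a.2.1.1 * a.2.1.2 ^ 2))

lemma continuous_separating [TopologicalSpace L] [DiscreteTopology L] :
    Continuous (separating bar σ) := by
  rw [continuous_prod_of_discrete_left]
  intro e
  unfold separating
  refine .prodMk (by fun_prop) (.prodMk ?_ ?_) <;> refine continuous_pi fun i => ?_ <;>
    simp only [Pi.add_apply, Pi.single_apply] <;> split_ifs <;> fun_prop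

variable {bar σ}

lemma separating_eq_of_gluing (hbar : Function.Involutive bar) {a b : L × Triangle}
    (h : SectorGluing bar σ a b) : separating bar σ a = separating bar σ b := by
  rcases h with ⟨e, e'⟩ | ⟨e, r⟩ | ⟨e, t⟩
  · simp [separating, ctr]
  · simp [separating, start, finish]
  · simp only [separating, edge, hbar e, unitInterval.coe_symm_eq]
    refine Prod.ext (by simp) (Prod.ext ?_ ?_)
    · simp
    · simp only
      rw [add_comm]
      congr 2 <;> ring

/-- The first component is the distance from the center. Off the outer sides the second one recovers
the positions relative to the two bounding spokes; on the outer sides the third one recovers the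
side and the position on it. -/
lemma sectorEq_of_separating_eq (h : IsRegularGluing bar σ) {a b : L × Triangle}
    (hab : separating bar σ a = separating bar σ b) : SectorEq bar σ a b := by
  obtain ⟨e, ⟨⟨s, f⟩, h1, h2, h3⟩⟩ := a
  obtain ⟨e', ⟨⟨s', f'⟩, h1', h2', h3'⟩⟩ := b
  simp only [separating, Prod.mk.injEq] at hab h1 h2 h3 h1' h2' h3'
  obtain ⟨hr, hA, hB⟩ := hab
  replace hA := fun i => congrFun hA i
  replace hB := fun i => congrFun hB i
  simp only [Pi.add_apply, Pi.single_apply] at hA hB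
  have ctr_mk : ∀ {s f : ℝ} (h : 0 ≤ s ∧ 0 ≤ f ∧ s + f ≤ 1), s = 0 → f = 0 →
      (⟨(s, f), h⟩ : Triangle) = ctr := by rintro s f h rfl rfl; rfl
  have vertex_mk : ∀ {s f : ℝ} (h : 0 ≤ s ∧ 0 ≤ f ∧ s + f ≤ 1), s + f = 1 → s * f = 0 →
      (⟨(s, f), h⟩ : Triangle) = start 1 ∨ (⟨(s, f), h⟩ : Triangle) = finish 1 := by
    intro s f h h₁ h₂
    rcases mul_eq_zero.1 h₂ with rfl | rfl
    · right; ext <;> simp [finish]; linarith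
    · left; ext <;> simp [start]; linarith
  rcases eq_or_ne (1 - s - f) 0 with ho | ho
  · have ho' : 1 - s' - f' = 0 := by linarith
    have hs : s = 1 - f := by linarith
    have hs' : s' = 1 - f' := by linarith
    by_cases hee : e = e' ∨ bar e = e'
    · have hp : (s - s') * (s + s' - 1) = 0 := by
        have : s * f = s' * f' := by
          rcases hee with rfl | rfl
          · have b1 := hB e
            have b2 := hB (bar e)
            simp only [if_true, if_neg (h.bar_ne e), if_neg (h.bar_ne e).symm] at b1 b2
            linear_combination b1 + b2 + s * f * ho - s' * f' * ho'
          · have b1 := hB e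
            have b2 := hB (bar e)
            simp only [if_true, if_neg (h.bar_ne e), if_neg (h.bar_ne e).symm, h.bar_bar e] at b1 b2
            linear_combination b1 + b2 + s * f * ho - s' * f' * ho'
        subst hs hs'
        linear_combination -this
      rcases hee with rfl | rfl
      · rcases mul_eq_zero.1 hp with hp | hp
        · exact Or.inl (Prod.ext rfl (by ext <;> simp only <;> linarith))
        -- Mirrored positions on one side are told apart by `s ^ 2 * f` against `s * f ^ 2`; these
        -- agree only at the end points and at the middle.
        · have b1 := hB e
          simp only [if_true, if_neg (h.bar_ne e).symm] at b1
          have e1 : s' = f := by linarith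
          have e2 : f' = s := by linarith
          rw [e1, e2] at b1
          have b3 : (s * f) * (s - f) = 0 := by linear_combination b1
          rcases mul_eq_zero.1 b3 with b3 | b3
          · exact Or.inr (Or.inr (Or.inl ⟨vertex_mk _ (by linarith) b3,
              vertex_mk _ (by linarith) (by rw [e1, e2, mul_comm, b3])⟩))
          · exact Or.inl (Prod.ext rfl (by ext <;> simp only <;> linarith))
      · have side : s = f' → SectorEq bar σ (e, ⟨(s, f), h1, h2, h3⟩)
            (bar e, ⟨(s', f'), h1', h2', h3'⟩) := fun hsf =>
          Or.inr (Or.inr (Or.inr (Or.inr (Or.inr ⟨rfl, ⟨f, h2, by linarith⟩,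
            by ext <;> simp [edge]; linarith, by ext <;> simp [edge] <;> linarith⟩))))
        rcases mul_eq_zero.1 hp with hp | hp
        · have b1 := hB e
          simp only [if_true, if_neg (h.bar_ne e).symm, h.bar_bar e] at b1
          have e1 : s' = s := by linarith
          have e2 : f' = f := by linarith
          rw [e1, e2] at b1
          have b3 : (s * f) * (s - f) = 0 := by linear_combination b1
          rcases mul_eq_zero.1 b3 with b3 | b3
          · exact Or.inr (Or.inr (Or.inl ⟨vertex_mk _ (by linarith) b3,
              vertex_mk _ (by linarith) (by rw [e1, e2, b3])⟩))
          · exact side (by linarith)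
        · exact side (by linarith)
    · rw [not_or] at hee
      have hbe : e ≠ bar e' := fun hc => hee.2 (by rw [hc, h.bar_bar])
      have b1 := hB e
      have b2 := hB e'
      simp only [if_true, if_neg (h.bar_ne _).symm, if_neg hee.1, if_neg hbe,
        if_neg (Ne.symm hee.1), if_neg (Ne.symm hee.2)] at b1 b2
      have z1 : s ^ 2 * f = 0 := by linarith
      have z2 : s' ^ 2 * f' = 0 := by linarith
      refine Or.inr (Or.inr (Or.inl ⟨vertex_mk _ (by linarith) ?_, vertex_mk _ (by linarith) ?_⟩))
      · simpa using z1
      · simpa using z2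
  · have ho' : 1 - s' - f' = 1 - s - f := by linarith
    rw [ho'] at hA
    -- The common factor `1 - s - f` is nonzero away from the outer side and can be cancelled.
    have hA' : ∀ i, ((if i = e then s else 0) + if i = σ e then f else 0) =
        (if i = e' then s' else 0) + if i = σ e' then f' else 0 := fun i => by
      have := hA i
      rw [← mul_left_inj' ho, add_mul, add_mul]
      simpa only [ite_mul, zero_mul] using this
    by_cases hee : e = e'
    · subst hee
      have a1 := hA' e
      simp only [if_true, if_neg (h.next_ne e).symm] at a1
      exact Or.inl (Prod.ext rfl (by ext <;> simp only <;> linarith))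
    have a1 := hA' e
    have a2 := hA' e'
    have a3 := hA' (σ e)
    simp only [if_true, if_neg (h.next_ne _).symm, if_neg (h.next_ne _), if_neg hee,
      if_neg (Ne.symm hee), σ.injective.eq_iff] at a1 a2 a3
    by_cases k1 : e = σ e'
    -- Two different sectors cannot share both spokes, because `σ (σ e') ≠ e'`.
    · have k2 : e' ≠ σ e := fun hc => h.next_next_ne e' (by rw [← k1, ← hc])
      rw [if_pos k1] at a1
      rw [if_neg k2] at a2
      have q2 : s' = 0 := by linarith
      have q1 : f = 0 := by linarith
      exact Or.inr (Or.inr (Or.inr (Or.inr (Or.inl ⟨k1.symm, ⟨s, h1, by linarith⟩,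
        by ext <;> simp [finish, q2]; linarith, by ext <;> simp [start, q1]⟩))))
    · rw [if_neg k1] at a1
      by_cases k2 : e' = σ e
      · rw [if_pos k2] at a2
        have q1 : s = 0 := by linarith
        have q2 : f' = 0 := by linarith
        exact Or.inr (Or.inr (Or.inr (Or.inl ⟨k2.symm, ⟨f, h2, by linarith⟩,
          by ext <;> simp [finish, q1], by ext <;> simp [start, q2]; linarith⟩)))
      · rw [if_neg k2] at a2
        rw [if_neg (Ne.symm k2)] at a3
        have q1 : s = 0 := by linarith
        have q2 : s' = 0 := by linarith
        have q3 : f = 0 := by linarith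
        exact Or.inr (Or.inl ⟨ctr_mk _ q1 q3, ctr_mk _ q2 (by linarith)⟩)

theorem mk_eq_iff (h : IsRegularGluing bar σ) {a b : L × Triangle} :
    Quot.mk (SectorGluing bar σ) a = Quot.mk _ b ↔ SectorEq bar σ a b := by
  refine ⟨fun hab => sectorEq_of_separating_eq h ?_, mk_eq_of_sectorEq h⟩
  exact congrArg (Quot.lift (separating bar σ) fun _ _ => separating_eq_of_gluing h.bar_bar) hab

theorem t2Space [TopologicalSpace L] [DiscreteTopology L] (h : IsRegularGluing bar σ) :
    T2Space (SectorSurface bar σ) := by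
  refine .of_injective_continuous (f := Quot.lift (separating bar σ) fun _ _ =>
    separating_eq_of_gluing h.bar_bar) ?_ (continuous_quot_lift _ (continuous_separating bar σ))
  rintro ⟨a⟩ ⟨b⟩ hab
  exact (mk_eq_iff h).2 (sectorEq_of_separating_eq h hab)

end Invariant

end SectorSurface

lemma IsRegularGluing.of_equiv {L' : Type*} {bar : L → L} {bar' : L' → L'} {σ : Equiv.Perm L}
    {σ' : Equiv.Perm L'} (h : IsRegularGluing bar σ) (τ : L ≃ L')
    (hbar : ∀ e, bar' (τ e) = τ (bar e)) (hσ : ∀ e, σ' (τ e) = τ (σ e)) :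
    IsRegularGluing bar' σ' where
  bar_bar e := by
    obtain ⟨e, rfl⟩ := τ.surjective e
    rw [hbar, hbar, h.bar_bar]
  bar_ne e := by
    obtain ⟨e, rfl⟩ := τ.surjective e
    rw [hbar]
    exact fun hc => h.bar_ne e (τ.injective hc)
  next_ne e := by
    obtain ⟨e, rfl⟩ := τ.surjective e
    rw [hσ]
    exact fun hc => h.next_ne e (τ.injective hc)
  next_next_ne e := by
    obtain ⟨e, rfl⟩ := τ.surjective e
    rw [hσ, hσ]
    exact fun hc => h.next_next_ne e (τ.injective hc)
  transitive P hP hs e := by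
    obtain ⟨e, rfl⟩ := τ.surjective e
    refine h.transitive (fun e => P (τ e)) ?_ (fun e he => ?_) e
    · obtain ⟨e, he⟩ := hP
      exact ⟨τ.symm e, by simpa using he⟩
    · rw [← hσ]; exact hs _ he
  vertex P hP hs e := by
    obtain ⟨e, rfl⟩ := τ.surjective e
    refine h.vertex (fun e => P (τ e)) ?_ (fun e he => ?_) e
    · obtain ⟨e, he⟩ := hP
      exact ⟨τ.symm e, by simpa using he⟩
    · rw [← hσ, ← hbar]; exact hs _ he

/-- For the vertex condition, `e ↦ stdBar e` followed by the next letter runs within a handle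
through the positions 0, 3, 2, 1 and then passes to position 0 of the following handle. -/
lemma isRegularGluing_std {g : ℕ} (hg : 0 < g) :
    IsRegularGluing (stdBar (g := g)) (letterNext g) := by
  have tr : ∀ P : StdLetter g → Prop, (∃ e, P e) → (∀ e, P e → P (letterNext g e)) → ∀ e, P e := by
    rintro P ⟨e, he⟩ hs e'
    have up : ∀ (k : ℕ) (e₀ : StdLetter g), P e₀ → ∀ e, stdIndex e = stdIndex e₀ + k → P e := by
      intro k
      induction k with
      | zero => exact fun e₀ h₀ e h => stdIndex_injective g h ▸ h₀
      | succ k ih =>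
        intro e₀ h₀ e h
        have := stdIndex_lt e
        refine ih _ (hs _ h₀) e ?_
        rw [stdIndex_letterNext, if_neg (by omega)]
        omega
    let l : StdLetter g := (⟨g - 1, by omega⟩, 3)
    have hl : stdIndex l + 1 = 4 * g := by simp [l, stdIndex]; omega
    have h1 : P l := up (4 * g - 1 - stdIndex e) e he l (by have := stdIndex_lt e; omega)
    refine up (stdIndex e') _ (hs _ h1) e' ?_
    rw [stdIndex_letterNext, if_pos hl, zero_add]
  have nx : ∀ (i : Fin g) (j j' : Fin 4), (j' : ℕ) = j + 1 → letterNext g (i, j) = (i, j') :=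
    fun i j j' h => letterNext_eq (by
      rw [if_neg (by simp only [stdIndex]; omega)]; simp only [stdIndex]; omega)
  refine ⟨stdBar_involutive g, fun ⟨i, j⟩ => ?_, fun e h => ?_, fun e h => ?_, tr, ?_⟩
  · fin_cases j <;> simp [stdBar]
  · have := congrArg stdIndex h
    rw [stdIndex_letterNext] at this
    split_ifs at this <;> omega
  · have := congrArg stdIndex h
    rw [stdIndex_letterNext, stdIndex_letterNext] at this
    split_ifs at this <;> omega
  · rintro P ⟨e, he⟩ hs
    have s0 : ∀ i, P (i, 0) → P (i, 3) := fun i h => by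
      have := hs _ h
      rwa [stdBar, nx _ _ 3 rfl] at this
    have s3 : ∀ i, P (i, 3) → P (i, 2) := fun i h => by
      have := hs _ h
      rwa [stdBar, nx _ _ 2 rfl] at this
    have s2 : ∀ i, P (i, 2) → P (i, 1) := fun i h => by
      have := hs _ h
      rwa [stdBar, nx _ _ 1 rfl] at this
    have s1 : ∀ i, P (i, 1) → P (letterNext g (i, 3)) := fun i h => hs _ h
    have z : ∀ i, (letterNext g (i, 3)).2 = 0 := fun i => by
      have := stdIndex_letterNext (i, (3 : Fin 4))
      have h3 : stdIndex (i, (3 : Fin 4)) = 4 * i + 3 := rfl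
      have hd : stdIndex (letterNext g (i, 3)) =
        4 * (letterNext g (i, 3)).1 + (letterNext g (i, 3)).2 := rfl
      have h4 := (letterNext g (i, 3)).2.isLt
      apply Fin.ext
      change ((letterNext g (i, 3)).2 : ℕ) = 0
      split_ifs at this <;> omega
    have s1' : ∀ i, P (i, 1) → P ((letterNext g (i, 3)).1, 0) := fun i h => by
      have := s1 i h
      rwa [← Prod.mk.eta (p := letterNext g (i, 3)), z] at this
    have first : ∀ e : StdLetter g, P (e.1, 0) := by
      refine tr _ ?_ ?_
      · obtain ⟨i, j⟩ := e
        refine ⟨_, s1' i ?_⟩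
        fin_cases j
        exacts [s2 _ (s3 _ (s0 _ he)), he, s2 _ he, s2 _ (s3 _ he)]
      · rintro ⟨i, j⟩ h
        fin_cases j
        · change P ((letterNext g (i, 0)).1, 0); rwa [nx i 0 1 rfl]
        · change P ((letterNext g (i, 1)).1, 0); rwa [nx i 1 2 rfl]
        · change P ((letterNext g (i, 2)).1, 0); rwa [nx i 2 3 rfl]
        · exact s1' i (s2 _ (s3 _ (s0 _ h)))
    rintro ⟨i, j⟩
    have h0 := first (i, 0)
    fin_cases j
    exacts [h0, s2 _ (s3 _ (s0 _ h0)), s3 _ (s0 _ h0), s0 _ h0]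

end SectorEquality

/-! ### A lens-shaped disk inside a sector. -/

section Lens

open Topology Triangle

namespace Triangle

/-- Opening a slit along the start side of a sector. -/
noncomputable def unslit (q : Triangle) : Triangle :=
  ⟨(q.1.1 - (1 - q.1.1 - q.1.2) * q.1.1 / 2, q.1.2 + (1 - q.1.1 - q.1.2) * q.1.1), by
    obtain ⟨⟨s, f⟩, h1, h2, h3⟩ := q
    simp only at h1 h2 h3
    have h4 : 0 ≤ 1 - s - f := by linarith
    refine ⟨?_, ?_, ?_⟩ <;> simp only
    · nlinarith
    · positivity
    · nlinarith⟩

/-- The open lens between the start side and the image of the start side under `unslit`. -/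
def openLens : Set Triangle := {q | 0 < q.1.2 ∧ 4 * q.1.2 < 1 - (2 * q.1.1 + q.1.2 - 1) ^ 2}

lemma continuous_unslit : Continuous unslit := by
  unfold unslit
  fun_prop

/-- The map preserves `2 * s + f`, and along each line where this is constant it is strictly
increasing in `f`. -/
lemma unslit_injective : Function.Injective unslit := by
  rintro ⟨⟨s, f⟩, h1, h2, h3⟩ ⟨⟨s', f'⟩, h1', h2', h3'⟩ h
  simp only at h1 h2 h3 h1' h2' h3'
  have e1 := congrArg (fun q : Triangle => q.1.1) h
  have e2 := congrArg (fun q : Triangle => q.1.2) h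
  simp only [unslit] at e1 e2
  have e3 : 2 * s + f = 2 * s' + f' := by linarith
  have e4 : (f - f') * (2 + f + f') = 0 := by
    have h5 : s = s' + (f' - f) / 2 := by linarith
    subst h5
    linear_combination 4 * e2
  have e5 : f = f' := by
    rcases mul_eq_zero.1 e4 with h | h <;> linarith
  ext <;> simp only <;> linarith

lemma unslit_finish (r : unitInterval) : unslit (finish r) = finish r := by
  ext <;> simp [unslit, finish]

lemma unslit_edge (t : unitInterval) : unslit (edge t) = edge t := by
  ext <;> simp [unslit, edge]

lemma unslit_ctr : unslit ctr = ctr := by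
  ext <;> simp [unslit, ctr]

lemma unslit_start_one : unslit (start 1) = start 1 := by
  ext <;> simp [unslit, start]

lemma eq_of_unslit_eq_start {q : Triangle} {r : unitInterval} (h : unslit q = start r) :
    q = start r ∧ (q = ctr ∨ q = start 1) := by
  obtain ⟨⟨s, f⟩, h1, h2, h3⟩ := q
  simp only at h1 h2 h3
  have e1 := congrArg (fun q : Triangle => q.1.1) h
  have e2 := congrArg (fun q : Triangle => q.1.2) h
  simp only [unslit, start] at e1 e2
  have h4 : 0 ≤ (1 - s - f) * s := mul_nonneg (by linarith) h1
  have hf : f = 0 := by linarith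
  subst hf
  refine ⟨by ext <;> simp [start]; linarith, ?_⟩
  rcases mul_eq_zero.1 (show (1 - s - 0) * s = 0 by linarith) with h | h
  · right; ext <;> simp [start]; linarith
  · left; ext <;> simp [ctr, h]

lemma unslit_notMem_openLens (q : Triangle) : unslit q ∉ openLens := by
  obtain ⟨⟨s, f⟩, h1, h2, h3⟩ := q
  simp only at h1 h2 h3
  rintro ⟨-, h⟩
  simp only [unslit] at h
  nlinarith [sq_nonneg f]

lemma exists_unslit_eq {q : Triangle} (h : q ∉ openLens) (hf : q.1.2 ≠ 0) : ∃ p, unslit p = q := by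
  obtain ⟨⟨s, f⟩, h1, h2, h3⟩ := q
  simp only at h1 h2 h3 hf
  have hf' : 0 < f := lt_of_le_of_ne h2 (Ne.symm hf)
  have h4 : 1 - (2 * s + f - 1) ^ 2 ≤ 4 * f := not_lt.1 fun hc => h ⟨hf', hc⟩
  -- On a line with fixed `2 * s + f` the equation is quadratic in the second coordinate `m - 1` of
  -- the preimage; lying outside the lens means that `m ≥ 1`.
  let m := √(4 * f + (2 * s + f - 1) ^ 2)
  have hm : m ^ 2 = 4 * f + (2 * s + f - 1) ^ 2 := Real.sq_sqrt (by positivity)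
  have hm0 : 0 ≤ m := Real.sqrt_nonneg _
  have m1 : 1 ≤ m := by nlinarith
  have m2 : m ≤ 2 - (2 * s + f - 1) := abs_le_of_sq_le_sq' (by nlinarith) (by linarith) |>.2
  have m3 : m ≤ 2 + (2 * s + f - 1) := abs_le_of_sq_le_sq' (by nlinarith) (by linarith) |>.2
  refine ⟨⟨((2 - m + (2 * s + f - 1)) / 2, m - 1), ?_, ?_, ?_⟩, ?_⟩
  · simp only; linarith
  · simp only; linarith
  · simp only; linarith
  · ext <;> simp only [unslit] <;> linarith

/-- The disk as a lens. -/
noncomputable def lensPoint (z : ClosedDisk) : Triangle :=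
  ⟨((1 - √(1 - z.1.re ^ 2) * (√(1 - z.1.re ^ 2) + z.1.im) / 8 + z.1.re) / 2,
    √(1 - z.1.re ^ 2) * (√(1 - z.1.re ^ 2) + z.1.im) / 8), by
    obtain ⟨z, hz⟩ := z
    have h1 : z.re ^ 2 + z.im ^ 2 ≤ 1 := by
      rw [← sq_le_one_iff₀ (norm_nonneg _), Complex.sq_norm, Complex.normSq_apply] at hz
      nlinarith
    have hw : √(1 - z.re ^ 2) ^ 2 = 1 - z.re ^ 2 := Real.sq_sqrt (by nlinarith [sq_nonneg z.im])
    have hw0 := Real.sqrt_nonneg (1 - z.re ^ 2)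
    simp only
    generalize √(1 - z.re ^ 2) = w at hw hw0
    obtain ⟨h2, h3⟩ := abs_le_of_sq_le_sq' (show z.im ^ 2 ≤ w ^ 2 by linarith) hw0
    obtain ⟨h4, h5⟩ := abs_le_of_sq_le_sq' (show z.re ^ 2 ≤ 1 ^ 2 by nlinarith [sq_nonneg z.im])
      zero_le_one
    have h6 : 0 ≤ w * (w + z.im) := mul_nonneg hw0 (by linarith)
    have h7 : w * (w + z.im) ≤ 2 * w ^ 2 := by nlinarith
    refine ⟨?_, ?_, ?_⟩ <;> simp only
    · nlinarith
    · positivity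
    · nlinarith⟩

lemma continuous_lensPoint : Continuous lensPoint := by
  unfold lensPoint
  fun_prop

/-- The point of the upper half circle over a point of an interval. -/
noncomputable def upperPoint (r : unitInterval) : ClosedDisk :=
  ⟨⟨2 * r - 1, √(1 - (2 * r - 1) ^ 2)⟩, by
    rw [← sq_le_one_iff₀ (norm_nonneg _), Complex.sq_norm, Complex.normSq_apply]
    have := Real.sq_sqrt (show 0 ≤ 1 - (2 * (r : ℝ) - 1) ^ 2 by nlinarith [r.2.1, r.2.2])
    simp only
    nlinarith⟩

/-- Complex conjugation of the disk. -/
noncomputable def conjDisk (z : ClosedDisk) : ClosedDisk := ⟨(starRingEnd ℂ) z, by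
  rw [Complex.norm_conj]; exact z.2⟩

lemma conjDisk_conjDisk (z : ClosedDisk) : conjDisk (conjDisk z) = z :=
  Subtype.ext (Complex.conj_conj _)

lemma continuous_conjDisk : Continuous conjDisk := by
  unfold conjDisk
  fun_prop

lemma norm_upperPoint (r : unitInterval) : ‖(upperPoint r : ℂ)‖ = 1 := by
  rw [← pow_eq_one_iff_of_nonneg (norm_nonneg _) two_ne_zero, Complex.sq_norm, Complex.normSq_apply]
  have := Real.sq_sqrt (show 0 ≤ 1 - (2 * (r : ℝ) - 1) ^ 2 by nlinarith [r.2.1, r.2.2])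
  simp only [upperPoint]
  nlinarith

/-- The upper half circle traces the displaced copy of the start side and the lower one the start
side itself. These arcs are the two banks of the cut. -/
lemma lensPoint_upperPoint (r : unitInterval) : lensPoint (upperPoint r) = unslit (start r) := by
  have := Real.sq_sqrt (show 0 ≤ 1 - (2 * (r : ℝ) - 1) ^ 2 by nlinarith [r.2.1, r.2.2])
  ext <;> simp only [lensPoint, upperPoint, unslit, start] <;> nlinarith

lemma lensPoint_conj_upperPoint (r : unitInterval) : lensPoint (conjDisk (upperPoint r)) = start r := by
  ext <;> simp [lensPoint, upperPoint, start, conjDisk]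

lemma exists_upperPoint_eq {z : ClosedDisk} (hz : ‖(z : ℂ)‖ = 1) :
    ∃ r, z = upperPoint r ∨ z = conjDisk (upperPoint r) := by
  obtain ⟨z, hz'⟩ := z
  simp only at hz
  have h1 : z.re ^ 2 + z.im ^ 2 = 1 := by
    rw [← pow_eq_one_iff_of_nonneg (norm_nonneg _) two_ne_zero, Complex.sq_norm, Complex.normSq_apply] at hz
    nlinarith
  obtain ⟨h4, h5⟩ := abs_le_of_sq_le_sq' (show z.re ^ 2 ≤ 1 ^ 2 by nlinarith [sq_nonneg z.im])
    zero_le_one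
  refine ⟨⟨(1 + z.re) / 2, by linarith, by linarith⟩, ?_⟩
  have h6 : 1 - (2 * ((1 + z.re) / 2) - 1) ^ 2 = z.im ^ 2 := by linarith
  rcases le_total 0 z.im with h | h
  · left
    apply Subtype.ext
    apply Complex.ext
    · simp [upperPoint]; ring
    · simp only [upperPoint, h6, Real.sqrt_sq h]
  · right
    apply Subtype.ext
    apply Complex.ext
    · simp [upperPoint, conjDisk]; ring
    · simp [upperPoint, conjDisk, h6, Real.sqrt_sq_eq_abs, abs_of_nonpos h]

lemma lensPoint_injective : Function.Injective lensPoint := by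
  rintro ⟨z, hz⟩ ⟨z', hz'⟩ h
  have e1 := congrArg (fun q : Triangle => q.1.1) h
  have e2 := congrArg (fun q : Triangle => q.1.2) h
  simp only [lensPoint] at e1 e2
  have hre : z.re = z'.re := by linarith
  rw [← sq_le_one_iff₀ (norm_nonneg _), Complex.sq_norm, Complex.normSq_apply] at hz hz'
  rw [← hre] at e2 hz'
  apply Subtype.ext
  apply Complex.ext hre
  rcases eq_or_ne (√(1 - z.re ^ 2)) 0 with h0 | h0
  · rw [Real.sqrt_eq_zero'] at h0
    have : z.im ^ 2 = 0 := by nlinarith [sq_nonneg z.im]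
    have : z'.im ^ 2 = 0 := by nlinarith [sq_nonneg z'.im]
    simp_all
  · have : √(1 - z.re ^ 2) * (√(1 - z.re ^ 2) + z.im) = √(1 - z.re ^ 2) * (√(1 - z.re ^ 2) + z'.im) := by
      linarith
    have := mul_left_cancel₀ h0 this
    linarith

lemma image_lensPoint : lensPoint '' {z | ‖(z : ℂ)‖ < 1} = openLens := by
  ext q
  constructor
  · rintro ⟨⟨z, hz'⟩, hz, rfl⟩
    change ‖z‖ < 1 at hz
    rw [← sq_lt_one_iff₀ (norm_nonneg _), Complex.sq_norm, Complex.normSq_apply] at hz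
    have hw : √(1 - z.re ^ 2) ^ 2 = 1 - z.re ^ 2 := Real.sq_sqrt (by nlinarith [sq_nonneg z.im])
    have hw0 : 0 < √(1 - z.re ^ 2) := Real.sqrt_pos.2 (by nlinarith [sq_nonneg z.im])
    simp only [openLens, lensPoint, Set.mem_ofPred_eq]
    generalize √(1 - z.re ^ 2) = w at hw hw0
    obtain ⟨h2, h3⟩ := abs_lt_of_sq_lt_sq' (show z.im ^ 2 < w ^ 2 by nlinarith) hw0.le
    have h6 : 0 < w * (w + z.im) := mul_pos hw0 (by linarith)
    have h7 : w * (w + z.im) < w * (2 * w) := mul_lt_mul_of_pos_left (by linarith) hw0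
    constructor
    · positivity
    · nlinarith
  · obtain ⟨⟨s, f⟩, h1, h2, h3⟩ := q
    rintro ⟨hf, h⟩
    simp only at hf h h1 h2 h3
    have hu : 0 < 1 - (2 * s + f - 1) ^ 2 := by linarith
    have hw : √(1 - (2 * s + f - 1) ^ 2) ^ 2 = 1 - (2 * s + f - 1) ^ 2 := Real.sq_sqrt hu.le
    have hw0 : 0 < √(1 - (2 * s + f - 1) ^ 2) := Real.sqrt_pos.2 hu
    set w := √(1 - (2 * s + f - 1) ^ 2) with hwd
    have hv : (8 * f / w - w) * w = 8 * f - w ^ 2 := by field_simp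
    have hn : ‖(⟨2 * s + f - 1, 8 * f / w - w⟩ : ℂ)‖ < 1 := by
      rw [← sq_lt_one_iff₀ (norm_nonneg _), Complex.sq_norm, Complex.normSq_apply]
      simp only
      have : (8 * f / w - w) ^ 2 < w ^ 2 := by
        apply sq_lt_sq'
        · have : 0 < 8 * f / w := by positivity
          linarith
        · rw [sub_lt_iff_lt_add, div_lt_iff₀ hw0]
          nlinarith
      nlinarith
    refine ⟨⟨⟨2 * s + f - 1, 8 * f / w - w⟩, hn.le⟩, hn, ?_⟩
    have e : w * (w + (8 * f / w - w)) / 8 = f := by field_simp; ring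
    ext
    · simp only [lensPoint, ← hwd, e]; ring
    · simp only [lensPoint, ← hwd, e]

end Triangle

end Lens

/-! ### The product of two words as a connected sum. -/

section ConnectedSum

set_option linter.unusedSectionVars false

open Topology SectorSurface Triangle

variable {L : Type*} [TopologicalSpace L] [DiscreteTopology L] [Finite L] [DecidableEq L]

/-- `p` is a parametrization of `X` by sectors. -/
structure SectorChart (bar : L → L) (σ : Equiv.Perm L) {X : Type*} [TopologicalSpace X]
    (p : L × Triangle → X) : Prop where
  regular : IsRegularGluing bar σ
  continuous : Continuous p
  surjective : Function.Surjective p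
  eq_iff : ∀ a b, p a = p b ↔ SectorEq bar σ a b

lemma IsRegularGluing.sectorChart {bar : L → L} {σ : Equiv.Perm L} (h : IsRegularGluing bar σ)
    {X : Type*} [TopologicalSpace X] (k : SectorSurface bar σ ≃ₜ X) :
    SectorChart bar σ fun a => k (Quot.mk _ a) :=
  ⟨h, k.continuous.comp continuous_quot_mk, k.surjective.comp Quot.mk_surjective, fun a b => by
    rw [k.injective.eq_iff, mk_eq_iff h]⟩

/-- The parametrization of the surface with a lens removed from the sector `x`. -/
noncomputable def slit (x : L) (a : L × Triangle) : L × Triangle :=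
  if a.1 = x then (x, unslit a.2) else a

lemma slit_self (x : L) (q : Triangle) : slit x (x, q) = (x, unslit q) := if_pos rfl

lemma slit_of_ne {x e : L} (h : e ≠ x) (q : Triangle) : slit x (e, q) = (e, q) := if_neg h

lemma slit_fst (x : L) (a : L × Triangle) : (slit x a).1 = a.1 := by
  unfold slit; split_ifs with h
  · exact h.symm
  · rfl

lemma slit_injective (x : L) : Function.Injective (slit x) := by
  rintro ⟨e, q⟩ ⟨e', q'⟩ h
  have h1 := congrArg Prod.fst h
  rw [slit_fst, slit_fst] at h1
  obtain rfl : e = e' := h1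
  rcases eq_or_ne e x with rfl | he
  · rw [slit_self, slit_self, Prod.mk.injEq] at h
    rw [unslit_injective h.2]
  · rwa [slit_of_ne he, slit_of_ne he] at h

lemma slit_eq_self {x e : L} {q : Triangle} (h : unslit q = q) : slit x (e, q) = (e, q) := by
  rcases eq_or_ne e x with rfl | he
  · rw [slit_self, h]
  · exact slit_of_ne he q

lemma continuous_slit (x : L) : Continuous (slit x) := by
  rw [continuous_prod_of_discrete_left]
  intro e
  rcases eq_or_ne e x with rfl | he
  · simp only [slit_self]
    exact continuous_const.prodMk continuous_unslit
  · simp only [slit_of_ne he]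
    fun_prop

namespace SectorChart

variable {bar : L → L} {σ : Equiv.Perm L} {M : Type*} [TopologicalSpace M] {p : L × Triangle → M}
  (hp : SectorChart bar σ p) (x : L)

include hp

lemma eq_of_mem_openLens {q : Triangle} (hq : q ∈ openLens) {b : L × Triangle} (h : p (x, q) = p b) :
    b = (x, q) := by
  have h1 : q.1.1 ≠ 0 := fun h0 => by
    obtain ⟨hf, h⟩ := hq
    rw [h0] at h
    nlinarith [sq_nonneg q.1.2]
  have h2 : q.1.2 ≠ 0 := hq.1.ne'
  have h3 : q.1.1 + q.1.2 ≠ 1 := fun h0 => by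
    obtain ⟨hf, h⟩ := hq
    have e : q.1.1 = 1 - q.1.2 := by linarith
    rw [e] at h
    nlinarith [sq_nonneg q.1.2, q.2.1]
  rcases (hp.eq_iff _ _).1 h with h | ⟨rfl, -⟩ | ⟨rfl | rfl, -⟩ | ⟨-, r, rfl, -⟩ | ⟨-, r, -, rfl⟩ |
    ⟨-, t, rfl, -⟩
  · exact h.symm
  · exact absurd rfl h1
  · exact absurd rfl h2
  · exact absurd rfl h1
  · exact absurd rfl h1
  · exact absurd rfl h2
  · exact absurd (by simp [edge]) h3

/-- Within a single sector only the two outer corners and otherwise equal points are identified, and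
the closed lens omits the corner `finish 1`. -/
lemma lens_injective : Function.Injective fun z => p (x, lensPoint z) := by
  intro z z' h
  have hf : ∀ z, lensPoint z ≠ finish 1 := fun z h => by
    have e1 := congrArg (fun q : Triangle => q.1.1) h
    have e2 := congrArg (fun q : Triangle => q.1.2) h
    obtain ⟨z, hz⟩ := z
    simp only [lensPoint, finish, Set.Icc.coe_one] at e1 e2
    rw [← sq_le_one_iff₀ (norm_nonneg _), Complex.sq_norm, Complex.normSq_apply] at hz
    rw [e2] at e1
    have : z.re = 0 := by linarith
    rw [this] at e2 hz
    norm_num at e2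
    nlinarith
  apply lensPoint_injective
  rcases (hp.eq_iff _ _).1 h with h | ⟨h, h'⟩ | ⟨h, h'⟩ | ⟨h, -⟩ | ⟨h, -⟩ | ⟨h, -⟩
  · exact (Prod.mk.inj h).2
  · exact h.trans h'.symm
  · exact (h.resolve_right (hf _)).trans (h'.resolve_right (hf _)).symm
  · exact absurd h (hp.regular.next_ne x)
  · exact absurd h (hp.regular.next_ne x)
  · exact absurd h (hp.regular.bar_ne x)

lemma image_lens : (fun z => p (x, lensPoint z)) '' {z | ‖(z : ℂ)‖ < 1} =
    (fun q => p (x, q)) '' openLens := by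
  rw [← image_lensPoint, Set.image_image]

/-- The start side of `x` is no longer covered from the sector `x`, but still from the last spoke of
the preceding sector. -/
lemma range_slit : Set.range (p ∘ slit x) = ((fun q => p (x, q)) '' openLens)ᶜ := by
  ext m
  constructor
  · rintro ⟨a, rfl⟩ ⟨q, hq, h⟩
    have := hp.eq_of_mem_openLens x hq h
    have h1 := congrArg Prod.fst this
    rw [slit_fst] at h1
    obtain ⟨e, q'⟩ := a
    obtain rfl : e = x := h1
    rw [slit_self, Prod.mk.injEq] at this
    exact unslit_notMem_openLens q' (this.2 ▸ hq)
  · intro hm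
    obtain ⟨⟨e, q⟩, rfl⟩ := hp.surjective m
    rcases eq_or_ne e x with rfl | he
    · have hq : q ∉ openLens := fun hq => hm ⟨q, hq, rfl⟩
      by_cases hf : q.1.2 = 0
      · let r : unitInterval := ⟨q.1.1, q.2.1, by linarith [q.2.2.2, q.2.2.1]⟩
        have hqr : q = start r := by ext <;> simp [start, hf, r]
        refine ⟨(σ.symm e, finish r), ?_⟩
        rw [Function.comp_apply, slit_of_ne, hqr, hp.eq_iff]
        · exact Or.inr (Or.inr (Or.inr (Or.inl ⟨by simp, r, rfl, rfl⟩)))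
        · intro hc
          exact hp.regular.next_ne e (by conv_lhs => rw [← hc]; simp)
      · obtain ⟨q', rfl⟩ := exists_unslit_eq hq hf
        exact ⟨(e, q'), by rw [Function.comp_apply, slit_self]⟩
    · exact ⟨(e, q), by rw [Function.comp_apply, slit_of_ne he]⟩

lemma isOpen_image_openLens [T2Space M] : IsOpen ((fun q => p (x, q)) '' openLens) := by
  rw [← isClosed_compl_iff, ← hp.range_slit]
  exact (isCompact_range (hp.continuous.comp (continuous_slit x))).isClosed

lemma isEmbedding_lens [T2Space M] : IsEmbedding fun z => p (x, lensPoint z) :=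
  (Continuous.isClosedEmbedding (hp.continuous.comp (continuous_const.prodMk continuous_lensPoint))
    (hp.lens_injective x)).isEmbedding

lemma slit_notMem (a : L × Triangle) : p (slit x a) ∉ (fun q => p (x, q)) '' openLens := by
  rw [← Set.mem_compl_iff, ← hp.range_slit]
  exact ⟨a, rfl⟩

lemma exists_slit_eq {m : M} (hm : m ∉ (fun q => p (x, q)) '' openLens) : ∃ a, m = p (slit x a) := by
  rw [← Set.mem_compl_iff, ← hp.range_slit] at hm
  obtain ⟨a, ha⟩ := hm
  exact ⟨a, ha.symm⟩

lemma lens_conj_upperPoint (r : unitInterval) :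
    p (x, lensPoint (conjDisk (upperPoint r))) = p (slit x (σ.symm x, finish r)) := by
  rw [slit_of_ne, lensPoint_conj_upperPoint, hp.eq_iff]
  · exact Or.inr (Or.inr (Or.inr (Or.inr (Or.inl ⟨by simp, r, rfl, rfl⟩))))
  · intro hc
    exact hp.regular.next_ne x (by conv_lhs => rw [← hc]; simp)

omit hp in
lemma lens_upperPoint (r : unitInterval) :
    p (x, lensPoint (upperPoint r)) = p (slit x (x, start r)) := by
  rw [slit_self, lensPoint_upperPoint]

variable {L' : Type*} [TopologicalSpace L'] [DiscreteTopology L'] [Finite L'] [DecidableEq L']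
  {bar' : L' → L'} {σ' : Equiv.Perm L'} {S : Type*} [TopologicalSpace S] {p' : L' × Triangle → S}
  {j : L → L'}

/-- Opening the lens undoes the gluing along the first spoke of `x`, except at its end points, and
no other. In the larger surface the same spoke is where the second word is inserted, and its end
points remain the center and the vertex. -/
lemma slit_eq_iff {x : L} (hp' : SectorChart bar' σ' p') (hj : Function.Injective j)
    (hb : ∀ e, bar' (j e) = j (bar e)) (hs : ∀ e, σ e ≠ x → σ' (j e) = j (σ e))
    (hx : ∀ e e', σ' (j e) = j e' → σ e = e' ∧ e' ≠ x) (a b : L × Triangle) :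
    p (slit x a) = p (slit x b) ↔ p' (j a.1, a.2) = p' (j b.1, b.2) := by
  rw [hp.eq_iff, hp'.eq_iff]
  have hfin : ∀ e q r, (slit x (e, q)).2 = finish r ↔ q = finish r := fun e q r => by
    have h0 : slit x (e, finish r) = (e, finish r) := slit_eq_self (unslit_finish r)
    refine ⟨fun h => ?_, fun h => by rw [h, h0]⟩
    have := slit_injective x (a₁ := (e, q)) (a₂ := (e, finish r))
      (by rw [h0]; exact Prod.ext (slit_fst _ _) h)
    exact (Prod.mk.inj this).2
  have hedge : ∀ e q t, (slit x (e, q)).2 = edge t ↔ q = edge t := fun e q r => by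
    have h0 : slit x (e, edge r) = (e, edge r) := slit_eq_self (unslit_edge r)
    refine ⟨fun h => ?_, fun h => by rw [h, h0]⟩
    have := slit_injective x (a₁ := (e, q)) (a₂ := (e, edge r))
      (by rw [h0]; exact Prod.ext (slit_fst _ _) h)
    exact (Prod.mk.inj this).2
  have hctr : ∀ e q, (slit x (e, q)).2 = ctr ↔ q = ctr := fun e q => by
    have h0 : slit x (e, ctr) = (e, ctr) := slit_eq_self unslit_ctr
    refine ⟨fun h => ?_, fun h => by rw [h, h0]⟩
    have := slit_injective x (a₁ := (e, q)) (a₂ := (e, ctr))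
      (by rw [h0]; exact Prod.ext (slit_fst _ _) h)
    exact (Prod.mk.inj this).2
  have hst1 : ∀ e q, (slit x (e, q)).2 = start 1 ↔ q = start 1 := fun e q => by
    have h0 : slit x (e, start 1) = (e, start 1) := slit_eq_self unslit_start_one
    refine ⟨fun h => ?_, fun h => by rw [h, h0]⟩
    have := slit_injective x (a₁ := (e, q)) (a₂ := (e, start 1))
      (by rw [h0]; exact Prod.ext (slit_fst _ _) h)
    exact (Prod.mk.inj this).2
  have hctr' : ∀ r, (finish r = ctr ↔ start r = ctr) ∧ (finish r = finish 1 ↔ start r = start 1) := by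
    intro r
    refine ⟨⟨fun h => ?_, fun h => ?_⟩, ⟨fun h => ?_, fun h => ?_⟩⟩
    · have := congrArg (fun q : Triangle => q.1.2) h; simp [finish, ctr] at this; rw [this]; rfl
    · have := congrArg (fun q : Triangle => q.1.1) h; simp [start, ctr] at this; rw [this]; rfl
    · have := congrArg (fun q : Triangle => q.1.2) h; simp [finish] at this; rw [this]
    · have := congrArg (fun q : Triangle => q.1.1) h; simp [start] at this; rw [this]
  have spoke : ∀ e q e' q', (σ e = e' ∧ ∃ r, (slit x (e, q)).2 = finish r ∧
      (slit x (e', q')).2 = start r) → SectorEq bar' σ' (j e, q) (j e', q') := by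
    rintro e q e' q' ⟨he, r, h1, h2⟩
    rw [hfin] at h1
    rcases eq_or_ne e' x with h3 | h3
    · subst h3
      rw [slit_self] at h2
      -- The displaced start side meets the original one only in the end points, which are
      -- identified anyway.
      obtain ⟨h4, h5⟩ := eq_of_unslit_eq_start h2
      rcases h5 with h5 | h5
      · exact Or.inr (Or.inl ⟨h1.trans ((hctr' r).1.2 (h4.symm.trans h5)), h5⟩)
      · exact Or.inr (Or.inr (Or.inl
          ⟨Or.inr (h1.trans ((hctr' r).2.2 (h4.symm.trans h5))), Or.inl h5⟩))
    · rw [slit_of_ne h3] at h2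
      subst he
      exact Or.inr (Or.inr (Or.inr (Or.inl ⟨hs e h3, r, h1, h2⟩)))
  have symm : ∀ {a b}, SectorEq bar' σ' a b → SectorEq bar' σ' b a := fun h =>
    (hp'.eq_iff _ _).1 ((hp'.eq_iff _ _).2 h).symm
  obtain ⟨e, q⟩ := a
  obtain ⟨e', q'⟩ := b
  constructor
  · rintro (h | ⟨h, h'⟩ | ⟨h, h'⟩ | h | h | ⟨h, t, h1, h2⟩)
    · rw [(Prod.mk.inj (slit_injective x h)).1, (Prod.mk.inj (slit_injective x h)).2]
      exact Or.inl rfl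
    · rw [hctr] at h h'
      exact Or.inr (Or.inl ⟨h, h'⟩)
    · rw [hst1, hfin] at h h'
      exact Or.inr (Or.inr (Or.inl ⟨h, h'⟩))
    · rw [slit_fst, slit_fst] at h
      exact spoke _ _ _ _ h
    · rw [slit_fst, slit_fst] at h
      exact symm (spoke _ _ _ _ h)
    · rw [hedge] at h1 h2
      rw [slit_fst, slit_fst] at h
      exact Or.inr (Or.inr (Or.inr (Or.inr (Or.inr ⟨by rw [hb]; exact congrArg j h, t, h1, h2⟩))))
  · rintro (h | ⟨h, h'⟩ | ⟨h, h'⟩ | ⟨h, r, h1, h2⟩ | ⟨h, r, h1, h2⟩ | ⟨h, t, h1, h2⟩)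
    · obtain ⟨h1, h2⟩ := Prod.mk.inj h
      simp only at h1 h2
      rw [hj h1, h2]
      exact Or.inl rfl
    · exact Or.inr (Or.inl ⟨(hctr _ _).2 h, (hctr _ _).2 h'⟩)
    · exact Or.inr (Or.inr (Or.inl ⟨h.imp (hst1 _ _).2 (hfin _ _ _).2,
        h'.imp (hst1 _ _).2 (hfin _ _ _).2⟩))
    · obtain ⟨h3, h4⟩ := hx _ _ h
      refine Or.inr (Or.inr (Or.inr (Or.inl ⟨?_, r, (hfin _ _ _).2 h1, ?_⟩)))
      · rw [slit_fst, slit_fst]; exact h3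
      · rw [slit_of_ne h4]; exact h2
    · obtain ⟨h3, h4⟩ := hx _ _ h
      refine Or.inr (Or.inr (Or.inr (Or.inr (Or.inl ⟨?_, r, (hfin _ _ _).2 h1, ?_⟩))))
      · rw [slit_fst, slit_fst]; exact h3
      · rw [slit_of_ne h4]; exact h2
    · refine Or.inr (Or.inr (Or.inr (Or.inr (Or.inr ⟨?_, t, (hedge _ _ _).2 h1, (hedge _ _ _).2 h2⟩))))
      rw [slit_fst, slit_fst]
      simp only at h
      rw [hb] at h
      exact hj h

/-- The surface with a lens removed embeds into a larger surface with a cut. -/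
lemma exists_isEmbedding [T2Space M] [T2Space S] {x : L} (hp' : SectorChart bar' σ' p')
    (hj : Function.Injective j) (hb : ∀ e, bar' (j e) = j (bar e))
    (hs : ∀ e, σ e ≠ x → σ' (j e) = j (σ e)) (hx : ∀ e e', σ' (j e) = j e' → σ e = e' ∧ e' ≠ x)
    {d : ClosedDisk → M} (hd : d '' {z | ‖(z : ℂ)‖ < 1} = (fun q => p (x, q)) '' openLens) :
    ∃ i : C(RemoveDisk d, S), IsEmbedding i ∧
      ∀ (m : RemoveDisk d) a, (m : M) = p (slit x a) → i m = p' (j a.1, a.2) := by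
  have key := hp.slit_eq_iff hp' hj hb hs hx
  have hmem : ∀ a, p (slit x a) ∉ d '' {z | ‖(z : ℂ)‖ < 1} := fun a => by
    rw [hd]; exact hp.slit_notMem x a
  let r : C(L × Triangle, RemoveDisk d) :=
    ⟨fun a => ⟨p (slit x a), hmem a⟩, (hp.continuous.comp (continuous_slit x)).subtype_mk hmem⟩
  have hr : Function.Surjective r := fun m => by
    obtain ⟨a, ha⟩ := hp.exists_slit_eq x (by rw [← hd]; exact m.2)
    exact ⟨a, Subtype.ext ha.symm⟩
  have hq : IsQuotientMap r := IsQuotientMap.of_surjective_continuous hr r.continuous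
  let f : C(L × Triangle, S) := ⟨fun a => p' (j a.1, a.2), hp'.continuous.comp
    ((continuous_of_discreteTopology.comp continuous_fst).prodMk continuous_snd)⟩
  have hfac : Function.FactorsThrough f r := fun a b h => (key a b).1 (congrArg Subtype.val h)
  have hi : ∀ a, hq.lift f hfac (r a) = f a := fun a => DFunLike.congr_fun (hq.lift_comp f hfac) a
  refine ⟨hq.lift f hfac, ?_, fun m a h => ?_⟩
  · have : CompactSpace (RemoveDisk d) := hr.compactSpace r.continuous
    refine (Continuous.isClosedEmbedding (hq.lift f hfac).continuous ?_).isEmbedding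
    intro m m' h
    obtain ⟨a, rfl⟩ := hr m
    obtain ⟨b, rfl⟩ := hr m'
    rw [hi, hi] at h
    exact Subtype.ext ((key a b).2 h)
  · obtain rfl : m = r a := Subtype.ext h
    exact hi a

end SectorChart

variable {L' : Type*} [TopologicalSpace L'] [DiscreteTopology L'] [Finite L'] [DecidableEq L']
  {bar : L → L} {σ : Equiv.Perm L} {bar' : L' → L'} {σ' : Equiv.Perm L'} {x : L} {y : L'}
  {M N S : Type*} [TopologicalSpace M] [TopologicalSpace N] [TopologicalSpace S]
  [T2Space M] [T2Space N] [T2Space S]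
  {p : L × Triangle → M} {p' : L' × Triangle → N} {p'' : (L ⊕ L') × Triangle → S}

/-- The surface with the product of two words is the connected sum of the surfaces with the two
words. -/
theorem exists_connectedSumDecomposition (hp : SectorChart bar σ p) (hp' : SectorChart bar' σ' p')
    (hp'' : SectorChart (Sum.map bar bar') (joinPerm σ σ' x y) p'') :
    ∃ D : ConnectedSumDecomposition S M N, IsOpen (D.dM '' {z | ‖(z : ℂ)‖ < 1}) ∧
      (∀ m, ∃ a : L' × Triangle, D.iN m = p'' (.inr a.1, a.2)) ∧ D.base = p'' (.inr y, start 1) := by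
  let dM : ClosedDisk → M := fun z => p (x, lensPoint z)
  -- The joined order glues the first spoke of each word to the last spoke of the other, so the
  -- upper arc of one lens belongs to the lower arc of the other; conjugation matches them.
  let dN : ClosedDisk → N := fun z => p' (y, lensPoint (conjDisk z))
  have hdM : dM '' {z | ‖(z : ℂ)‖ < 1} = (fun q => p (x, q)) '' openLens := hp.image_lens x
  have hdN : dN '' {z | ‖(z : ℂ)‖ < 1} = (fun q => p' (y, q)) '' openLens := by
    rw [← hp'.image_lens y]
    ext m
    constructor
    · rintro ⟨z, hz, rfl⟩
      exact ⟨conjDisk z, by simpa [conjDisk] using hz, rfl⟩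
    · rintro ⟨z, hz, rfl⟩
      exact ⟨conjDisk z, by simpa [conjDisk] using hz, by simp only [dN, conjDisk_conjDisk]⟩
  have hconj : IsEmbedding conjDisk :=
    (Continuous.isClosedEmbedding continuous_conjDisk
      (Function.LeftInverse.injective conjDisk_conjDisk)).isEmbedding
  have edM : IsEmbedding dM := hp.isEmbedding_lens x
  have edN : IsEmbedding dN := (hp'.isEmbedding_lens y).comp hconj
  obtain ⟨iM, hiM, jM⟩ := hp.exists_isEmbedding hp'' Sum.inl_injective (fun e => rfl)
    (fun e he => by rw [joinPerm_inl, if_neg he])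
    (fun e e' h => by
      rw [joinPerm_inl] at h
      split_ifs at h with h1
      have h2 := Sum.inl_injective h
      exact ⟨h2, h2 ▸ h1⟩) hdM
  obtain ⟨iN, hiN, jN⟩ := hp'.exists_isEmbedding hp'' Sum.inr_injective (fun e => rfl)
    (fun e he => by rw [joinPerm_inr, if_neg he])
    (fun e e' h => by
      rw [joinPerm_inr] at h
      split_ifs at h with h1
      have h2 := Sum.inr_injective h
      exact ⟨h2, h2 ▸ h1⟩) hdN
  have mem : ∀ (m : RemoveDisk dM), ∃ a, (m : M) = p (slit x a) := fun m =>
    hp.exists_slit_eq x (by rw [← hdM]; exact m.2)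
  have mem' : ∀ (m : RemoveDisk dN), ∃ a, (m : N) = p' (slit y a) := fun m =>
    hp'.exists_slit_eq y (by rw [← hdN]; exact m.2)
  have s₁ : ∀ r, p'' (.inl (σ.symm x), finish r) = p'' (.inr y, start r) := fun r => by
    rw [hp''.eq_iff]
    exact Or.inr (Or.inr (Or.inr (Or.inl ⟨by simp [joinPerm_inl], r, rfl, rfl⟩)))
  have s₂ : ∀ r, p'' (.inr (σ'.symm y), finish r) = p'' (.inl x, start r) := fun r => by
    rw [hp''.eq_iff]
    exact Or.inr (Or.inr (Or.inr (Or.inl ⟨by simp [joinPerm_inr], r, rfl, rfl⟩)))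
  have glue : ∀ (z : ClosedDisk) (hz : ‖(z : ℂ)‖ = 1),
      iM (RemoveDisk.boundary dM edM.injective z hz) =
        iN (RemoveDisk.boundary dN edN.injective z hz) := by
    intro z hz
    obtain ⟨r, rfl | rfl⟩ := exists_upperPoint_eq hz
    · rw [jM _ (x, start r) (SectorChart.lens_upperPoint x r),
        jN _ (σ'.symm y, finish r) (hp'.lens_conj_upperPoint y r), s₂]
    · rw [jM _ (σ.symm x, finish r) (hp.lens_conj_upperPoint x r),
        jN _ (y, start r) (by
          change p' (y, lensPoint (conjDisk (conjDisk _))) = _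
          rw [conjDisk_conjDisk, SectorChart.lens_upperPoint (p := p')]), s₁]
  have hn : ∀ r, ‖(conjDisk (upperPoint r) : ℂ)‖ = 1 := fun r => by
    simpa [conjDisk] using norm_upperPoint r
  have bnd : ∀ r : unitInterval, ∀ (m : M) (n : N),
      m = p (slit x (x, start r)) → n = p' (slit y (σ'.symm y, finish r)) →
      ∃ z : ClosedDisk, ‖(z : ℂ)‖ = 1 ∧ m = dM z ∧ n = dN z := fun r m n h h' =>
    ⟨upperPoint r, norm_upperPoint r, h.trans (SectorChart.lens_upperPoint x r).symm,
      h'.trans (hp'.lens_conj_upperPoint y r).symm⟩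
  have bnd' : ∀ r : unitInterval, ∀ (m : M) (n : N),
      m = p (slit x (σ.symm x, finish r)) → n = p' (slit y (y, start r)) →
      ∃ z : ClosedDisk, ‖(z : ℂ)‖ = 1 ∧ m = dM z ∧ n = dN z := fun r m n h h' =>
    ⟨conjDisk (upperPoint r), hn r, h.trans (hp.lens_conj_upperPoint x r).symm,
      h'.trans (by simp only [dN, conjDisk_conjDisk, SectorChart.lens_upperPoint])⟩
  have inter : ∀ m n, iM m = iN n → ∃ z : ClosedDisk, ‖(z : ℂ)‖ = 1 ∧ (m : M) = dM z ∧
      (n : N) = dN z := by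
    intro m n h
    obtain ⟨⟨e, q⟩, ha⟩ := mem m
    obtain ⟨⟨e', q'⟩, hb⟩ := mem' n
    rw [jM m _ ha, jN n _ hb] at h
    rw [hp''.eq_iff] at h
    have same : ∀ r a b, p (slit x (e, q)) = p (slit x a) → p' (slit y (e', q')) = p' (slit y b) →
        (a = (x, start r) ∧ b = (σ'.symm y, finish r)) ∨
          (a = (σ.symm x, finish r) ∧ b = (y, start r)) →
        ∃ z : ClosedDisk, ‖(z : ℂ)‖ = 1 ∧ (m : M) = dM z ∧ (n : N) = dN z := by
      rintro r _ _ h1 h2 (⟨rfl, rfl⟩ | ⟨rfl, rfl⟩)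
      · exact bnd r _ _ (ha.trans h1) (hb.trans h2)
      · exact bnd' r _ _ (ha.trans h1) (hb.trans h2)
    rcases h with h | ⟨h1, h2⟩ | ⟨h1, h2⟩ | ⟨h, r, h1, h2⟩ | ⟨h, r, h1, h2⟩ | ⟨h, -⟩
    · simp at h
    · simp only at h1 h2
      subst h1 h2
      have c : ∀ e, slit x (e, ctr) = (e, ctr) := fun e => slit_eq_self unslit_ctr
      have c' : ∀ e, slit y (e, ctr) = (e, ctr) := fun e => slit_eq_self unslit_ctr
      have z0 : start 0 = ctr := by ext <;> simp [start, ctr]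
      have z1 : finish 0 = ctr := by ext <;> simp [finish, ctr]
      refine same 0 (x, start 0) (σ'.symm y, finish 0) ?_ ?_ (Or.inl ⟨rfl, rfl⟩)
      · rw [z0, c, c, hp.eq_iff]; exact Or.inr (Or.inl ⟨rfl, rfl⟩)
      · rw [z1, c', c', hp'.eq_iff]; exact Or.inr (Or.inl ⟨rfl, rfl⟩)
    · simp only at h1 h2
      have c : ∀ e q, (q = start 1 ∨ q = finish 1) → slit x (e, q) = (e, q) := by
        rintro e q (rfl | rfl)
        exacts [slit_eq_self unslit_start_one, slit_eq_self (unslit_finish 1)]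
      have c' : ∀ e q, (q = start 1 ∨ q = finish 1) → slit y (e, q) = (e, q) := by
        rintro e q (rfl | rfl)
        exacts [slit_eq_self unslit_start_one, slit_eq_self (unslit_finish 1)]
      refine same 1 (x, start 1) (σ'.symm y, finish 1) ?_ ?_ (Or.inl ⟨rfl, rfl⟩)
      · rw [c _ _ h1, c _ _ (Or.inl rfl), hp.eq_iff]
        exact Or.inr (Or.inr (Or.inl ⟨h1, Or.inl rfl⟩))
      · rw [c' _ _ h2, c' _ _ (Or.inr rfl), hp'.eq_iff]
        exact Or.inr (Or.inr (Or.inl ⟨h2, Or.inr rfl⟩))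
    · simp only [joinPerm_inl] at h h1 h2
      split_ifs at h with h3
      obtain rfl := Sum.inr_injective h
      obtain rfl : e = σ.symm x := by rw [← h3]; simp
      exact same r _ _ rfl rfl (Or.inr ⟨by rw [h1], by rw [h2]⟩)
    · simp only [joinPerm_inr] at h h1 h2
      split_ifs at h with h3
      obtain rfl := Sum.inl_injective h
      obtain rfl : e' = σ'.symm y := by rw [← h3]; simp
      exact same r _ _ rfl rfl (Or.inl ⟨by rw [h2], by rw [h1]⟩)
    · simp at h
  have cover : Set.range iM ∪ Set.range iN = Set.univ := by
    refine Set.eq_univ_of_forall fun s => ?_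
    obtain ⟨⟨e | e, q⟩, rfl⟩ := hp''.surjective s
    · exact Or.inl ⟨⟨p (slit x (e, q)), by rw [hdM]; exact hp.slit_notMem x _⟩, jM _ (e, q) rfl⟩
    · exact Or.inr ⟨⟨p' (slit y (e, q)), by rw [hdN]; exact hp'.slit_notMem y _⟩, jN _ (e, q) rfl⟩
  let D : ConnectedSumDecomposition S M N := ⟨dM, dN, edM, edN, iM, iN, hiM, hiN, glue, cover, inter⟩
  refine ⟨D, ?_, fun m => ?_, ?_⟩
  · change IsOpen (dM '' _)
    rw [hdM]
    exact hp.isOpen_image_openLens x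
  · obtain ⟨a, ha⟩ := mem' m
    exact ⟨a, jN m a ha⟩
  · have h1 : (⟨1, by simp⟩ : ClosedDisk) = conjDisk (upperPoint 1) := by
      apply Subtype.ext
      apply Complex.ext <;> simp [conjDisk, upperPoint] <;> norm_num
    refine (jM _ (σ.symm x, finish 1) ?_).trans (s₁ 1)
    rw [← hp.lens_conj_upperPoint x 1, ← h1]
    rfl

end ConnectedSum

/-! ### Trivial labels make the path homomorphism trivial on a region. -/

section Trivialization

set_option linter.unusedSectionVars false

open Topology SectorSurface Triangle

variable {L : Type*} [TopologicalSpace L] [DiscreteTopology L] {bar : L → L} {σ : Equiv.Perm L}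
  {G : Type*} [Group G] (F : PathHom (SectorSurface bar σ) G)

namespace SectorSurface

/-- The value of a path homomorphism on the paths from the center within a sector. -/
noncomputable def development (e : L) (q : Triangle) : G :=
  F.comap (sector bar σ e) (PathConnectedSpace.somePath ctr q)

lemma development_eq (e : L) {q : Triangle} (δ : Path ctr q) :
    development F e q = F.comap (sector bar σ e) δ :=
  PathHom.eq_of_simplyConnected _ _ _

lemma development_mul (e : L) {q q' : Triangle} (δ : Path q q') :
    development F e q * F.comap (sector bar σ e) δ = development F e q' := by
  rw [development, ← PathHom.map_trans]
  exact PathHom.eq_of_simplyConnected _ _ _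

lemma development_ctr (e : L) : development F e ctr = 1 := by
  rw [development_eq F e (Path.refl ctr), PathHom.map_refl]

lemma development_start_one (e : L) : development F e (start 1) = spokeValue F e :=
  development_eq F e startPath

lemma development_finish_one (e : L) :
    development F e (finish 1) = spokeValue F e * label F e := by
  rw [← development_mul F e edgePath, development_start_one, label]

lemma development_finish (e : L) (r : unitInterval) :
    development F e (finish r) = development F (σ e) (start r) := by
  let α : Path ctr (finish r) := ⟨⟨fun t => finish (t * r), by unfold finish; fun_prop⟩, by
    ext <;> simp [finish, ctr], by simp⟩
  let β : Path ctr (start r) := ⟨⟨fun t => start (t * r), by unfold start; fun_prop⟩, by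
    ext <;> simp [start, ctr], by simp⟩
  rw [development_eq F e α, development_eq F _ β]
  exact F.congr _ _ fun t => Quot.sound (.spoke e _)

lemma development_edge (e : L) (t : unitInterval) :
    (development F e (start 1))⁻¹ * development F e (edge t) =
      (development F (bar e) (finish 1))⁻¹ * development F (bar e) (edge (unitInterval.symm t)) := by
  let α : Path (start 1) (edge t) := ⟨⟨fun r => edge (r * t), by unfold edge; fun_prop⟩, by
    ext <;> simp [edge, start], by simp⟩
  let β : Path (finish 1) (edge (unitInterval.symm t)) :=
    ⟨⟨fun r => edge (unitInterval.symm (r * t)), by unfold edge; fun_prop⟩, by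
    ext <;> simp [edge, finish], by simp⟩
  rw [← development_mul F e α, ← development_mul F (bar e) β, inv_mul_cancel_left,
    inv_mul_cancel_left]
  exact F.congr _ _ fun r => Quot.sound (.side e _)

/-- A path homomorphism with trivial labels in a region can be made trivial on all paths which lie in
a sector of this region. -/
theorem exists_gauge (hr : IsRegularGluing bar σ) {A : Set L} {e₀ : L} (he₀ : e₀ ∈ A)
    (hκ : ∀ e ∈ A, spokeValue F e = spokeValue F e₀) (hl : ∀ e ∈ A, label F e = 1) :
    ∃ u : SectorSurface bar σ → G, u (Quot.mk _ (e₀, start 1)) = 1 ∧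
      ∀ e ∈ A, ∀ {q q' : Triangle} (δ : Path q q'), (F.gauge u).comap (sector bar σ e) δ = 1 := by
  classical
  let D : L × Triangle → G := fun a => development F a.1 a.2
  have hs : ∀ e ∈ A, D (e, start 1) = spokeValue F e₀ := fun e he =>
    (development_start_one F e).trans (hκ e he)
  have hf : ∀ e ∈ A, D (e, finish 1) = spokeValue F e₀ := fun e he => by
    rw [← hκ e he]
    exact (development_finish_one F e).trans (by rw [hl e he, mul_one])
  -- The developments of different sectors agree at identified points: at vertices because the
  -- labels are 1 and the spoke values are constant on `A`, and then along the sides.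
  have wd : ∀ a b : L × Triangle, a.1 ∈ A → b.1 ∈ A →
      Quot.mk (SectorGluing bar σ) a = Quot.mk _ b → D a = D b := by
    rintro ⟨e, q⟩ ⟨e', q'⟩ he he' h
    have hv : ∀ e ∈ A, ∀ q, (q = start 1 ∨ q = finish 1) → D (e, q) = spokeValue F e₀ := by
      rintro e he q (rfl | rfl)
      exacts [hs e he, hf e he]
    rcases (mk_eq_iff hr).1 h with h | ⟨h, h'⟩ | ⟨h, h'⟩ | ⟨h, r, h1, h2⟩ | ⟨h, r, h1, h2⟩ |
      ⟨h, t, h1, h2⟩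
    · rw [h]
    · simp only at h h'
      rw [h, h']
      exact (development_ctr F e).trans (development_ctr F e').symm
    · rw [hv e he _ h, hv e' he' _ h']
    · simp only at h h1 h2
      rw [h1, h2, ← h]
      exact development_finish F e r
    · simp only at h h1 h2
      rw [h1, h2, ← h]
      exact (development_finish F e' r).symm
    · simp only at h h1 h2
      subst h h1 h2
      have h3 := development_edge F e t
      change (D (e, start 1))⁻¹ * D (e, edge t) =
        (D (bar e, finish 1))⁻¹ * D (bar e, edge (unitInterval.symm t)) at h3
      rw [hs e he, hf _ he'] at h3
      exact mul_left_cancel h3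
  let u : SectorSurface bar σ → G := fun x =>
    if h : ∃ a : L × Triangle, a.1 ∈ A ∧ Quot.mk _ a = x then
      (spokeValue F e₀)⁻¹ * D h.choose else 1
  have hu : ∀ a : L × Triangle, a.1 ∈ A → u (Quot.mk _ a) = (spokeValue F e₀)⁻¹ * D a := by
    intro a ha
    have h : ∃ b : L × Triangle, b.1 ∈ A ∧ Quot.mk (SectorGluing bar σ) b = Quot.mk _ a :=
      ⟨a, ha, rfl⟩
    simp only [u, dif_pos h]
    rw [wd _ _ h.choose_spec.1 ha h.choose_spec.2]
  refine ⟨u, ?_, fun e he q q' δ => ?_⟩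
  · rw [hu _ he₀, hs _ he₀, inv_mul_cancel]
  · change u (Quot.mk _ (e, q)) * F.comap (sector bar σ e) δ * (u (Quot.mk _ (e, q')))⁻¹ = 1
    rw [hu _ he, hu _ he, mul_inv_eq_one, mul_assoc]
    exact congrArg _ (development_mul F e δ)

end SectorSurface

/-- Weights for moving the points of a sector towards the start, the finish, the middle of the outer
side and the center, compatible with the gluing. -/
structure StarWeight (bar : L → L) (σ : Equiv.Perm L) where
  /-- The weight of the start. -/
  a : L → Triangle → ℝ
  /-- The weight of the finish. -/
  b : L → Triangle → ℝ
  /-- The weight of the middle of the outer side. -/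
  m : L → Triangle → ℝ
  /-- The weight of the center. -/
  w : L → Triangle → ℝ
  continuous_a : ∀ e, Continuous (a e)
  continuous_b : ∀ e, Continuous (b e)
  continuous_m : ∀ e, Continuous (m e)
  continuous_w : ∀ e, Continuous (w e)
  a_nonneg : ∀ e q, 0 ≤ a e q
  b_nonneg : ∀ e q, 0 ≤ b e q
  m_nonneg : ∀ e q, 0 ≤ m e q
  w_nonneg : ∀ e q, 0 ≤ w e q
  a_ctr : ∀ e, a e ctr = 0
  b_ctr : ∀ e, b e ctr = 0
  m_ctr : ∀ e, m e ctr = 0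
  w_ctr : ∀ e e', w e ctr = w e' ctr
  a_finish : ∀ e r, a e (finish r) = 0
  m_finish : ∀ e r, m e (finish r) = 0
  b_start : ∀ e r, b e (start r) = 0
  m_start : ∀ e r, m e (start r) = 0
  a_start : ∀ e r, a (σ e) (start r) = b e (finish r)
  w_start : ∀ e r, w (σ e) (start r) = w e (finish r)
  w_edge : ∀ e t, w e (edge t) = 0
  a_edge : ∀ e t, a (bar e) (edge (unitInterval.symm t)) = b e (edge t)
  b_edge : ∀ e t, b (bar e) (edge (unitInterval.symm t)) = a e (edge t)
  m_edge : ∀ e t, m (bar e) (edge (unitInterval.symm t)) = m e (edge t)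

namespace StarWeight

variable (V : StarWeight bar σ)

/-- The total weight. -/
def total (e : L) (q : Triangle) : ℝ := V.a e q + V.b e q + V.m e q + V.w e q

lemma continuous_total (e : L) : Continuous (V.total e) :=
  (((V.continuous_a e).add (V.continuous_b e)).add (V.continuous_m e)).add (V.continuous_w e)

/-- The total weight as a function on the surface. -/
def totalMap : SectorSurface bar σ → ℝ :=
  Quot.lift (fun a => V.total a.1 a.2) fun _ _ h => by
    cases h <;>
      simp [total, V.a_ctr, V.b_ctr, V.m_ctr, V.a_finish, V.m_finish, V.b_start,
        V.m_start, V.a_start, V.w_start, V.w_edge, V.a_edge, V.b_edge, V.m_edge, add_comm]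
    exact V.w_ctr _ _

lemma continuous_totalMap : Continuous V.totalMap :=
  continuous_quot_lift _ (continuous_prod_of_discrete_left.2 fun e => V.continuous_total e)

/-- The normalization of the weights to a total of at most one. -/
noncomputable def scale (e : L) (q : Triangle) : ℝ := (max 1 (V.total e q))⁻¹

lemma scale_pos (e : L) (q : Triangle) : 0 < V.scale e q :=
  inv_pos.2 (lt_of_lt_of_le one_pos (le_max_left _ _))

lemma scale_mul_total_le (e : L) (q : Triangle) : V.scale e q * V.total e q ≤ 1 := by
  rw [scale, inv_mul_le_iff₀ (lt_of_lt_of_le one_pos (le_max_left _ _)), mul_one]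
  exact le_max_right _ _

lemma scale_eq {e : L} {q : Triangle} (h : 1 < V.total e q) : V.scale e q * V.total e q = 1 := by
  rw [scale, max_eq_right h.le]
  exact inv_mul_cancel₀ (by linarith)

lemma continuous_scale (e : L) : Continuous (V.scale e) :=
  (continuous_const.max (V.continuous_total e)).inv₀ fun _ =>
    (lt_of_lt_of_le one_pos (le_max_left _ _)).ne'

/-- The motion of a sector. -/
noncomputable def flow (e : L) (q : Triangle) (τ : unitInterval) : Triangle :=
  ⟨(q.1.1 + τ * V.scale e q * (V.a e q * (1 - q.1.1) - V.b e q * q.1.1 +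
      V.m e q * (1 / 2 - q.1.1) - V.w e q * q.1.1),
    q.1.2 + τ * V.scale e q * (V.b e q * (1 - q.1.2) - V.a e q * q.1.2 +
      V.m e q * (1 / 2 - q.1.2) - V.w e q * q.1.2)), by
    have h0 := mul_nonneg τ.2.1 (V.scale_pos e q).le
    have h1 : (τ : ℝ) * V.scale e q * V.total e q ≤ 1 := by
      rw [mul_assoc]
      exact mul_le_one₀ τ.2.2 (mul_nonneg (V.scale_pos e q).le (by
        have := V.a_nonneg e q; have := V.b_nonneg e q; have := V.m_nonneg e q
        have := V.w_nonneg e q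
        unfold total; linarith)) (V.scale_mul_total_le e q)
    have ha := mul_nonneg h0 (V.a_nonneg e q)
    have hb := mul_nonneg h0 (V.b_nonneg e q)
    have hm := mul_nonneg h0 (V.m_nonneg e q)
    have hw := mul_nonneg h0 (V.w_nonneg e q)
    unfold total at h1
    obtain ⟨⟨s, f⟩, hs, hf, hsf⟩ := q
    simp only at hs hf hsf
    refine ⟨?_, ?_, ?_⟩ <;> simp only
    · nlinarith [mul_le_mul_of_nonneg_right h1 hs]
    · nlinarith [mul_le_mul_of_nonneg_right h1 hf]
    · nlinarith [mul_le_mul_of_nonneg_right h1 (sub_nonneg.2 hsf)]⟩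

lemma flow_zero (e : L) (q : Triangle) : V.flow e q 0 = q := by
  ext <;> simp [flow]

lemma continuous_flow (e : L) : Continuous fun p : Triangle × unitInterval => V.flow e p.1 p.2 := by
  have := V.continuous_a e
  have := V.continuous_b e
  have := V.continuous_m e
  have := V.continuous_w e
  have := V.continuous_scale e
  unfold flow
  fun_prop

lemma mk_flow {a b : L × Triangle} (h : SectorGluing bar σ a b) (τ : unitInterval) :
    Quot.mk (SectorGluing bar σ) (a.1, V.flow a.1 a.2 τ) = Quot.mk _ (b.1, V.flow b.1 b.2 τ) := by
  have hT : V.scale a.1 a.2 = V.scale b.1 b.2 := by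
    have : V.total a.1 a.2 = V.total b.1 b.2 := congrArg V.totalMap (Quot.sound h)
    rw [scale, this, scale]
  cases h with
  | center e e' =>
    apply center_eq <;> simp only [flow, V.a_ctr, V.b_ctr, V.m_ctr] <;> simp [ctr]
  | spoke e r =>
    simp only at hT
    refine spoke_eq rfl ?_ ?_ ?_ <;>
      simp only [flow, V.a_finish, V.m_finish, V.b_start, V.m_start, V.a_start, V.w_start, hT] <;>
      simp [finish, start]
  | side e t =>
    simp only at hT
    refine side_eq rfl ?_ ?_ ?_ <;>
      simp only [flow, V.w_edge, V.a_edge, V.b_edge, V.m_edge, hT] <;>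
      (simp [edge]; try ring)

/-- The motion of the surface. -/
noncomputable def flowMap : SectorSurface bar σ → C(unitInterval, SectorSurface bar σ) :=
  Quot.lift (fun a => ⟨fun τ => Quot.mk _ (a.1, V.flow a.1 a.2 τ), continuous_quot_mk.comp
    (continuous_const.prodMk ((V.continuous_flow a.1).comp (continuous_const.prodMk continuous_id)))⟩)
    fun _ _ h => ContinuousMap.ext fun τ => V.mk_flow h τ

lemma continuous_flowMap : Continuous V.flowMap := by
  refine continuous_quot_lift _ (continuous_prod_of_discrete_left.2 fun e => ?_)
  exact ContinuousMap.continuous_of_continuous_uncurry _ (continuous_quot_mk.comp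
    (continuous_const.prodMk (V.continuous_flow e)))

variable {F} {A : Set L}

/-- A path may cross spokes infinitely often, so it cannot simply be cut into pieces lying in
sectors. The flow instead contracts the path to `c`; each track stays in one sector of `A`, where
`F` is trivial, and the square swept out gives `F γ = 1`. -/
lemma eq_one (hF : ∀ e ∈ A, ∀ {q q' : Triangle} (δ : Path q q'), F.comap (sector bar σ e) δ = 1)
    {c : SectorSurface bar σ} (hc : ∀ e q, 1 < V.total e q → Quot.mk _ (e, V.flow e q 1) = c)
    {x y : SectorSurface bar σ} (γ : Path x y) (hγ : ∀ t, 1 < V.totalMap (γ t))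
    (hA : ∀ t, ∃ a : L × Triangle, a.1 ∈ A ∧ Quot.mk _ a = γ t) : F γ = 1 := by
  let Φ : C(unitInterval × unitInterval, SectorSurface bar σ) :=
    ⟨fun p => V.flowMap (γ p.1) p.2, by
      have h := V.continuous_flowMap.comp γ.continuous
      exact ContinuousMap.continuous_uncurry_of_continuous ⟨_, h⟩⟩
  have hc' : ∀ x, 1 < V.totalMap x → V.flowMap x 1 = c := by
    rintro ⟨e, q⟩ h
    exact hc e q h
  have h0 : ∀ x, V.flowMap x 0 = x := by
    rintro ⟨e, q⟩
    exact congrArg (fun q => Quot.mk _ (e, q)) (V.flow_zero e q)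
  have track : ∀ t, ∃ δ : Path (γ t) c, (∀ τ, δ τ = V.flowMap (γ t) τ) ∧ F δ = 1 := by
    intro t
    obtain ⟨⟨e, q⟩, he, h⟩ := hA t
    refine ⟨⟨V.flowMap (γ t), h0 _, hc' _ (hγ t)⟩, fun τ => rfl, ?_⟩
    let δ : Path q (V.flow e q 1) :=
      ⟨⟨fun τ => V.flow e q τ, (V.continuous_flow e).comp (continuous_const.prodMk continuous_id)⟩,
        V.flow_zero e q, rfl⟩
    rw [← hF e he δ]
    refine F.congr _ _ fun τ => ?_
    change V.flowMap (γ t) τ = _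
    rw [← h]
    rfl
  obtain ⟨δ₀, e₀, f₀⟩ := track 0
  obtain ⟨δ₁, e₁, f₁⟩ := track 1
  have := F.square Φ (γ.cast γ.source γ.target) δ₁ δ₀ (Path.refl c) (fun t => (h0 _).symm) e₁ e₀
    (fun t => (hc' _ (hγ t)).symm)
  rw [f₁, f₀, F.map_refl, mul_one, mul_one] at this
  exact (F.congr γ (γ.cast γ.source γ.target) fun t => rfl).trans this

/-- The weight of the star of the center. -/
def center (bar : L → L) (σ : Equiv.Perm L) : StarWeight bar σ where
  a _ _ := 0
  b _ _ := 0
  m _ _ := 0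
  w _ q := 3 * (1 - q.1.1 - q.1.2)
  continuous_a _ := continuous_const
  continuous_b _ := continuous_const
  continuous_m _ := continuous_const
  continuous_w _ := by fun_prop
  a_nonneg _ _ := le_rfl
  b_nonneg _ _ := le_rfl
  m_nonneg _ _ := le_rfl
  w_nonneg _ q := by linarith [q.2.2.2]
  a_ctr _ := rfl
  b_ctr _ := rfl
  m_ctr _ := rfl
  w_ctr _ _ := rfl
  a_finish _ _ := rfl
  m_finish _ _ := rfl
  b_start _ _ := rfl
  m_start _ _ := rfl
  a_start _ _ := rfl
  w_start _ _ := by simp [start, finish]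
  w_edge _ _ := by simp [edge]
  a_edge _ _ := rfl
  b_edge _ _ := rfl
  m_edge _ _ := rfl

/-- The weight of the star of the vertex. -/
def vertex (bar : L → L) (σ : Equiv.Perm L) : StarWeight bar σ where
  a _ q := 2 * max (q.1.1 - q.1.2) 0
  b _ q := 2 * max (q.1.2 - q.1.1) 0
  m _ _ := 0
  w _ _ := 0
  continuous_a _ := by fun_prop
  continuous_b _ := by fun_prop
  continuous_m _ := continuous_const
  continuous_w _ := continuous_const
  a_nonneg _ _ := by positivity
  b_nonneg _ _ := by positivity
  m_nonneg _ _ := le_rfl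
  w_nonneg _ _ := le_rfl
  a_ctr _ := by simp [ctr]
  b_ctr _ := by simp [ctr]
  m_ctr _ := rfl
  w_ctr _ _ := rfl
  a_finish _ r := by simp [finish, r.2.1]
  m_finish _ _ := rfl
  b_start _ r := by simp [start, r.2.1]
  m_start _ _ := rfl
  a_start _ _ := by simp [start, finish]
  w_start _ _ := rfl
  w_edge _ _ := rfl
  a_edge _ _ := by simp [edge]
  b_edge _ _ := by simp [edge]
  m_edge _ _ := rfl

open Classical in
/-- The weight of the star of a side. -/
noncomputable def side (hbar : Function.Involutive bar) (σ : Equiv.Perm L) (e₀ : L) :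
    StarWeight bar σ where
  a _ _ := 0
  b _ _ := 0
  m e q := if e = e₀ ∨ e = bar e₀ then 24 * min q.1.1 q.1.2 else 0
  w _ _ := 0
  continuous_a _ := continuous_const
  continuous_b _ := continuous_const
  continuous_m _ := by split_ifs <;> fun_prop
  continuous_w _ := continuous_const
  a_nonneg _ _ := le_rfl
  b_nonneg _ _ := le_rfl
  m_nonneg _ q := by
    have := le_min q.2.1 q.2.2.1
    split_ifs <;> positivity
  w_nonneg _ _ := le_rfl
  a_ctr _ := rfl
  b_ctr _ := rfl
  m_ctr _ := by simp [ctr]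
  w_ctr _ _ := rfl
  a_finish _ _ := rfl
  m_finish _ r := by simp [finish, r.2.1]
  b_start _ _ := rfl
  m_start _ r := by simp [start, r.2.1]
  a_start _ _ := rfl
  w_start _ _ := rfl
  w_edge _ _ := rfl
  a_edge _ _ := rfl
  b_edge _ _ := rfl
  m_edge e t := by
    have : (bar e = e₀ ∨ bar e = bar e₀) ↔ (e = e₀ ∨ e = bar e₀) := by
      rw [hbar.injective.eq_iff, hbar.eq_iff, or_comm]
    simp only [this]
    simp [edge, min_comm]

lemma center_flow {e : L} {q : Triangle} (h : 1 < (center bar σ).total e q) :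
    (center bar σ).flow e q 1 = ctr := by
  have h2 := scale_eq _ h
  have h3 : (center bar σ).total e q = 3 * (1 - q.1.1 - q.1.2) := by simp [total, center]
  rw [h3] at h2
  ext
  · simp only [flow, Set.Icc.coe_one]
    simp only [center, ctr] at h2 ⊢
    linear_combination (-q.1.1) * h2
  · simp only [flow, Set.Icc.coe_one]
    simp only [center, ctr] at h2 ⊢
    linear_combination (-q.1.2) * h2

lemma vertex_flow {e : L} {q : Triangle} (h : 1 < (vertex bar σ).total e q) :
    (vertex bar σ).flow e q 1 = start 1 ∨ (vertex bar σ).flow e q 1 = finish 1 := by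
  have h2 := scale_eq _ h
  have h3 : (vertex bar σ).total e q = 2 * max (q.1.1 - q.1.2) 0 + 2 * max (q.1.2 - q.1.1) 0 := by
    simp [total, vertex]
  rw [h3] at h2
  rcases le_total q.1.1 q.1.2 with hq | hq
  · right
    have e1 : max (q.1.1 - q.1.2) 0 = 0 := max_eq_right (by linarith)
    rw [e1] at h2
    ext
    · simp only [flow, Set.Icc.coe_one]
      simp only [vertex, finish, e1] at h2 ⊢
      linear_combination (-q.1.1) * h2
    · simp only [flow, Set.Icc.coe_one]
      simp only [vertex, finish, e1, Set.Icc.coe_one] at h2 ⊢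
      linear_combination (1 - q.1.2) * h2
  · left
    have e1 : max (q.1.2 - q.1.1) 0 = 0 := max_eq_right (by linarith)
    rw [e1] at h2
    ext
    · simp only [flow, Set.Icc.coe_one]
      simp only [vertex, start, e1, Set.Icc.coe_one] at h2 ⊢
      linear_combination (1 - q.1.1) * h2
    · simp only [flow, Set.Icc.coe_one]
      simp only [vertex, start, e1] at h2 ⊢
      linear_combination (-q.1.2) * h2

lemma side_flow {hbar : Function.Involutive bar} {e₀ e : L} {q : Triangle}
    (h : 1 < (side hbar σ e₀).total e q) :
    (e = e₀ ∨ e = bar e₀) ∧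
      (side hbar σ e₀).flow e q 1 = edge ⟨1 / 2, by norm_num, by norm_num⟩ := by
  have he : e = e₀ ∨ e = bar e₀ := by
    by_contra hc
    simp only [total, side, if_neg hc] at h
    norm_num at h
  have h2 := scale_eq _ h
  have h3 : (side hbar σ e₀).total e q = (side hbar σ e₀).m e q := by simp [total, side]
  rw [h3] at h2
  refine ⟨he, ?_⟩
  have ha : (side hbar σ e₀).a e q = 0 := rfl
  have hb : (side hbar σ e₀).b e q = 0 := rfl
  have hw : (side hbar σ e₀).w e q = 0 := rfl
  ext
  · simp only [flow, Set.Icc.coe_one, ha, hb, hw, edge]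
    linear_combination (1 / 2 - q.1.1) * h2
  · simp only [flow, Set.Icc.coe_one, ha, hb, hw, edge]
    linear_combination (1 / 2 - q.1.2) * h2

end StarWeight

namespace SectorSurface

variable {F} {A : Set L}

/-- A path homomorphism which is trivial on all paths in the sectors of a region is trivial on all
paths in this region. -/
theorem eq_one_of_sectors (hr : IsRegularGluing bar σ)
    (hF : ∀ e ∈ A, ∀ {q q' : Triangle} (δ : Path q q'), F.comap (sector bar σ e) δ = 1)
    {x y : SectorSurface bar σ} (γ : Path x y)
    (hA : ∀ t, ∃ a : L × Triangle, a.1 ∈ A ∧ Quot.mk _ a = γ t) : F γ = 1 := by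
  let X : Set (SectorSurface bar σ) := {x | ∃ a : L × Triangle, a.1 ∈ A ∧ Quot.mk _ a = x}
  let ι := {V : StarWeight bar σ //
    ∃ c : SectorSurface bar σ, ∀ e q, 1 < V.total e q → Quot.mk _ (e, V.flow e q 1) = c}
  have key := (F.comap (⟨Subtype.val, continuous_subtype_val⟩ : C(X, _))).eq_one_of_cover
    (fun V : ι => {x | 1 < V.1.totalMap x})
    (fun V => isOpen_lt continuous_const (V.1.continuous_totalMap.comp continuous_subtype_val))
    ?_ (fun V a b δ hδ => ?_) (γ.restrictTo hA)
  · rw [← key]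
    exact F.congr _ _ fun t => rfl
  · rintro ⟨_, ⟨e, q⟩, he, rfl⟩
    -- The stars of the center, the vertex and the sides cover the surface: outside the first two,
    -- `s + f ≥ 2/3` and `|s - f| ≤ 1/2`, so that `24 * min s f ≥ 2`.
    by_cases h1 : 1 < 3 * (1 - q.1.1 - q.1.2)
    · refine ⟨⟨.center bar σ, Quot.mk _ (e, ctr), fun e' q' h => ?_⟩, ?_⟩
      · rw [StarWeight.center_flow h]
        exact Quot.sound (.center e' e)
      · change 1 < StarWeight.total _ e q
        simpa [StarWeight.total, StarWeight.center] using h1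
    by_cases h2 : 1 < 2 * max (q.1.1 - q.1.2) 0 + 2 * max (q.1.2 - q.1.1) 0
    · exact ⟨⟨.vertex bar σ, Quot.mk _ (e, start 1), fun e' q' h =>
        vertex_eq hr (StarWeight.vertex_flow h) (Or.inl rfl)⟩, by
        change 1 < StarWeight.total _ e q
        simpa [StarWeight.total, StarWeight.vertex] using h2⟩
    · refine ⟨⟨.side hr.bar_bar σ e, Quot.mk _ (e, edge ⟨1 / 2, by norm_num, by norm_num⟩),
        fun e' q' h => ?_⟩, ?_⟩
      · obtain ⟨h3, h4⟩ := StarWeight.side_flow h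
        rw [h4]
        rcases h3 with rfl | rfl
        · rfl
        · exact (side_eq rfl (by simp [edge]) (by simp [edge]; norm_num)
            (by simp [edge]; norm_num)).symm
      · change 1 < StarWeight.total _ e q
        simp only [StarWeight.total, StarWeight.side, true_or, if_true]
        have h3 := le_max_left (q.1.1 - q.1.2) 0
        have h4 := le_max_left (q.1.2 - q.1.1) 0
        have h5 := le_max_right (q.1.1 - q.1.2) 0
        have h6 := le_max_right (q.1.2 - q.1.1) 0
        rcases min_choice q.1.1 q.1.2 with h7 | h7 <;> rw [h7] <;> linarith
  · obtain ⟨c, hc⟩ := V.2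
    exact V.1.eq_one hF hc (δ.map continuous_subtype_val) hδ fun t => (δ t).2

end SectorSurface

end Trivialization

/-! ### Extension over the disk and the proof of the theorem. -/

section Stabilization

open Topology CategoryTheory

namespace PathHom

variable {X : Type*} [TopologicalSpace X] {G : Type*} [Group G]

/-- The trivial path homomorphism. -/
def trivial (X : Type*) [TopologicalSpace X] (G : Type*) [Group G] : PathHom X G where
  toFun _ := 1
  map_trans _ _ := (mul_one 1).symm
  map_homotopic _ := rfl

/-- A path homomorphism which extends a representation of the fundamental group. -/
theorem exists_of_monoidHom [PathConnectedSpace X] {x : X} (ρ : FundamentalGroup X x →* G) :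
    ∃ F : PathHom X G, ∀ y, ∃ w : Path x y, ∀ γ : Path y y,
      ρ ((FundamentalGroup.fundamentalGroupMulEquivOfPath w).symm
        (Path.Homotopic.Quotient.mk γ)) = (F γ)⁻¹ := by
  let φ : ∀ a : X, FundamentalGroupoid.mk x ⟶ FundamentalGroupoid.mk a := fun a =>
    Path.Homotopic.Quotient.mk (PathConnectedSpace.somePath x a)
  let m : ∀ {a b : X}, Path a b → (FundamentalGroupoid.mk a ⟶ FundamentalGroupoid.mk b) :=
    fun γ => Path.Homotopic.Quotient.mk γ
  let κ : ∀ {a b : X}, Path a b → FundamentalGroup X x := fun {a b} γ =>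
    φ a ≫ m γ ≫ Groupoid.inv (φ b)
  refine ⟨⟨fun γ => (ρ (κ γ))⁻¹, fun {a b c} γ δ => ?_, fun {a b γ δ} h => ?_⟩, fun y => ?_⟩
  · rw [← mul_inv_rev, ← map_mul]
    congr 2
    have : m (γ.trans δ) = m γ ≫ m δ := rfl
    change φ a ≫ m (γ.trans δ) ≫ Groupoid.inv (φ c) =
      (φ a ≫ m γ ≫ Groupoid.inv (φ b)) ≫ (φ b ≫ m δ ≫ Groupoid.inv (φ c))
    rw [this]
    simp
  · have : m γ = m δ := Quotient.sound h
    simp only [κ, this]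
  · refine ⟨PathConnectedSpace.somePath x y, fun γ => ?_⟩
    rw [inv_inv]
    rfl

/-- The representation of the fundamental group given by a path homomorphism. -/
theorem exists_monoidHom (F : PathHom X G) (y : X) :
    ∃ ρ : FundamentalGroup X y →* G, ∀ γ : Path y y, ρ (Path.Homotopic.Quotient.mk γ) = (F γ)⁻¹ := by
  let f : FundamentalGroup X y → G := fun p => (Quotient.lift (fun γ => F γ) (fun _ _ h => F.map_homotopic h) p)⁻¹
  refine ⟨MonoidHom.mk' f fun p q => ?_, fun γ => rfl⟩
  induction p using Path.Homotopic.Quotient.ind with | mk p => ?_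
  induction q using Path.Homotopic.Quotient.ind with | mk q => ?_
  -- The product in the fundamental group traverses the right factor first, whereas `F` multiplies
  -- in the order of traversal; the inverse compensates for this.
  change (F (q.trans p))⁻¹ = (F p)⁻¹ * (F q)⁻¹
  rw [F.map_trans, mul_inv_rev]

end PathHom

/-- The radial projection of the disk to the boundary circle. -/
noncomputable def radialProj (z : ClosedDisk) : ClosedDisk :=
  ⟨z / ‖(z : ℂ)‖, by
    rw [norm_div, Complex.norm_real, norm_norm]
    exact div_self_le_one _⟩

lemma norm_radialProj {z : ClosedDisk} (hz : (z : ℂ) ≠ 0) : ‖(radialProj z : ℂ)‖ = 1 := by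
  rw [radialProj, norm_div, Complex.norm_real, norm_norm, div_self (norm_ne_zero_iff.2 hz)]

lemma radialProj_eq {z : ClosedDisk} (hz : ‖(z : ℂ)‖ = 1) : radialProj z = z := by
  apply Subtype.ext
  simp [radialProj, hz]

lemma continuousOn_radialProj : ContinuousOn radialProj {z | (z : ℂ) ≠ 0} := by
  rw [IsEmbedding.subtypeVal.continuousOn_iff]
  refine ContinuousOn.div (by fun_prop) (by fun_prop) fun z hz => ?_
  simpa using hz

/-- A surface minus an open disk is a retract of the surface minus a point. -/
theorem exists_retraction {M : Type*} [TopologicalSpace M] [T2Space M] {d : ClosedDisk → M}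
    (hd : IsEmbedding d) (ho : IsOpen (d '' {z | ‖(z : ℂ)‖ < 1})) :
    ∃ r : C({m : M | m ≠ d ⟨0, by simp⟩}, RemoveDisk d),
      (∀ (m : {m : M | m ≠ d ⟨0, by simp⟩}) (n : RemoveDisk d), (m : M) = n → r m = n) ∧
      ∀ m : {m : M | m ≠ d ⟨0, by simp⟩}, (m : M) ∈ d '' {z | ‖(z : ℂ)‖ < 1} →
        ∃ (z : ClosedDisk) (hz : ‖(z : ℂ)‖ = 1), r m = RemoveDisk.boundary d hd.injective z hz := by
  classical
  let r : M → M := fun m => if h : ∃ z, d z = m then d (radialProj h.choose) else m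
  have hrd : ∀ z, r (d z) = d (radialProj z) := fun z => by
    have h : ∃ z', d z' = d z := ⟨z, rfl⟩
    simp only [r, dif_pos h]
    rw [hd.injective h.choose_spec]
  have hrn : ∀ m, m ∉ Set.range d → r m = m := fun m hm => dif_neg hm
  have hid : ∀ m, m ∉ d '' {z | ‖(z : ℂ)‖ < 1} → r m = m := fun m hm => by
    by_cases h : m ∈ Set.range d
    · obtain ⟨z, rfl⟩ := h
      rw [hrd, radialProj_eq]
      exact le_antisymm z.2 (not_lt.1 fun hz => hm ⟨z, hz, rfl⟩)
    · exact hrn m h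
  have hne : ∀ z : ClosedDisk, d z ≠ d ⟨0, by simp⟩ → (z : ℂ) ≠ 0 := fun z hz h =>
    hz (congrArg d (Subtype.ext h))
  have hmem : ∀ m, m ≠ d ⟨0, by simp⟩ → r m ∉ d '' {z | ‖(z : ℂ)‖ < 1} := fun m hm => by
    by_cases h : m ∈ Set.range d
    · obtain ⟨z, rfl⟩ := h
      rw [hrd]
      exact (RemoveDisk.boundary d hd.injective _ (norm_radialProj (hne z hm))).2
    · rw [hrn m h]
      rintro ⟨z, -, rfl⟩
      exact h ⟨z, rfl⟩
  have c1 : ContinuousOn r (d '' {z | ‖(z : ℂ)‖ < 1})ᶜ := continuousOn_id.congr fun m hm => hid m hm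
  have c2 : ContinuousOn r (d '' {z | (z : ℂ) ≠ 0}) := by
    rw [hd.isInducing.continuousOn_image_iff]
    exact (hd.continuous.comp_continuousOn continuousOn_radialProj).congr fun z _ => hrd z
  have cl : IsClosed (Set.range d) := (isCompact_range hd.continuous).isClosed
  -- The punctured space is the union of two relatively closed sets, the complement of the open disk
  -- and the punctured closed disk, and `r` is continuous on each.
  have c : ContinuousOn r {m | m ≠ d ⟨0, by simp⟩} := by
    intro m hm
    refine ContinuousWithinAt.mono
      (t := (d '' {z | ‖(z : ℂ)‖ < 1})ᶜ ∪ d '' {z | (z : ℂ) ≠ 0}) (.union ?_ ?_) ?_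
    · by_cases h : m ∈ (d '' {z | ‖(z : ℂ)‖ < 1})ᶜ
      · exact c1 m h
      · refine continuousWithinAt_of_notMem_closure ?_
        rwa [ho.isClosed_compl.closure_eq]
    · by_cases h : m ∈ Set.range d
      · obtain ⟨z, rfl⟩ := h
        exact c2 _ ⟨z, hne z hm, rfl⟩
      · exact continuousWithinAt_of_notMem_closure fun h' =>
          h (closure_minimal (Set.image_subset_range _ _) cl h')
    · intro n hn
      by_cases h : n ∈ Set.range d
      · obtain ⟨z, rfl⟩ := h
        exact Or.inr ⟨z, hne z hn, rfl⟩
      · exact Or.inl fun ⟨z, _, hz⟩ => h ⟨z, hz⟩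
  refine ⟨⟨fun m => ⟨r m, hmem m m.2⟩, c.domRestrict.subtype_mk _⟩, fun m n h => ?_, fun m h => ?_⟩
  · refine Subtype.ext ?_
    change r m = n
    rw [h]
    exact hid _ n.2
  · obtain ⟨⟨_, hm⟩, z, -, rfl⟩ := m, h
    exact ⟨_, norm_radialProj (hne z hm), Subtype.ext (hrd z)⟩

namespace ConnectedSumDecomposition

variable {S M N : Type*} [TopologicalSpace S] [TopologicalSpace M] [TopologicalSpace N] [T2Space M]
  {G : Type*} [Group G]

/-- A path homomorphism which is trivial on the second piece extends from the first piece to the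
surface with a disk instead of the second piece. -/
theorem exists_extension (D : ConnectedSumDecomposition S M N)
    (ho : IsOpen (D.dM '' {z | ‖(z : ℂ)‖ < 1})) (F : PathHom S G)
    (hF : ∀ {a b : RemoveDisk D.dN} (γ : Path a b), F.comap D.iN γ = 1) :
    ∃ F' : PathHom M G, ∀ {a b : RemoveDisk D.dM} (γ : Path a b),
      F'.comap D.inclM γ = F.comap D.iM γ := by
  obtain ⟨r, hr, hb⟩ := exists_retraction D.isEmbedding_dM ho
  -- The cover consists of the surface punctured at the center of the disk, with `F` pulled back
  -- along the retraction, and of the open disk, with the trivial homomorphism.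
  let W : Bool → Set M := fun i =>
    bif i then {m | m ≠ D.dM ⟨0, by simp⟩} else D.dM '' {z | ‖(z : ℂ)‖ < 1}
  let E : ∀ i, PathHom (W i) G := fun i => match i with
    | true => (F.comap D.iM).comap r
    | false => PathHom.trivial _ G
  -- On the overlap the retraction lands in the boundary curve, which also belongs to the second
  -- piece, where `F` is trivial.
  have key : ∀ {a b : M} (γ : Path a b) (h : ∀ t, γ t ∈ W true), (∀ t, γ t ∈ W false) →
      E true (γ.restrictTo h) = 1 := by
    intro a b γ h h'
    have hz : ∀ t, ∃ n, D.iN n = D.iM (r ⟨γ t, h t⟩) := fun t => by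
      obtain ⟨z, hz, e⟩ := hb ⟨γ t, h t⟩ (h' t)
      exact ⟨_, by rw [e, D.glue z hz]⟩
    choose n hn using hz
    have hc : Continuous n := by
      rw [D.isEmbedding_iN.continuous_iff, show D.iN ∘ n = fun t => D.iM (r ⟨γ t, h t⟩) from funext hn]
      fun_prop
    rw [← hF ⟨⟨n, hc⟩, rfl, rfl⟩]
    exact F.congr _ _ fun t => (hn t).symm
  have hW : ∀ i, IsOpen (W i) := fun i => by
    cases i
    · exact ho
    · exact isOpen_ne
  have hcov : ∀ m, ∃ i, m ∈ W i := fun m => by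
    by_cases h : m = D.dM ⟨0, by simp⟩
    · exact ⟨false, ⟨0, by simp⟩, by simp, h.symm⟩
    · exact ⟨true, h⟩
  have hE : ∀ i j {a b : M} (γ : Path a b) (hi : ∀ t, γ t ∈ W i) (hj : ∀ t, γ t ∈ W j),
      E i (γ.restrictTo hi) = E j (γ.restrictTo hj) := by
    intro i j a b γ hi hj
    cases i <;> cases j
    · rfl
    · exact (key γ hj hi).symm
    · exact key γ hi hj
    · rfl
  obtain ⟨F', hF'⟩ := PathHom.exists_glue hW hcov hE
  refine ⟨F', fun {a b} γ => ?_⟩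
  have h : ∀ t, γ.map D.inclM.continuous t ∈ W true := fun t h0 =>
    (γ t).2 ⟨⟨0, by simp⟩, by simp, h0.symm⟩
  refine (hF' true _ h).trans (F.congr _ _ fun t => ?_)
  exact congrArg D.iM (hr ⟨_, h t⟩ (γ t) rfl)

end ConnectedSumDecomposition

lemma isRegularGluing_join (g : ℕ) :
    IsRegularGluing (Sum.map (stdBar (g := g + 1)) (stdBar (g := 1)))
      (joinPerm (letterNext (g + 1)) (letterNext 1) (stdFirst g) (stdFirst 0)) := by
  obtain ⟨τ, hbar, hσ, -⟩ := exists_splitEquiv g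
  exact (isRegularGluing_std (by omega)).of_equiv τ hbar hσ

instance {g : ℕ} : PathConnectedSpace (StandardSurface g) := by
  have : PathConnectedSpace ClosedDisk := by
    have h : Convex ℝ {z : ℂ | ‖z‖ ≤ 1} := by
      simpa [Metric.closedBall] using convex_closedBall (0 : ℂ) 1
    exact isPathConnected_iff_pathConnectedSpace.1 (h.isPathConnected ⟨0, by simp⟩)
  exact Quot.mk_surjective.pathConnectedSpace continuous_quot_mk

lemma exists_sectorChart {g : ℕ} (hg : 0 < g) :
    T2Space (StandardSurface g) ∧
      ∃ p, SectorChart (stdBar (g := g)) (letterNext g) (X := StandardSurface g) p := by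
  obtain ⟨h⟩ := nonempty_sectorSurface_homeomorph hg
  have := SectorSurface.t2Space (isRegularGluing_std hg)
  exact ⟨h.symm.t2Space, _, (isRegularGluing_std hg).sectorChart h.symm⟩

open SectorSurface Triangle in
/-- A path homomorphism with trivial labels in the second part of a word is a stabilization. -/
theorem exists_stabilization {S : Type*} [TopologicalSpace S] {G : Type*} [Group G] {g : ℕ}
    {F : PathHom S G} {ℓ : StdLetter (g + 1) ⊕ StdLetter 1 → G}
    (hF : Presents F (Sum.map stdBar stdBar)
      (joinPerm (letterNext (g + 1)) (letterNext 1) (stdFirst g) (stdFirst 0)) ℓ)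
    (hℓ : ∀ e, ℓ (.inr e) = 1) :
    ∃ (D : ConnectedSumDecomposition S (StandardSurface (g + 1)) (StandardSurface 1))
      (F' : PathHom (StandardSurface (g + 1)) G),
      (∀ γ : Path D.baseM D.baseM, F.comap D.iM γ = F'.comap D.inclM γ) ∧
      ∀ γ : Path D.baseN D.baseN, F.comap D.iN γ = 1 := by
  obtain ⟨h, hh⟩ := hF
  obtain ⟨_, p, hp⟩ := exists_sectorChart g.succ_pos
  obtain ⟨_, p', hp'⟩ := exists_sectorChart one_pos
  have hr := isRegularGluing_join g
  have := SectorSurface.t2Space hr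
  have : T2Space S := h.t2Space
  obtain ⟨D, ho, hN, hbase⟩ := exists_connectedSumDecomposition hp hp' (hr.sectorChart h)
  set F₀ := F.comap (h : C(SectorSurface (Sum.map stdBar stdBar)
    (joinPerm (letterNext (g + 1)) (letterNext 1) (stdFirst g) (stdFirst 0)), S)) with hF₀
  have hl : ∀ e ∈ Set.range Sum.inr, label F₀ e = 1 := by
    rintro _ ⟨e, rfl⟩
    rw [hh, hℓ]
  -- Crossing a sector with trivial label does not change the spoke value. The step back to the
  -- initial letter, where the joined order leaves the second word, is not needed.
  have hκ : ∀ e ∈ Set.range Sum.inr, spokeValue F₀ e = spokeValue F₀ (.inr (stdFirst 0)) := by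
    rintro _ ⟨e, rfl⟩
    refine (isRegularGluing_std one_pos).transitive
      (fun e => spokeValue F₀ (.inr e) = spokeValue F₀ (.inr (stdFirst 0))) ⟨_, rfl⟩ (fun e he => ?_) e
    by_cases hc : letterNext 1 e = stdFirst 0
    · rw [hc]
    · have h1 := spokeValue_mul_label F₀ (.inr e)
      rw [hl _ ⟨e, rfl⟩, mul_one, joinPerm_inr, if_neg hc] at h1
      rw [← h1, he]
  obtain ⟨u, hu, hs⟩ := exists_gauge F₀ hr (Set.mem_range_self (stdFirst 0)) hκ hl
  have hgauge : ∀ {a b : S} (γ : Path a b), F.gauge (u ∘ h.symm) γ =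
      F₀.gauge u (γ.map h.symm.continuous) := fun {a b} γ => by
    rw [PathHom.gauge_apply, PathHom.gauge_apply, hF₀, PathHom.comap_apply]
    congr 2
    exact F.congr _ _ fun t => (h.apply_symm_apply _).symm
  have htriv : ∀ {a b : RemoveDisk D.dN} (γ : Path a b), (F.gauge (u ∘ h.symm)).comap D.iN γ = 1 := by
    intro a b γ
    rw [PathHom.comap_apply, hgauge]
    refine eq_one_of_sectors hr hs _ fun t => ?_
    obtain ⟨c, hc⟩ := hN (γ t)
    exact ⟨(.inr c.1, c.2), ⟨c.1, rfl⟩, by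
      change _ = h.symm (D.iN (γ t))
      rw [hc, h.symm_apply_apply]⟩
  -- The change of trivialization is 1 at the base point, which is the vertex, so it does not affect
  -- loops there.
  have hb : u (h.symm D.base) = 1 := by rw [hbase, h.symm_apply_apply, hu]
  have hloop : ∀ {a b : S} (γ : Path a b), a = D.base → b = D.base →
      F.gauge (u ∘ h.symm) γ = F γ := by
    rintro _ _ γ rfl rfl
    rw [PathHom.gauge_apply, Function.comp_apply, hb, one_mul, inv_one, mul_one]
  obtain ⟨F', hF'⟩ := D.exists_extension ho (F.gauge (u ∘ h.symm)) htriv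
  refine ⟨D, F', fun γ => ?_, fun γ => ?_⟩
  · rw [hF', PathHom.comap_apply, PathHom.comap_apply]
    exact (hloop _ rfl rfl).symm
  · rw [← htriv γ, PathHom.comap_apply, PathHom.comap_apply]
    exact (hloop _ D.iN_baseN D.iN_baseN).symm

theorem mainTheorem8 {G : Type*} [Group G] [Finite G] (J R : ℕ) (hG : HasJordanSizeAtMost G J R)
    (g : ℕ) (hg : J + R + 1 ≤ g) {S : Type*} [TopologicalSpace S] (hS : IsClosedSurface g S)
    (x : S) (ρ : FundamentalGroup S x →* G) : IsStabilization g ρ := by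
  obtain ⟨k⟩ := hS
  have : PathConnectedSpace S := k.symm.surjective.pathConnectedSpace k.symm.continuous
  obtain ⟨F, hF⟩ := PathHom.exists_of_monoidHom ρ
  -- The quotient is nonempty, so `J ≥ 1` and the genus is at least 2. Both summands then have
  -- positive genus, as the sector model requires.
  have hJ : 1 ≤ J := by
    obtain ⟨A, -, -, -, hA⟩ := hG
    exact Nat.card_pos.trans_le hA
  obtain ⟨g, rfl⟩ : ∃ g', g = 1 + (g' + 1) := ⟨g - 2, by omega⟩
  obtain ⟨k'⟩ := nonempty_sectorSurface_homeomorph (g := 1 + (g + 1)) (by omega)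
  obtain ⟨T, hTl, hT⟩ := exists_handlesPresent F (k'.symm.trans k.symm)
  obtain ⟨T', hT'⟩ := hG.exists_trivial_handle T (by omega)
  have hbar := stdBar_involutive (1 + (g + 1))
  obtain ⟨ℓ, hℓ, hℓ1⟩ := (hT.of_rel hbar hT').exists_presents hbar (hT'.length_eq.symm.trans hTl)
  -- The trivial handle heads the list, and handle 0 is the one split off as the torus.
  obtain ⟨ℓ', hℓ', hℓ1'⟩ := hℓ.split fun j => hℓ1 _ j rfl
  obtain ⟨D, F', hM, hN⟩ := exists_stabilization hℓ' hℓ1'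
  obtain ⟨w, hw⟩ := hF D.base
  obtain ⟨ρ', hρ'⟩ := F'.exists_monoidHom (D.inclM D.baseM)
  refine ⟨g + 1, 1, by omega, le_rfl, D, w, ρ', fun γ => ?_, fun γ => ?_⟩
  · induction γ using Path.Homotopic.Quotient.ind with | mk γ => ?_
    exact (hw (γ.map D.iM.continuous)).trans
      ((congrArg _ (hM γ)).trans (hρ' (γ.map D.inclM.continuous)).symm)
  · induction γ using Path.Homotopic.Quotient.ind with | mk γ => ?_
    rw [FundamentalGroup.mapOfEq_apply]
    refine (hw ((γ.map D.iN.continuous).cast D.iN_baseN.symm D.iN_baseN.symm)).trans ?_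
    rw [inv_eq_one]
    exact (F.congr ((γ.map D.iN.continuous).cast D.iN_baseN.symm D.iN_baseN.symm)
      (γ.map D.iN.continuous) fun t => rfl).trans (hN γ)

end Stabilization
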